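/- Let $G$ be a finite group, and let $\mathrm{Mack}(G)$ be the category of rational $G$-Mackey functors: rational vector spaces $M(G/H)$ for $H\le G$ with restrictions $R^H_K$, inductions $I^H_K$ ($K\le H$) and conjugations $C_g\colon M(G/H)\to M(G/gHg^{-1})$ satisfying the usual axioms, including the Mackey double coset axiom. It is symmetric monoidal under the box product $$(M\,\square\,N)(G/H)=\Big(\bigoplus_{K\le H}M(G/K)\otimes_{\mathbb Q}N(G/K)\Big)\Big/ I(H),$$ where $I(H)$ is spanned by $R^K_L(x)\otimes y'-x\otimes I^K_L(y')$ and $x'\otimes R^K_L(y)-I^K_L(x')\otimes y$ for $L\le K\le H$, and $C_h(x)\otimes y-x\otimes C_h^{-1}(y)$ for $K\le H$, $h\in H$, $x\in M(G/K)$, $y\in N(G/hKh^{-1})$. Conjugation is diagonal, induction is induced by the inclusion of summands, and restriction from $H'$ to $H$ sends $x\otimes y$ in the summand of $K\le H'$ to $\sum_{l\in[H\backslash H'/K]}R_{H\cap lKl^{-1}}C_l(x)\otimes R_{H\cap lKl^{-1}}C_l(y)$. The unit is the rational Burnside ring Mackey functor $A_{\mathbb Q}$, and the symmetry is $x\otimes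 y\mapsto y\otimes x$. The ring $A_{\mathbb Q}(H)$ acts on $M(G/H)$, with $[H/K]$ acting as $I^H_KR^H_K$. For $H\le G$ let $e_H^G\in A_{\mathbb Q}(G)$ be the idempotent whose mark at $K\le G$ (the linear extension of $[X]\mapsto|X^K|$) is $1$ if $K$ is conjugate to $H$ and $0$ otherwise. Let $e_H^GM\subseteq M$ be the Mackey functor with $(e_H^GM)(G/K)=R^G_K(e_H^G)\,M(G/K)$, and let $e_H^G\mathrm{Mack}(G)$ be the full subcategory of those $M$ with $M=e_H^GM$. It is symmetric monoidal under $\square$, with unit $e_H^GA_{\mathbb Q}$. Let $W_GH=N_GH/H$, and let $\mathbb Q[W_GH]\text{-mod}$ have the tensor product over $\mathbb Q$ with diagonal action. Define $$U_H\colon e_H^G\mathrm{Mack}(G)\to\mathbb Q[W_GH]\text{-mod},\qquad U_H(M)=M(G/H),$$ with $W_GH$ acting by the conjugation maps, and $$F_H\colon\mathbb Q[W_GH]\text{-mod}\to e_H^G\mathrm{Mack}(G),\qquad F_H(V)(G/K)=\big(\mathbb Q[(G/K)^H]\otimes V\big)^{W_GH}.$$ In terms of the components $y_\sigma\in V$,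 $\sigma\in(G/K)^H$, of an element $y$, the structure maps of $F_H(V)$ are $(R^K_Ly)_\sigma=y_{\alpha(\sigma)}$ and $(I^K_Ly)_\tau=\sum_{\alpha(\sigma)=\tau}y_\sigma$, where $\alpha\colon G/L\to G/K$ is the projection for $L\le K$, and $(C_gy)_{x\,gKg^{-1}}=y_{xgK}$. **Corollary.** (1) For each $H\le G$, the functor $U_H$ is left adjoint to $F_H$ and is an equivalence of categories. Both $U_H$ and $F_H$ are strong symmetric monoidal, compatibly with the adjunction (that is, the adjunction is monoidal). The structure map $U_H(M)\otimes_{\mathbb Q}U_H(N)\cong U_H(M\,\square\,N)$ is $x\otimes y\mapsto[x\otimes y]$, the class of $x\otimes y$ in the summand of $K=H$. (2) The functor $$\mathrm{Mack}(G)\longrightarrow\prod_{(H)}e_H^G\mathrm{Mack}(G),\qquad M\mapsto(e_H^GM)_{(H)},$$ where the product has one factor for each conjugacy class of subgroups of $G$ and the componentwise monoidal structure, is an equivalence of categories and is strong symmetric monoidal. The structure maps $e_H^GM\,\square\,e_H^GN\cong e_H^G(M\,\square\,N)$ are those induced by the inclusions $e_H^GM\subseteq M$ and $e_H^GN\subseteq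 N$. -/

import Mathlib

open CategoryTheory MonoidalCategory TensorProduct
open scoped Pointwise

namespace RatMackey

noncomputable section

attribute [local instance 5] Fintype.ofFinite

/-! ### Sums over double cosets -/

section Groups

variable {G : Type} [Group G]

/-- The conjugate subgroup `g H g⁻¹`. -/
abbrev conjSub (g : G) (H : Subgroup G) : Subgroup G := MulAut.conj g • H

lemma mem_conjSub {g x : G} {H : Subgroup G} : x ∈ conjSub g H ↔ g⁻¹ * x * g ∈ H := by
  rw [Subgroup.mem_pointwise_smul_iff_inv_smul_mem, ← map_inv]
  simp [MulAut.smul_def]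

lemma conjSub_mul (g h : G) (H : Subgroup G) :
    conjSub (g * h) H = conjSub g (conjSub h H) := by
  simp [conjSub, mul_smul]

lemma conjSub_one (H : Subgroup G) : conjSub 1 H = H := by simp [conjSub]

lemma conjSub_of_mem {h : G} {H : Subgroup G} (hh : h ∈ H) : conjSub h H = H := by
  ext x
  rw [mem_conjSub, Subgroup.mul_mem_cancel_right _ hh,
    Subgroup.mul_mem_cancel_left _ (H.inv_mem hh)]

lemma conjSub_mono (g : G) {H K : Subgroup G} (h : H ≤ K) : conjSub g H ≤ conjSub g K := by
  intro x hx
  rw [mem_conjSub] at *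
  exact h hx

lemma conjSub_le_of_mem {g : G} {H K : Subgroup G} (h : K ≤ H) (hg : g ∈ H) :
    conjSub g K ≤ H := (conjSub_mono g h).trans (conjSub_of_mem hg).le

lemma conjSub_inf (g : G) (H K : Subgroup G) :
    conjSub g (H ⊓ K) = conjSub g H ⊓ conjSub g K := by
  ext x
  simp [Subgroup.mem_inf, mem_conjSub]

lemma le_conjSub_iff {g : G} {H K : Subgroup G} : H ≤ conjSub g K ↔ conjSub g⁻¹ H ≤ K := by
  constructor
  · intro h
    have := conjSub_mono g⁻¹ h
    rwa [← conjSub_mul, inv_mul_cancel, conjSub_one] at this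
  · intro h
    have := conjSub_mono g h
    rwa [← conjSub_mul, mul_inv_cancel, conjSub_one] at this

lemma inf_conjSub (g : G) (K L : Subgroup G) :
    K ⊓ conjSub g L = conjSub g (L ⊓ conjSub g⁻¹ K) := by
  rw [conjSub_inf, ← conjSub_mul, mul_inv_cancel, conjSub_one, inf_comm]

variable [Finite G]

/-- The order of a subgroup, as a rational number. -/
def ord (H : Subgroup G) : ℚ := Nat.card H

lemma ord_ne_zero (H : Subgroup G) : ord H ≠ 0 := by
  simp [ord]

lemma ord_conjSub (g : G) (H : Subgroup G) : ord (conjSub g H) = ord H := by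
  unfold ord
  rw [Nat.card_congr (Subgroup.equivSMul (MulAut.conj g) H).toEquiv.symm]

lemma orbit_sum {Γ X V : Type} [Group Γ] [Finite Γ] [MulAction Γ X] [Finite X]
    [AddCommGroup V] [Module ℚ V] (f : X → V) (hf : ∀ (g : Γ) x, f (g • x) = f x)
    {Q : Type} [Finite Q] (p : X → Q) (out : Q → X) (hp : ∀ q, p (out q) = q)
    (hpr : ∀ x y, p x = p y ↔ ∃ g : Γ, g • x = y) :
    ∑ q : Q, f (out q) =
      ∑ x : X, ((Nat.card (MulAction.stabilizer Γ x) : ℚ) / Nat.card Γ) • f x := by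
  classical
  rw [← Finset.sum_fiberwise_of_maps_to (t := Finset.univ) (g := p) (fun _ _ => Finset.mem_univ _)]
  refine Finset.sum_congr rfl fun q _ => ?_
  have key : ∀ x ∈ Finset.univ.filter (fun x => p x = q),
      ((Nat.card (MulAction.stabilizer Γ x) : ℚ) / Nat.card Γ) • f x =
        (Nat.card (MulAction.orbit Γ (out q)) : ℚ)⁻¹ • f (out q) := by
    intro x hx
    rw [Finset.mem_filter] at hx
    obtain ⟨g, rfl⟩ := (hpr (out q) x).1 ((hp q).trans hx.2.symm)
    rw [hf]
    congr 1
    have h1 := Nat.card_congr (MulAction.orbitProdStabilizerEquivGroup Γ (g • out q))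
    rw [Nat.card_prod, MulAction.orbit_smul] at h1
    have h2 : (Nat.card (MulAction.orbit Γ (out q)) : ℚ) ≠ 0 := by
      have : Nonempty (MulAction.orbit Γ (out q)) := ⟨⟨_, MulAction.mem_orbit_self _⟩⟩
      exact_mod_cast Nat.card_pos.ne'
    have h3 : (Nat.card Γ : ℚ) ≠ 0 := by exact_mod_cast Nat.card_pos.ne'
    field_simp
    exact_mod_cast (by rw [← h1, mul_comm])
  rw [Finset.sum_congr rfl key, Finset.sum_const]
  have hc : (Finset.univ.filter (fun x => p x = q)).card
      = Nat.card (MulAction.orbit Γ (out q)) := by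
    rw [Nat.card_coe_set_eq, ← Set.ncard_coe_finset]
    congr 1
    ext x
    simp only [Finset.coe_filter, Finset.mem_univ, true_and, Set.mem_setOf_eq]
    rw [MulAction.mem_orbit_iff]
    conv_lhs => rw [← hp q, eq_comm]
    exact hpr _ _
  rw [hc, ← Nat.cast_smul_eq_nsmul ℚ, smul_smul, mul_inv_cancel₀, one_smul]
  have : Nonempty (MulAction.orbit Γ (out q)) := ⟨⟨_, MulAction.mem_orbit_self _⟩⟩
  exact_mod_cast Nat.card_pos.ne'

instance (A B : Set G) : Finite (DoubleCoset.Quotient A B) :=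
  inferInstanceAs (Finite (_root_.Quotient _))

/-- A sum over representatives of the double cosets `A \\ Γ / B` as a weighted sum over `Γ`. -/
lemma doubleCoset_sum (A B : Subgroup G) {V : Type} [AddCommGroup V] [Module ℚ V]
    (f : G → V) (hf : ∀ a ∈ A, ∀ b ∈ B, ∀ x, f (a * x * b) = f x) :
    ∑ q : DoubleCoset.Quotient (A : Set G) (B : Set G), f q.out =
      ∑ x : G, (ord (A ⊓ conjSub x B) / (ord A * ord B)) • f x := by
  let _ : MulAction (A × B) G :=
    { smul := fun p x => p.1 * x * (p.2 : G)⁻¹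
      one_smul := fun x => by change (1 : G) * x * (1 : G)⁻¹ = x; simp
      mul_smul := fun p q x => by
        change (p.1 * q.1 : G) * x * (p.2 * q.2 : G)⁻¹ = p.1 * (q.1 * x * (q.2 : G)⁻¹) * (p.2 : G)⁻¹
        group }
  have hs : ∀ (p : A × B) (x : G), p • x = p.1 * x * (p.2 : G)⁻¹ := fun _ _ => rfl
  rw [orbit_sum (Γ := A × B) f (fun g x => by rw [hs]; exact hf _ g.1.2 _ (B.inv_mem g.2.2) x)
    (DoubleCoset.mk A B) (fun q => q.out) (fun q => DoubleCoset.out_eq' A B q)]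
  · refine Finset.sum_congr rfl fun x _ => ?_
    congr 2
    · unfold ord
      norm_cast
      refine Nat.card_congr ⟨fun p => ⟨p.1.1, p.1.1.2, ?_⟩, fun a => ⟨(⟨a, a.2.1⟩,
        ⟨x⁻¹ * a * x, mem_conjSub.1 a.2.2⟩), ?_⟩, ?_, ?_⟩
      · have := p.2
        rw [MulAction.mem_stabilizer_iff, hs] at this
        refine mem_conjSub.2 ?_
        convert p.1.2.2 using 1
        rw [mul_inv_eq_iff_eq_mul] at this
        rw [mul_assoc, this]; group
      · rw [MulAction.mem_stabilizer_iff, hs]; simp only; group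
      · rintro ⟨⟨a, b⟩, hp⟩
        rw [MulAction.mem_stabilizer_iff, hs] at hp
        ext
        · rfl
        · simp only at hp ⊢
          rw [mul_inv_eq_iff_eq_mul] at hp
          rw [mul_assoc, hp]; group
      · rintro ⟨a, ha⟩; rfl
    · unfold ord
      rw [Nat.card_prod]; push_cast; rfl
  · intro x y
    rw [DoubleCoset.eq]
    constructor
    · rintro ⟨a, ha, b, hb, rfl⟩
      exact ⟨(⟨a, ha⟩, ⟨b⁻¹, B.inv_mem hb⟩), by rw [hs]; simp⟩
    · rintro ⟨p, rfl⟩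
      exact ⟨p.1, p.1.2, (p.2 : G)⁻¹, B.inv_mem p.2.2, rfl⟩

/-- The same for subgroups `K, L ≤ H` of an ambient group. -/
lemma doubleCoset_sum' {K L H : Subgroup G} (hK : K ≤ H) (hL : L ≤ H) {V : Type}
    [AddCommGroup V] [Module ℚ V]
    (f : H → V) (hf : ∀ a b x : H, (a : G) ∈ K → (b : G) ∈ L → f (a * x * b) = f x) :
    ∑ q : DoubleCoset.Quotient (K.subgroupOf H : Set H) (L.subgroupOf H : Set H), f q.out =
      ∑ x : H, (ord (K ⊓ conjSub (x : G) L) / (ord K * ord L)) • f x := by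
  have ho : ∀ {S : Subgroup G}, S ≤ H → ord (S.subgroupOf H) = ord S := fun h => by
    unfold ord; rw [Nat.card_congr (Subgroup.subgroupOfEquivOfLe h).toEquiv]
  rw [doubleCoset_sum _ _ f (fun a ha b hb x => hf a b x ha hb)]
  refine Finset.sum_congr rfl fun x _ => ?_
  rw [ho hK, ho hL, ← ho (S := K ⊓ conjSub (x : G) L) (inf_le_left.trans hK)]
  congr 4
  ext y
  simp [Subgroup.mem_inf, mem_conjSub, Subgroup.mem_subgroupOf]

end Groups

/-! ### Rational Mackey functors -/

/-- The data of a rational Mackey functor with all its axioms except the Mackey axiom.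
`res`, `ind`, `conj` are restriction, induction and conjugation; `obj H` is the value at `G/H`.
The conjugation `C_g` is a map from `obj H` to `obj K` for every `K` equal to `g H g⁻¹`. -/
structure PreMackey (G : Type) [Group G] where
  obj : Subgroup G → Type
  [acg : ∀ H, AddCommGroup (obj H)]
  [mod : ∀ H, Module ℚ (obj H)]
  res : ∀ {K H : Subgroup G}, K ≤ H → obj H →ₗ[ℚ] obj K
  ind : ∀ {K H : Subgroup G}, K ≤ H → obj K →ₗ[ℚ] obj H
  conj : ∀ (g : G) {H K : Subgroup G}, K = conjSub g H → obj H →ₗ[ℚ] obj K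
  res_self : ∀ {H : Subgroup G} (x : obj H), res le_rfl x = x
  ind_self : ∀ {H : Subgroup G} (x : obj H), ind le_rfl x = x
  conj_self : ∀ {H : Subgroup G} {h : G} (_ : h ∈ H) (e : H = conjSub h H) (x : obj H),
    conj h e x = x
  ind_ind : ∀ {L K H : Subgroup G} (h₁ : L ≤ K) (h₂ : K ≤ H) (x : obj L),
    ind h₂ (ind h₁ x) = ind (h₁.trans h₂) x
  res_res : ∀ {L K H : Subgroup G} (h₁ : L ≤ K) (h₂ : K ≤ H) (x : obj H),
    res h₁ (res h₂ x) = res (h₁.trans h₂) x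
  conj_conj : ∀ (g h : G) {H K L : Subgroup G} (e₁ : K = conjSub h H) (e₂ : L = conjSub g K)
    (e₃ : L = conjSub (g * h) H) (x : obj H), conj g e₂ (conj h e₁ x) = conj (g * h) e₃ x
  conj_res : ∀ (g : G) {K H K' H' : Subgroup G} (eK : K' = conjSub g K) (eH : H' = conjSub g H)
    (h : K ≤ H) (h' : K' ≤ H') (x : obj H), res h' (conj g eH x) = conj g eK (res h x)
  conj_ind : ∀ (g : G) {K H K' H' : Subgroup G} (eK : K' = conjSub g K) (eH : H' = conjSub g H)
    (h : K ≤ H) (h' : K' ≤ H') (x : obj K), ind h' (conj g eK x) = conj g eH (ind h x)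

attribute [instance] PreMackey.acg PreMackey.mod

namespace PreMackey

variable {G : Type} [Group G] (M : PreMackey G)

/-- `R ∘ C_g : M(G/K) → M(G/S)` for `S ≤ g K g⁻¹`. -/
def tr (g : G) {S K : Subgroup G} (h : S ≤ conjSub g K) : M.obj K →ₗ[ℚ] M.obj S :=
  M.res h ∘ₗ M.conj g rfl

lemma tr_def (g : G) {S K : Subgroup G} (h : S ≤ conjSub g K) (x : M.obj K) :
    M.tr g h x = M.res h (M.conj g rfl x) := rfl

lemma tr_eq (g : G) {S K : Subgroup G} (h : S ≤ conjSub g K) (h' : conjSub g⁻¹ S ≤ K)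
    (e : S = conjSub g (conjSub g⁻¹ S)) (x : M.obj K) :
    M.tr g h x = M.conj g e (M.res h' x) := M.conj_res _ _ _ _ _ _

lemma conj_eq_tr (g : G) {S K : Subgroup G} (h : S = conjSub g K) (x : M.obj K) :
    M.conj g h x = M.tr g h.le x := by
  subst h
  rw [tr_def, res_self]

lemma res_eq_tr {S K : Subgroup G} (h : S ≤ K) (x : M.obj K) :
    M.res h x = M.tr 1 (h.trans (conjSub_one K).ge) x := by
  have key : ∀ (K' : Subgroup G) (e : K' = conjSub 1 K) (h' : S ≤ K') (e' : K = K'),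
      M.res h x = M.res h' (M.conj 1 e x) := by
    intro K' e h' e'
    subst e'
    rw [M.conj_self (one_mem _)]
  exact key _ rfl _ (conjSub_one K).symm

lemma tr_congr {g g' : G} (e : g = g') {S K : Subgroup G} (h : S ≤ conjSub g K)
    (h' : S ≤ conjSub g' K) (x : M.obj K) : M.tr g h x = M.tr g' h' x := by
  subst e; rfl

lemma tr_tr (g g' : G) {S T K : Subgroup G} (h : S ≤ conjSub g T) (h' : T ≤ conjSub g' K)
    (h'' : S ≤ conjSub (g * g') K) (x : M.obj K) :
    M.tr g h (M.tr g' h' x) = M.tr (g * g') h'' x := by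
  have e : conjSub (g * g') K = conjSub g (conjSub g' K) := conjSub_mul g g' K
  simp only [tr_def]
  rw [← M.conj_res g rfl e h' (e ▸ conjSub_mono g h'), M.res_res, M.conj_conj]

lemma tr_mul_mem (g : G) {k : G} {S K : Subgroup G} (hk : k ∈ K) (h : S ≤ conjSub g K)
    (h' : S ≤ conjSub (g * k) K) (x : M.obj K) : M.tr (g * k) h' x = M.tr g h x := by
  rw [← M.tr_tr g k h (conjSub_of_mem hk).ge, ← M.conj_eq_tr k (conjSub_of_mem hk).symm,
    M.conj_self hk]

lemma tr_mem {k : G} {S K : Subgroup G} (hk : k ∈ K) (h : S ≤ K)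
    (h' : S ≤ conjSub k K) (x : M.obj K) : M.tr k h' x = M.res h x := by
  have e : conjSub (1 * k) K = conjSub k K := by rw [one_mul]
  rw [res_eq_tr, ← M.tr_mul_mem 1 hk _ (h'.trans e.ge)]
  exact M.tr_congr (one_mul k).symm _ _ _

lemma tr_mem_mul {s g : G} {S K : Subgroup G} (hs : s ∈ S) (h : S ≤ conjSub g K)
    (h' : S ≤ conjSub (s * g) K) (x : M.obj K) : M.tr (s * g) h' x = M.tr g h x := by
  rw [← M.tr_tr s g (conjSub_of_mem hs).ge h, ← M.conj_eq_tr s (conjSub_of_mem hs).symm,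
    M.conj_self hs]

lemma res_tr (g : G) {S T K : Subgroup G} (h : S ≤ T) (h' : T ≤ conjSub g K) (x : M.obj K) :
    M.res h (M.tr g h' x) = M.tr g (h.trans h') x := by
  rw [tr_def, res_res]; rfl

lemma tr_res (g : G) {S T K : Subgroup G} (h : S ≤ conjSub g T) (h' : T ≤ K)
    (h'' : S ≤ conjSub g K) (x : M.obj K) :
    M.tr g h (M.res h' x) = M.tr g h'' x := by
  rw [tr_def, tr_def, ← M.conj_res g rfl rfl h' (conjSub_mono g h'), M.res_res]

/-- For `x ∈ H` and `S, K ≤ H`, the composite `M(G/K) → M(G/(S ∩ x K x⁻¹)) → M(G/S)`. -/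
def dc (S : Subgroup G) {K : Subgroup G} (x : G) (y : M.obj K) : M.obj S :=
  M.ind (inf_le_left : S ⊓ conjSub x K ≤ S) (M.tr x inf_le_right y)

lemma ind_tr_congr {S T T' K : Subgroup G} (e : T = T') (h : T ≤ S) (h' : T' ≤ S) {x x' : G}
    (ht : T ≤ conjSub x K) (ht' : T' ≤ conjSub x' K) (y y' : M.obj K)
    (hy : M.tr x ht y = M.tr x' (e.le.trans ht') y') :
    M.ind h (M.tr x ht y) = M.ind h' (M.tr x' ht' y') := by
  subst e; rw [hy]

lemma dc_mul_mem (S : Subgroup G) {K : Subgroup G} (x : G) {b : G} (hb : b ∈ K) (y : M.obj K) :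
    M.dc S (x * b) y = M.dc S x y := by
  have e : conjSub (x * b) K = conjSub x K := by rw [conjSub_mul, conjSub_of_mem hb]
  refine M.ind_tr_congr (by rw [e]) _ _ _ _ _ _ ?_
  exact M.tr_mul_mem x hb _ _ _

lemma dc_mem_mul {S : Subgroup G} {K : Subgroup G} (x : G) {a : G} (ha : a ∈ S) (y : M.obj K) :
    M.dc S (a * x) y = M.dc S x y := by
  have e : S ⊓ conjSub (a * x) K = conjSub a (S ⊓ conjSub x K) := by
    rw [conjSub_inf, conjSub_of_mem ha, conjSub_mul]
  unfold dc
  rw [← M.conj_self ha (conjSub_of_mem ha).symm (M.ind _ (M.tr x _ y)),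
    ← M.conj_ind a e (conjSub_of_mem ha).symm inf_le_left inf_le_left, M.conj_eq_tr a e,
    M.tr_tr]

/-- The Mackey axiom in terms of double coset representatives. -/
def MackeyAxiom [Finite G] : Prop :=
  ∀ {K L H : Subgroup G} (hK : K ≤ H) (hL : L ≤ H) (y : M.obj L),
    M.res hK (M.ind hL y) =
      ∑ q : DoubleCoset.Quotient (K.subgroupOf H : Set H) (L.subgroupOf H : Set H),
        M.ind (inf_le_left : K ⊓ conjSub (q.out : G) L ≤ K)
          (M.conj (q.out : G) (inf_conjSub (q.out : G) K L)
            (M.res (inf_le_left : L ⊓ conjSub (q.out : G)⁻¹ K ≤ L) y))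

lemma mackeyAxiom_iff [Finite G] : M.MackeyAxiom ↔
    ∀ {K L H : Subgroup G} (hK : K ≤ H) (hL : L ≤ H) (y : M.obj L),
      M.res hK (M.ind hL y) =
        ∑ x : H, (ord (K ⊓ conjSub (x : G) L) / (ord K * ord L)) • M.dc K (x : G) y := by
  have key : ∀ {K L H : Subgroup G} (hK : K ≤ H) (hL : L ≤ H) (y : M.obj L),
      ∑ q : DoubleCoset.Quotient (K.subgroupOf H : Set H) (L.subgroupOf H : Set H),
        M.ind (inf_le_left : K ⊓ conjSub (q.out : G) L ≤ K)
          (M.conj (q.out : G) (inf_conjSub (q.out : G) K L)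
            (M.res (inf_le_left : L ⊓ conjSub (q.out : G)⁻¹ K ≤ L) y)) =
        ∑ x : H, (ord (K ⊓ conjSub (x : G) L) / (ord K * ord L)) • M.dc K (x : G) y := by
    intro K L H hK hL y
    rw [← doubleCoset_sum' hK hL (fun x : H => M.dc K (x : G) y)]
    · refine Finset.sum_congr rfl fun q _ => ?_
      unfold dc
      rw [M.conj_eq_tr, M.tr_res]
    · intro a b x ha hb
      simp only [Subgroup.coe_mul]
      rw [M.dc_mul_mem _ _ hb, M.dc_mem_mul _ ha]
  unfold MackeyAxiom
  constructor
  · intro h K L H hK hL y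
    rw [h hK hL, key hK hL]
  · intro h K L H hK hL y
    rw [h hK hL, key hK hL]

end PreMackey

/-- A rational `G`-Mackey functor. -/
structure Mackey (G : Type) [Group G] [Finite G] extends PreMackey G where
  mackey : toPreMackey.MackeyAxiom

namespace Mackey

variable {G : Type} [Group G] [Finite G]

/-- A morphism of Mackey functors. -/
@[ext]
structure Hom (M N : Mackey G) where
  app : ∀ H, M.obj H →ₗ[ℚ] N.obj H
  app_res : ∀ {K H : Subgroup G} (h : K ≤ H) (x : M.obj H),
    app K (M.res h x) = N.res h (app H x)
  app_ind : ∀ {K H : Subgroup G} (h : K ≤ H) (x : M.obj K),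
    app H (M.ind h x) = N.ind h (app K x)
  app_conj : ∀ (g : G) {H K : Subgroup G} (e : K = conjSub g H) (x : M.obj H),
    app K (M.conj g e x) = N.conj g e (app H x)

instance : Category (Mackey G) where
  Hom := Hom
  id M := ⟨fun _ => LinearMap.id, fun _ _ => rfl, fun _ _ => rfl, fun _ _ _ _ _ => rfl⟩
  comp f g := ⟨fun H => g.app H ∘ₗ f.app H, by simp [f.app_res, g.app_res],
    by simp [f.app_ind, g.app_ind], by simp [f.app_conj, g.app_conj]⟩

@[ext]
lemma hom_ext {M N : Mackey G} {f g : M ⟶ N} (h : ∀ H x, f.app H x = g.app H x) : f = g :=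
  Hom.ext (funext fun H => LinearMap.ext (h H))

@[simp] lemma id_app (M : Mackey G) (H : Subgroup G) (x : M.obj H) :
    Hom.app (𝟙 M) H x = x := rfl

@[simp] lemma comp_app {M N P : Mackey G} (f : M ⟶ N) (g : N ⟶ P) (H : Subgroup G)
    (x : M.obj H) : (f ≫ g).app H x = g.app H (f.app H x) := rfl

lemma app_tr {M N : Mackey G} (f : M ⟶ N) (g : G) {S K : Subgroup G} (h : S ≤ conjSub g K)
    (x : M.obj K) : f.app S (M.tr g h x) = N.tr g h (f.app K x) := by
  rw [PreMackey.tr_def, f.app_res, f.app_conj]; rfl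

variable (M : Mackey G)

lemma res_ind {K L H : Subgroup G} (hK : K ≤ H) (hL : L ≤ H) (y : M.obj L) :
    M.res hK (M.ind hL y) =
      ∑ x : H, (ord (K ⊓ conjSub (x : G) L) / (ord K * ord L)) • M.dc K (x : G) y :=
  M.mackeyAxiom_iff.1 M.mackey hK hL y

lemma dc_congr {S K : Subgroup G} {x x' : G} (h : x = x') (y : M.obj K) :
    M.dc S x y = M.dc S x' y := by rw [h]

lemma tr_ind (g : G) {S L K : Subgroup G} (h : S ≤ conjSub g K) (hL : L ≤ K) (y : M.obj L) :
    M.tr g h (M.ind hL y) =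
      ∑ m : K, (ord (S ⊓ conjSub (g * m) L) / (ord S * ord L)) • M.dc S (g * m) y := by
  rw [PreMackey.tr_def, ← M.conj_ind g rfl rfl hL (conjSub_mono g hL), M.res_ind]
  let e : K ≃ conjSub g K := (Subgroup.equivSMul (MulAut.conj g) K).toEquiv
  have he : ∀ m : K, ((e m : conjSub g K) : G) * g = g * m := fun m => by
    change g * m * g⁻¹ * g = g * m
    simp
  rw [← e.sum_comp]
  refine Finset.sum_congr rfl fun m _ => ?_
  have h1 : conjSub ((e m : conjSub g K) : G) (conjSub g L) = conjSub (g * m) L := by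
    rw [← conjSub_mul, he]
  rw [h1, ord_conjSub]
  congr 1
  refine Eq.trans ?_ (M.dc_congr (he m) y)
  unfold PreMackey.dc
  rw [M.conj_eq_tr g rfl, M.tr_tr]
  · refine M.ind_tr_congr ?_ _ _ _ _ _ _ ?_
    · rw [conjSub_mul]
    · rfl

end Mackey

/-! ### The box product -/

namespace Mackey

variable {G : Type} [Group G] [Finite G]

lemma sum_mul_right {K H : Subgroup G} (hK : K ≤ H) {V : Type} [AddCommGroup V] [Module ℚ V]
    (F : G → V) : ∑ l : H, ∑ m : K, F (l * m) = ord K • ∑ l : H, F l := by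
  rw [Finset.sum_comm]
  have : ∀ m : K, ∑ l : H, F (l * m) = ∑ l : H, F l := fun m =>
    Equiv.sum_comp (Equiv.mulRight (⟨m, hK m.2⟩ : H)) (fun l : H => F l)
  rw [Finset.sum_congr rfl fun m _ => this m, Finset.sum_const, Finset.card_univ,
    ← Nat.card_eq_fintype_card, ← Nat.cast_smul_eq_nsmul ℚ]
  rfl

lemma sum_mul_left {K H : Subgroup G} (hK : K ≤ H) {V : Type} [AddCommGroup V] [Module ℚ V]
    (F : G → V) : ∑ m : K, ∑ l : H, F (m * l) = ord K • ∑ l : H, F l := by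
  have : ∀ m : K, ∑ l : H, F (m * l) = ∑ l : H, F l := fun m =>
    Equiv.sum_comp (Equiv.mulLeft (⟨m, hK m.2⟩ : H)) (fun l : H => F l)
  rw [Finset.sum_congr rfl fun m _ => this m, Finset.sum_const, Finset.card_univ,
    ← Nat.card_eq_fintype_card, ← Nat.cast_smul_eq_nsmul ℚ]
  rfl

lemma sum_inv_subgroup {H : Subgroup G} {V : Type} [AddCommGroup V] (F : G → V) :
    ∑ l : H, F (l : G)⁻¹ = ∑ l : H, F l :=
  Equiv.sum_comp (Equiv.inv H) (fun l : H => F l)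

variable (M N : Mackey G)

/-- `T(H) = ⨁_{K ≤ H} M(G/K) ⊗ N(G/K)`. -/
abbrev BoxT (H : Subgroup G) : Type :=
  DirectSum {K : Subgroup G // K ≤ H} fun K => M.obj K.1 ⊗[ℚ] N.obj K.1

open scoped Classical in
/-- `x ⊗ y` in the summand of `T(H)` indexed by `K`. -/
def boxT {H K : Subgroup G} (h : K ≤ H) (x : M.obj K) (y : N.obj K) : BoxT M N H :=
  DirectSum.lof ℚ {K : Subgroup G // K ≤ H} (fun K => M.obj K.1 ⊗[ℚ] N.obj K.1) ⟨K, h⟩ (x ⊗ₜ y)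

/-- The generators of `I(H)`. -/
inductive BoxRel (H : Subgroup G) : BoxT M N H → Prop
  | res_left {L K : Subgroup G} (hL : L ≤ K) (hK : K ≤ H) (x : M.obj K) (y : N.obj L) :
      BoxRel H (boxT M N (hL.trans hK) (M.res hL x) y - boxT M N hK x (N.ind hL y))
  | res_right {L K : Subgroup G} (hL : L ≤ K) (hK : K ≤ H) (x : M.obj L) (y : N.obj K) :
      BoxRel H (boxT M N (hL.trans hK) x (N.res hL y) - boxT M N hK (M.ind hL x) y)
  | conj {h : G} (hh : h ∈ H) {K K' : Subgroup G} (hK : K ≤ H) (hK' : K' ≤ H)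
      (e : K' = conjSub h K) (e' : K = conjSub h⁻¹ K') (x : M.obj K) (y : N.obj K') :
      BoxRel H (boxT M N hK' (M.conj h e x) y - boxT M N hK x (N.conj h⁻¹ e' y))

/-- `I(H)`. -/
def boxI (H : Subgroup G) : Submodule ℚ (BoxT M N H) := Submodule.span ℚ {t | BoxRel M N H t}

/-- `(M □ N)(G/H) = T(H) / I(H)`. -/
def BoxObj (H : Subgroup G) : Type := BoxT M N H ⧸ boxI M N H

instance (H : Subgroup G) : AddCommGroup (BoxObj M N H) :=
  inferInstanceAs (AddCommGroup (BoxT M N H ⧸ boxI M N H))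
instance (H : Subgroup G) : Module ℚ (BoxObj M N H) :=
  inferInstanceAs (Module ℚ (BoxT M N H ⧸ boxI M N H))

open scoped Classical in
/-- The class of `x ⊗ y` in `(M □ N)(G/H)`, for `x ∈ M(G/K)` and `y ∈ N(G/K)`, `K ≤ H`. -/
def pr {H K : Subgroup G} (h : K ≤ H) : M.obj K →ₗ[ℚ] N.obj K →ₗ[ℚ] BoxObj M N H :=
  (TensorProduct.mk ℚ (M.obj K) (N.obj K)).compr₂
    ((boxI M N H).mkQ ∘ₗ
      DirectSum.lof ℚ {K : Subgroup G // K ≤ H} (fun K => M.obj K.1 ⊗[ℚ] N.obj K.1) ⟨K, h⟩)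

lemma pr_apply {H K : Subgroup G} (h : K ≤ H) (x : M.obj K) (y : N.obj K) :
    pr M N h x y = (boxI M N H).mkQ (boxT M N h x y) := rfl

variable {M N}

lemma pr_res_left {H L K : Subgroup G} (hL : L ≤ K) (hK : K ≤ H) (x : M.obj K) (y : N.obj L) :
    pr M N (hL.trans hK) (M.res hL x) y = pr M N hK x (N.ind hL y) :=
  (Submodule.Quotient.eq _).2 (Submodule.subset_span (BoxRel.res_left hL hK x y))

lemma pr_res_right {H L K : Subgroup G} (hL : L ≤ K) (hK : K ≤ H) (x : M.obj L) (y : N.obj K) :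
    pr M N (hL.trans hK) x (N.res hL y) = pr M N hK (M.ind hL x) y :=
  (Submodule.Quotient.eq _).2 (Submodule.subset_span (BoxRel.res_right hL hK x y))

lemma pr_conj {H : Subgroup G} {h : G} (hh : h ∈ H) {K K' : Subgroup G} (hK : K ≤ H)
    (hK' : K' ≤ H) (e : K' = conjSub h K) (x : M.obj K) (y : N.obj K) :
    pr M N hK' (M.conj h e x) (N.conj h e y) = pr M N hK x y := by
  have e' : K = conjSub h⁻¹ K' := by rw [e, ← conjSub_mul, inv_mul_cancel, conjSub_one]
  have h1 : pr M N hK' (M.conj h e x) (N.conj h e y) =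
      pr M N hK x (N.conj h⁻¹ e' (N.conj h e y)) :=
    (Submodule.Quotient.eq _).2 (Submodule.subset_span (BoxRel.conj hh hK hK' e e' x _))
  have h2 : K = conjSub (h⁻¹ * h) K := by rw [inv_mul_cancel, conjSub_one]
  rw [h1, N.conj_conj _ _ _ _ h2, N.conj_self (by rw [inv_mul_cancel]; exact one_mem _)]

lemma pr_congr {H K K' : Subgroup G} (e : K = K') (h : K ≤ H) (h' : K' ≤ H) {A B : Subgroup G}
    (x : M.obj A) (y : N.obj B) {a b : G} (ha : K ≤ conjSub a A) (ha' : K' ≤ conjSub a A)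
    (hb : K ≤ conjSub b B) (hb' : K' ≤ conjSub b B) :
    pr M N h (M.tr a ha x) (N.tr b hb y) = pr M N h' (M.tr a ha' x) (N.tr b hb' y) := by
  subst e; rfl

lemma pr_res_eq {H K T : Subgroup G} (e : T = K) (h : T ≤ H) (h' : K ≤ H) (hT : T ≤ K)
    (x : M.obj K) (y : N.obj K) : pr M N h (M.res hT x) (N.res hT y) = pr M N h' x y := by
  subst e; rw [M.res_self, N.res_self]

section lift

variable {H : Subgroup G} {V : Type} [AddCommGroup V] [Module ℚ V]

open scoped Classical in
/-- Linear maps out of `(M □ N)(G/H)`. -/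
def boxLift (f : ∀ K, K ≤ H → M.obj K →ₗ[ℚ] N.obj K →ₗ[ℚ] V)
    (h₁ : ∀ {L K} (hL : L ≤ K) (hK : K ≤ H) x y,
      f L (hL.trans hK) (M.res hL x) y = f K hK x (N.ind hL y))
    (h₂ : ∀ {L K} (hL : L ≤ K) (hK : K ≤ H) x y,
      f L (hL.trans hK) x (N.res hL y) = f K hK (M.ind hL x) y)
    (h₃ : ∀ {h : G} (_ : h ∈ H) {K K'} (hK : K ≤ H) (hK' : K' ≤ H) (e : K' = conjSub h K) x y,
      f K' hK' (M.conj h e x) (N.conj h e y) = f K hK x y) : BoxObj M N H →ₗ[ℚ] V :=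
  (boxI M N H).liftQ (DirectSum.toModule ℚ _ V fun K => TensorProduct.lift (f K.1 K.2)) (by
    rw [boxI, Submodule.span_le]
    rintro _ (⟨hL, hK, x, y⟩ | ⟨hL, hK, x, y⟩ | ⟨hh, hK, hK', e, e', x, y⟩)
    · simp [boxT, h₁ hL hK x y]
    · simp [boxT, h₂ hL hK x y]
    · rename_i h K K'
      have h2 : K' = conjSub (h * h⁻¹) K' := by rw [mul_inv_cancel, conjSub_one]
      have : y = N.conj h e (N.conj h⁻¹ e' y) := by
        rw [N.conj_conj _ _ _ _ h2, N.conj_self (by rw [mul_inv_cancel]; exact one_mem _)]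
      have h4 := h₃ hh hK hK' e x (N.conj h⁻¹ e' y)
      rw [← this] at h4
      simp [boxT, h4])

@[simp] lemma boxLift_pr (f : ∀ K, K ≤ H → M.obj K →ₗ[ℚ] N.obj K →ₗ[ℚ] V) (h₁ h₂ h₃)
    {K : Subgroup G} (hK : K ≤ H) (x : M.obj K) (y : N.obj K) :
    boxLift f h₁ h₂ h₃ (pr M N hK x y) = f K hK x y := by
  refine (Submodule.liftQ_apply _ _ _).trans ?_
  simp

lemma box_ext (f g : BoxObj M N H →ₗ[ℚ] V)
    (h : ∀ {K : Subgroup G} (hK : K ≤ H) x y, f (pr M N hK x y) = g (pr M N hK x y))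
    (z : BoxObj M N H) : f z = g z := by
  classical
  have : f = g := by
    refine Submodule.linearMap_qext _ (DirectSum.linearMap_ext _ fun K => ?_)
    refine TensorProduct.ext' fun x y => ?_
    exact h K.2 x y
  rw [this]

end lift

/-- `R C_l x ⊗ R C_l y` in the summand indexed by `S ∩ l K l⁻¹`. -/
def tw (S : Subgroup G) {K : Subgroup G} (l : G) : M.obj K →ₗ[ℚ] N.obj K →ₗ[ℚ] BoxObj M N S :=
  (pr M N (inf_le_left : S ⊓ conjSub l K ≤ S)).compl₁₂
    (M.tr l inf_le_right) (N.tr l inf_le_right)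

lemma tw_apply (S : Subgroup G) {K : Subgroup G} (l : G) (x : M.obj K) (y : N.obj K) :
    tw S l x y = pr M N (inf_le_left : S ⊓ conjSub l K ≤ S)
      (M.tr l inf_le_right x) (N.tr l inf_le_right y) := rfl

lemma tw_mul_mem (S : Subgroup G) {K : Subgroup G} (l : G) {b : G} (hb : b ∈ K)
    (x : M.obj K) (y : N.obj K) : tw S (l * b) x y = tw S l x y := by
  have e : conjSub (l * b) K = conjSub l K := by rw [conjSub_mul, conjSub_of_mem hb]
  rw [tw_apply, tw_apply, M.tr_mul_mem l hb (inf_le_right.trans e.le),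
    N.tr_mul_mem l hb (inf_le_right.trans e.le)]
  exact pr_congr (by rw [e]) _ _ _ _ _ _ _ _

lemma tw_mem_mul {S K : Subgroup G} (l : G) {a : G} (ha : a ∈ S)
    (x : M.obj K) (y : N.obj K) : tw S (a * l) x y = tw S l x y := by
  have e : S ⊓ conjSub (a * l) K = conjSub a (S ⊓ conjSub l K) := by
    rw [conjSub_inf, conjSub_of_mem ha, conjSub_mul]
  rw [tw_apply, tw_apply, ← pr_conj ha inf_le_left inf_le_left e, M.conj_eq_tr, N.conj_eq_tr,
    M.tr_tr, N.tr_tr]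

/-- Restriction of `x ⊗ y` along `S ≤ H`, as a sum over double coset representatives. -/
def boxResAux {S H : Subgroup G} (K : Subgroup G) :
    M.obj K →ₗ[ℚ] N.obj K →ₗ[ℚ] BoxObj M N S :=
  ∑ l : DoubleCoset.Quotient (S.subgroupOf H : Set H) (K.subgroupOf H : Set H), tw S (l.out : G)

lemma boxResAux_eq {S H K : Subgroup G} (hS : S ≤ H) (hK : K ≤ H) (x : M.obj K) (y : N.obj K) :
    boxResAux (S := S) (H := H) K x y =
      ∑ l : H, (ord (S ⊓ conjSub (l : G) K) / (ord S * ord K)) • tw S (l : G) x y := by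
  rw [← doubleCoset_sum' hS hK (fun l : H => tw S (l : G) x y)]
  · simp [boxResAux, LinearMap.sum_apply]
  · intro a b l ha hb
    simp only [Subgroup.coe_mul]
    rw [tw_mul_mem _ _ hb, tw_mem_mul _ ha]

lemma ord_cancel (S T K L : Subgroup G) (a : ℚ) :
    (ord T / (ord S * ord K)) * (a / (ord T * ord L)) = (ord K)⁻¹ * (a / (ord S * ord L)) := by
  have := ord_ne_zero S
  have := ord_ne_zero T
  have := ord_ne_zero K
  have := ord_ne_zero L
  field_simp

lemma boxRes_rel₁ {S H : Subgroup G} (hS : S ≤ H) {L K : Subgroup G} (hL : L ≤ K) (hK : K ≤ H)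
    (x : M.obj K) (y : N.obj L) :
    boxResAux (S := S) (H := H) L (M.res hL x) y = boxResAux (S := S) (H := H) K x (N.ind hL y) := by
  rw [boxResAux_eq hS (hL.trans hK), boxResAux_eq hS hK]
  have key : ∀ l : H, (ord (S ⊓ conjSub (l : G) K) / (ord S * ord K)) • tw S (l : G) x (N.ind hL y)
      = ∑ m : K, (ord K)⁻¹ • (ord (S ⊓ conjSub (l * m : G) L) / (ord S * ord L)) •
          tw S (l * m : G) (M.res hL x) y := by
    intro l
    rw [tw_apply, N.tr_ind, map_sum, Finset.smul_sum]
    refine Finset.sum_congr rfl fun m _ => ?_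
    have e : conjSub (l * m : G) L ≤ conjSub (l : G) K := by
      rw [conjSub_mul]; exact conjSub_mono _ (conjSub_le_of_mem hL m.2)
    have e' : S ⊓ conjSub (l : G) K ⊓ conjSub (l * m : G) L = S ⊓ conjSub (l * m : G) L := by
      rw [inf_assoc, inf_eq_right.2 e]
    have e'' : conjSub (l * m : G) K = conjSub (l : G) K := by
      rw [conjSub_mul, conjSub_of_mem m.2]
    rw [e', map_smul, smul_smul, smul_smul, ord_cancel]
    congr 1
    unfold PreMackey.dc
    rw [← pr_res_left, M.res_tr, tw_apply,
      M.tr_res (l * m : G) _ hL (inf_le_right.trans (e.trans e''.ge)),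
      M.tr_mul_mem (l : G) m.2 (inf_le_right.trans e)]
    exact pr_congr e' _ _ _ _ _ _ _ _
  rw [Finset.sum_congr rfl fun l _ => key l, sum_mul_right hK (fun l => (ord K)⁻¹ •
    (ord (S ⊓ conjSub l L) / (ord S * ord L)) • tw S l (M.res hL x) y), ← Finset.smul_sum, smul_smul,
    mul_inv_cancel₀ (ord_ne_zero K), one_smul]

lemma boxRes_rel₂ {S H : Subgroup G} (hS : S ≤ H) {L K : Subgroup G} (hL : L ≤ K) (hK : K ≤ H)
    (x : M.obj L) (y : N.obj K) :
    boxResAux (S := S) (H := H) L x (N.res hL y) = boxResAux (S := S) (H := H) K (M.ind hL x) y := by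
  rw [boxResAux_eq hS (hL.trans hK), boxResAux_eq hS hK]
  have key : ∀ l : H, (ord (S ⊓ conjSub (l : G) K) / (ord S * ord K)) • tw S (l : G) (M.ind hL x) y
      = ∑ m : K, (ord K)⁻¹ • (ord (S ⊓ conjSub (l * m : G) L) / (ord S * ord L)) •
          tw S (l * m : G) x (N.res hL y) := by
    intro l
    rw [tw_apply, M.tr_ind, map_sum, LinearMap.sum_apply, Finset.smul_sum]
    refine Finset.sum_congr rfl fun m _ => ?_
    have e : conjSub (l * m : G) L ≤ conjSub (l : G) K := by
      rw [conjSub_mul]; exact conjSub_mono _ (conjSub_le_of_mem hL m.2)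
    have e' : S ⊓ conjSub (l : G) K ⊓ conjSub (l * m : G) L = S ⊓ conjSub (l * m : G) L := by
      rw [inf_assoc, inf_eq_right.2 e]
    have e'' : conjSub (l * m : G) K = conjSub (l : G) K := by
      rw [conjSub_mul, conjSub_of_mem m.2]
    rw [e', map_smul, LinearMap.smul_apply, smul_smul, smul_smul, ord_cancel]
    congr 1
    unfold PreMackey.dc
    rw [← pr_res_right, N.res_tr, tw_apply,
      N.tr_res (l * m : G) _ hL (inf_le_right.trans (e.trans e''.ge)),
      N.tr_mul_mem (l : G) m.2 (inf_le_right.trans e)]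
    exact pr_congr e' _ _ _ _ _ _ _ _
  rw [Finset.sum_congr rfl fun l _ => key l, sum_mul_right hK (fun l => (ord K)⁻¹ •
    (ord (S ⊓ conjSub l L) / (ord S * ord L)) • tw S l x (N.res hL y)), ← Finset.smul_sum, smul_smul,
    mul_inv_cancel₀ (ord_ne_zero K), one_smul]

lemma tw_conj (S : Subgroup G) {K K' : Subgroup G} (l h : G) (e : K' = conjSub h K)
    (x : M.obj K) (y : N.obj K) :
    tw S l (M.conj h e x) (N.conj h e y) = tw S (l * h) x y := by
  have e₂ : conjSub (l * h) K = conjSub l K' := by rw [conjSub_mul, e]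
  rw [tw_apply, tw_apply, M.conj_eq_tr, N.conj_eq_tr, M.tr_tr _ _ _ _ (inf_le_right.trans e₂.ge),
    N.tr_tr _ _ _ _ (inf_le_right.trans e₂.ge)]
  exact pr_congr (by rw [e₂]) _ _ _ _ _ _ _ _

/-- Restriction on the box product. -/
def boxRes {S H : Subgroup G} (hS : S ≤ H) : BoxObj M N H →ₗ[ℚ] BoxObj M N S :=
  boxLift (fun K _ => boxResAux (S := S) (H := H) K) (boxRes_rel₁ hS) (boxRes_rel₂ hS) (by
    intro h hh K K' hK hK' e x y
    rw [boxResAux_eq hS hK, boxResAux_eq hS hK',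
      ← Equiv.sum_comp (Equiv.mulRight (⟨h, hh⟩ : H)) (fun l : H =>
        (ord (S ⊓ conjSub (l : G) K) / (ord S * ord K)) • tw S (l : G) x y)]
    refine Finset.sum_congr rfl fun l _ => ?_
    rw [tw_conj]
    simp only [Equiv.coe_mulRight, Subgroup.coe_mul]
    rw [conjSub_mul, ← e, e, ord_conjSub])

/-- Induction on the box product, induced by the inclusion `T(K) → T(H)`. -/
def boxInd {S H : Subgroup G} (hS : S ≤ H) : BoxObj M N S →ₗ[ℚ] BoxObj M N H :=
  boxLift (fun _ hK => pr M N (hK.trans hS)) (fun hL hK => pr_res_left hL (hK.trans hS))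
    (fun hL hK => pr_res_right hL (hK.trans hS))
    (fun hh _ _ hK hK' => pr_conj (hS hh) (hK.trans hS) (hK'.trans hS))

/-- Conjugation on the box product, the diagonal one. -/
def boxConj (g : G) {H H' : Subgroup G} (e : H' = conjSub g H) :
    BoxObj M N H →ₗ[ℚ] BoxObj M N H' :=
  boxLift (fun _ hK => (pr M N ((conjSub_mono g hK).trans e.ge)).compl₁₂
      (M.conj g rfl) (N.conj g rfl))
    (fun hL hK x y => by
      simp only [LinearMap.compl₁₂_apply]
      rw [← M.conj_res g rfl rfl hL (conjSub_mono g hL), pr_res_left,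
        N.conj_ind g rfl rfl hL])
    (fun hL hK x y => by
      simp only [LinearMap.compl₁₂_apply]
      rw [← N.conj_res g rfl rfl hL (conjSub_mono g hL), pr_res_right,
        M.conj_ind g rfl rfl hL])
    (fun {h} hh K K' hK hK' e' x y => by
      simp only [LinearMap.compl₁₂_apply]
      have h1 : g * h * g⁻¹ ∈ H' := by
        rw [e, mem_conjSub]; convert hh using 1; group
      have e₁ : conjSub g K' = conjSub (g * h) K := by rw [e', conjSub_mul]
      have e₂ : conjSub g K' = conjSub (g * h * g⁻¹) (conjSub g K) := by
        rw [e', ← conjSub_mul, ← conjSub_mul]; congr 1; group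
      rw [← pr_conj h1 ((conjSub_mono g hK).trans e.ge) ((conjSub_mono g hK').trans e.ge) e₂,
        M.conj_conj _ _ _ _ e₁, N.conj_conj _ _ _ _ e₁]
      have e₃ : conjSub g K' = conjSub (g * h * g⁻¹ * g) K := by
        rw [e₁]; congr 1; group
      rw [M.conj_conj _ _ _ _ e₃, N.conj_conj _ _ _ _ e₃]
      simp only [inv_mul_cancel_right])

lemma boxRes_pr {S H K : Subgroup G} (hS : S ≤ H) (hK : K ≤ H) (x : M.obj K) (y : N.obj K) :
    boxRes hS (pr M N hK x y) =
      ∑ l : H, (ord (S ⊓ conjSub (l : G) K) / (ord S * ord K)) • tw S (l : G) x y := by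
  rw [boxRes, boxLift_pr, boxResAux_eq hS hK]

@[simp] lemma boxInd_pr {S H K : Subgroup G} (hS : S ≤ H) (hK : K ≤ S) (x : M.obj K)
    (y : N.obj K) : boxInd hS (pr M N hK x y) = pr M N (hK.trans hS) x y := by
  rw [boxInd, boxLift_pr]

lemma boxConj_pr (g : G) {H H' : Subgroup G} (e : H' = conjSub g H) {K : Subgroup G}
    (hK : K ≤ H) (x : M.obj K) (y : N.obj K) : boxConj g e (pr M N hK x y) =
      pr M N ((conjSub_mono g hK).trans e.ge) (M.conj g rfl x) (N.conj g rfl y) := by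
  rw [boxConj, boxLift_pr]; rfl

/-- `x ⊗ y` restricted to a subgroup containing all of `K`'s level. -/
lemma boxRes_pr_self {S H : Subgroup G} (hS : S ≤ H) (x : M.obj H) (y : N.obj H) :
    boxRes hS (pr M N le_rfl x y) = pr M N le_rfl (M.res hS x) (N.res hS y) := by
  rw [boxRes_pr]
  have key : ∀ l : H, (ord (S ⊓ conjSub (l : G) H) / (ord S * ord H)) • tw S (l : G) x y =
      (ord H)⁻¹ • pr M N le_rfl (M.res hS x) (N.res hS y) := by
    intro l
    have e : S ⊓ conjSub (l : G) H = S := by rw [conjSub_of_mem l.2, inf_eq_left.2 hS]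
    have h1 := ord_ne_zero S
    have h2 := ord_ne_zero H
    have h3 : S ≤ conjSub (l : G) H := by rw [conjSub_of_mem l.2]; exact hS
    rw [e, tw_apply, ← M.tr_mem l.2 hS h3, ← N.tr_mem l.2 hS h3]
    congr 1
    · field_simp
    · exact pr_congr e _ _ _ _ _ _ _ _
  rw [Finset.sum_congr rfl fun l _ => key l, Finset.sum_const, Finset.card_univ,
    ← Nat.card_eq_fintype_card, ← Nat.cast_smul_eq_nsmul ℚ, smul_smul]
  change (ord H * (ord H)⁻¹) • _ = _
  rw [mul_inv_cancel₀ (ord_ne_zero H), one_smul]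

lemma boxInd_tw {S T K : Subgroup G} (l : G) (x : M.obj K) (y : N.obj K) (h : T ≤ S)
    (hT : S ⊓ conjSub l K ≤ T) :
    boxInd h (tw T l x y) = tw S l x y := by
  rw [tw_apply, boxInd_pr, tw_apply]
  exact pr_congr (le_antisymm (inf_le_inf_right _ h) (le_inf hT inf_le_right)) _ _ _ _ _ _ _ _

lemma boxConj_tw (g : G) {H H' K : Subgroup G} (e : H' = conjSub g H) (l : G)
    (x : M.obj K) (y : N.obj K) : boxConj g e (tw H l x y) = tw H' (g * l) x y := by
  have e' : conjSub g (H ⊓ conjSub l K) = H' ⊓ conjSub (g * l) K := by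
    rw [conjSub_inf, e, conjSub_mul]
  rw [tw_apply, boxConj_pr, M.conj_eq_tr, N.conj_eq_tr,
    M.tr_tr _ _ _ _ (e'.le.trans inf_le_right), N.tr_tr _ _ _ _ (e'.le.trans inf_le_right)]
  exact pr_congr e' _ _ _ _ _ _ _ _

lemma boxRes_tw {T S K : Subgroup G} (h : T ≤ S) (l : G) (x : M.obj K) (y : N.obj K) :
    boxRes h (tw S l x y) = ∑ m : S, (ord (T ⊓ conjSub (m * l : G) K) /
      (ord T * ord (S ⊓ conjSub l K))) • tw T (m * l : G) x y := by
  rw [tw_apply, boxRes_pr]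
  refine Finset.sum_congr rfl fun m _ => ?_
  have e : T ⊓ conjSub (m : G) (S ⊓ conjSub l K) = T ⊓ conjSub (m * l : G) K := by
    rw [conjSub_inf, conjSub_of_mem m.2, ← inf_assoc, inf_eq_left.2 h, conjSub_mul]
  rw [e, tw_apply, tw_apply, M.tr_tr _ _ _ _ (e.le.trans inf_le_right),
    N.tr_tr _ _ _ _ (e.le.trans inf_le_right)]
  congr 1
  exact pr_congr e _ _ _ _ _ _ _ _

variable (M N)

/-- The data of the box product. -/
def preBox : PreMackey G where
  obj := BoxObj M N
  res := boxRes
  ind := boxInd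
  conj := boxConj
  res_self {H} := box_ext _ LinearMap.id fun {K} hK x y => by
    rw [boxRes_pr, LinearMap.id_apply]
    have key : ∀ l : H, (ord (H ⊓ conjSub (l : G) K) / (ord H * ord K)) • tw H (l : G) x y =
        (ord H)⁻¹ • pr M N hK x y := by
      intro l
      have e : H ⊓ conjSub (l : G) K = conjSub (l : G) K :=
        inf_eq_right.2 (conjSub_le_of_mem hK l.2)
      have h1 := ord_ne_zero K
      have h2 := ord_ne_zero H
      rw [e, ord_conjSub, ← mul_one (l : G), ← boxConj_tw (l : G) (conjSub_of_mem l.2).symm 1,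
        tw_apply, M.tr_mem (one_mem K) (inf_le_right.trans (conjSub_one K).le),
        N.tr_mem (one_mem K) (inf_le_right.trans (conjSub_one K).le), boxConj_pr,
        pr_conj l.2 inf_le_left (conjSub_le_of_mem inf_le_left l.2)]
      congr 1
      · field_simp
      · exact pr_res_eq (by rw [conjSub_one, inf_eq_right.2 hK]) _ _ _ _ _
    rw [Finset.sum_congr rfl fun l _ => key l, Finset.sum_const, Finset.card_univ,
      ← Nat.card_eq_fintype_card, ← Nat.cast_smul_eq_nsmul ℚ, smul_smul]
    change (ord H * (ord H)⁻¹) • _ = _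
    rw [mul_inv_cancel₀ (ord_ne_zero H), one_smul]
  ind_self := box_ext _ LinearMap.id fun {K} hK x y => by rw [boxInd_pr]; rfl
  conj_self hh e := box_ext _ LinearMap.id fun {K} hK x y => by
    rw [boxConj_pr, pr_conj hh hK]; rfl
  ind_ind h₁ h₂ := box_ext (boxInd h₂ ∘ₗ boxInd h₁) _ fun {K} hK x y => by simp
  res_res {L K H} h₁ h₂ := box_ext (boxRes h₁ ∘ₗ boxRes h₂) _ fun {J} hJ x y => by
    rw [LinearMap.comp_apply, boxRes_pr, boxRes_pr, map_sum]
    have key : ∀ l : H, boxRes h₁ ((ord (K ⊓ conjSub (l : G) J) / (ord K * ord J)) •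
        tw K (l : G) x y) = ∑ m : K, (ord K)⁻¹ • (ord (L ⊓ conjSub (m * l : G) J) /
          (ord L * ord J)) • tw L (m * l : G) x y := by
      intro l
      rw [map_smul, boxRes_tw, Finset.smul_sum]
      refine Finset.sum_congr rfl fun m _ => ?_
      rw [smul_smul, smul_smul, mul_comm (ord L), mul_comm (ord L)]
      congr 1
      have := ord_ne_zero (K ⊓ conjSub (l : G) J)
      have := ord_ne_zero K
      have := ord_ne_zero J
      have := ord_ne_zero L
      field_simp
    rw [Finset.sum_congr rfl fun l _ => key l, Finset.sum_comm, sum_mul_left h₂ (fun l =>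
      (ord K)⁻¹ • (ord (L ⊓ conjSub l J) / (ord L * ord J)) • tw L l x y), ← Finset.smul_sum,
      smul_smul, mul_inv_cancel₀ (ord_ne_zero K), one_smul]
  conj_conj g h H K L e₁ e₂ e₃ := box_ext (boxConj g e₂ ∘ₗ boxConj h e₁) _ fun {J} hJ x y => by
    have e : conjSub g (conjSub h J) = conjSub (g * h) J := (conjSub_mul _ _ _).symm
    simp only [LinearMap.comp_apply]
    rw [boxConj_pr, boxConj_pr, boxConj_pr, M.conj_conj _ _ _ _ e, N.conj_conj _ _ _ _ e,
      M.conj_eq_tr, N.conj_eq_tr, M.conj_eq_tr, N.conj_eq_tr]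
    exact pr_congr e _ _ _ _ _ _ _ _
  conj_res g K H K' H' eK eH h h' := box_ext (boxRes h' ∘ₗ boxConj g eH)
      (boxConj g eK ∘ₗ boxRes h) fun {J} hJ x y => by
    subst eK eH
    rw [LinearMap.comp_apply, LinearMap.comp_apply, boxConj_pr, boxRes_pr, boxRes_pr, map_sum]
    let e : H ≃ conjSub g H := (Subgroup.equivSMul (MulAut.conj g) H).toEquiv
    have he : ∀ m : H, ((e m : conjSub g H) : G) * g = g * m := fun m => by
      change g * m * g⁻¹ * g = g * m
      simp
    rw [← e.sum_comp]
    refine Finset.sum_congr rfl fun l _ => ?_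
    rw [map_smul, boxConj_tw, tw_conj, ← conjSub_mul, he, ord_conjSub, ord_conjSub,
      conjSub_mul, ← conjSub_inf, ord_conjSub]
  conj_ind g K H K' H' eK eH h h' := box_ext (boxInd h' ∘ₗ boxConj g eK)
      (boxConj g eH ∘ₗ boxInd h) fun {J} hJ x y => by
    rw [LinearMap.comp_apply, LinearMap.comp_apply, boxConj_pr, boxInd_pr, boxInd_pr, boxConj_pr]

/-- The box product of two Mackey functors. -/
def box : Mackey G where
  toPreMackey := preBox M N
  mackey := by
    rw [PreMackey.mackeyAxiom_iff]
    intro K L H hK hL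
    have main : ∀ z : BoxObj M N L, boxRes hK (boxInd hL z) =
        ∑ x : H, (ord (K ⊓ conjSub (x : G) L) / (ord K * ord L)) •
          boxInd inf_le_left (boxRes (inf_le_right : K ⊓ conjSub (x : G) L ≤ _)
            (boxConj (x : G) rfl z)) := by
      intro z
      have := box_ext (boxRes hK ∘ₗ boxInd hL) (∑ x : H, (ord (K ⊓ conjSub (x : G) L) /
        (ord K * ord L)) • (boxInd (inf_le_left : K ⊓ conjSub (x : G) L ≤ K) ∘ₗ
          boxRes inf_le_right ∘ₗ boxConj (x : G) rfl)) (fun {J} hJ x y => ?_) z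
      · refine this.trans ?_
        simp only [LinearMap.sum_apply, LinearMap.smul_apply, LinearMap.comp_apply]
      rw [LinearMap.comp_apply, boxInd_pr, boxRes_pr]
      simp only [LinearMap.sum_apply, LinearMap.smul_apply, LinearMap.comp_apply]
      have key : ∀ l : H, (ord (K ⊓ conjSub (l : G) L) / (ord K * ord L)) •
          boxInd (inf_le_left : K ⊓ conjSub (l : G) L ≤ K)
            (boxRes inf_le_right (boxConj (l : G) rfl (pr M N hJ x y))) =
          ∑ m : L, (ord L)⁻¹ • (ord (K ⊓ conjSub (l * m : G) J) / (ord K * ord J)) •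
            tw K (l * m : G) x y := by
        intro l
        let e : L ≃ conjSub (l : G) L := (Subgroup.equivSMul (MulAut.conj (l : G)) L).toEquiv
        have he : ∀ m : L, ((e m : conjSub (l : G) L) : G) * l = (l : G) * (m : G) := fun m => by
          change (l : G) * m * (l : G)⁻¹ * (l : G) = (l : G) * (m : G)
          simp
        rw [boxConj_pr, boxRes_pr, ← e.sum_comp, map_sum, Finset.smul_sum]
        refine Finset.sum_congr rfl fun m _ => ?_
        have h1 : conjSub (l * m : G) J ≤ conjSub (l : G) L := by
          rw [conjSub_mul]; exact conjSub_mono _ (conjSub_le_of_mem hJ m.2)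
        rw [map_smul, tw_conj, he, boxInd_tw _ _ _ _ (le_inf inf_le_left (inf_le_right.trans h1)),
          ord_conjSub, ← conjSub_mul, he, inf_assoc, inf_eq_right.2 h1, smul_smul, smul_smul,
          mul_comm (ord K) (ord L), mul_comm (ord K) (ord J),
          mul_comm (ord (K ⊓ conjSub (l : G) L)) (ord J)]
        congr 1
        have := ord_ne_zero (K ⊓ conjSub (l : G) L)
        have := ord_ne_zero K
        have := ord_ne_zero J
        have := ord_ne_zero L
        field_simp
      rw [Finset.sum_congr rfl fun l _ => key l, sum_mul_right hL (fun l =>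
        (ord L)⁻¹ • (ord (K ⊓ conjSub l J) / (ord K * ord J)) • tw K l x y), ← Finset.smul_sum,
        smul_smul, mul_inv_cancel₀ (ord_ne_zero L), one_smul]
    exact main

end Mackey

namespace Mackey

variable {G : Type} [Group G] [Finite G]

/-- Pairings of Mackey functors; they correspond to morphisms out of the box product. -/
structure Pairing (M N Q : Mackey G) where
  φ : ∀ H, M.obj H →ₗ[ℚ] N.obj H →ₗ[ℚ] Q.obj H
  res : ∀ {K H : Subgroup G} (h : K ≤ H) x y, φ K (M.res h x) (N.res h y) = Q.res h (φ H x y)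
  conj : ∀ (g : G) {H K : Subgroup G} (e : K = conjSub g H) x y,
    φ K (M.conj g e x) (N.conj g e y) = Q.conj g e (φ H x y)
  ind_right : ∀ {K H : Subgroup G} (h : K ≤ H) x y,
    φ H x (N.ind h y) = Q.ind h (φ K (M.res h x) y)
  ind_left : ∀ {K H : Subgroup G} (h : K ≤ H) x y,
    φ H (M.ind h x) y = Q.ind h (φ K x (N.res h y))

/-- The universal pairing `M, N → M □ N`. -/
def boxPairing (M N : Mackey G) : Pairing M N (box M N) where
  φ _ := pr M N le_rfl
  res h x y := (boxRes_pr_self h x y).symm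
  conj g H K e x y := by
    subst e
    exact (boxConj_pr g rfl le_rfl x y).symm
  ind_right h x y := (pr_res_left h le_rfl x y).symm.trans (boxInd_pr h le_rfl _ _).symm
  ind_left h x y := (pr_res_right h le_rfl x y).symm.trans (boxInd_pr h le_rfl _ _).symm

lemma Pairing.tr {M N Q : Mackey G} (p : Pairing M N Q) (g : G) {S K : Subgroup G}
    (h : S ≤ conjSub g K) (x : M.obj K) (y : N.obj K) :
    p.φ S (M.tr g h x) (N.tr g h y) = Q.tr g h (p.φ K x y) := by
  simp only [PreMackey.tr_def]
  rw [p.res, p.conj]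

/-- The class of `x ⊗ y` at the top level. -/
def tmul {M N : Mackey G} {H : Subgroup G} (x : M.obj H) (y : N.obj H) : (box M N).obj H :=
  (boxPairing M N).φ H x y

lemma pr_eq {M N : Mackey G} {K H : Subgroup G} (h : K ≤ H) (x : M.obj K) (y : N.obj K) :
    pr M N h x y = (box M N).ind h (tmul x y) := (boxInd_pr h le_rfl x y).symm

lemma res_tmul {M N : Mackey G} {K H : Subgroup G} (h : K ≤ H) (x : M.obj H) (y : N.obj H) :
    (box M N).res h (tmul x y) = tmul (M.res h x) (N.res h y) :=
  ((boxPairing M N).res h x y).symm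

lemma conj_tmul {M N : Mackey G} (g : G) {K H : Subgroup G} (e : K = conjSub g H)
    (x : M.obj H) (y : N.obj H) :
    (box M N).conj g e (tmul x y) = tmul (M.conj g e x) (N.conj g e y) :=
  ((boxPairing M N).conj g e x y).symm

lemma tr_tmul {M N : Mackey G} (g : G) {K H : Subgroup G} (e : K ≤ conjSub g H)
    (x : M.obj H) (y : N.obj H) :
    (box M N).tr g e (tmul x y) = tmul (M.tr g e x) (N.tr g e y) :=
  ((boxPairing M N).tr g e x y).symm

lemma tmul_ind {M N : Mackey G} {K H : Subgroup G} (h : K ≤ H) (x : M.obj H) (y : N.obj K) :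
    tmul x (N.ind h y) = (box M N).ind h (tmul (M.res h x) y) :=
  (boxPairing M N).ind_right h x y

lemma ind_tmul {M N : Mackey G} {K H : Subgroup G} (h : K ≤ H) (x : M.obj K) (y : N.obj H) :
    tmul (M.ind h x) y = (box M N).ind h (tmul x (N.res h y)) :=
  (boxPairing M N).ind_left h x y

lemma obj_ext {M N : Mackey G} {V : Type} [AddCommGroup V] [Module ℚ V] {H : Subgroup G}
    (f g : (box M N).obj H →ₗ[ℚ] V)
    (h : ∀ {K : Subgroup G} (hK : K ≤ H) (x : M.obj K) (y : N.obj K),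
      f ((box M N).ind hK (tmul x y)) = g ((box M N).ind hK (tmul x y))) (z) : f z = g z :=
  box_ext f g (fun hK x y => by rw [pr_eq]; exact h hK x y) z

/-- The map `x ⊗ y ↦ I φ(x, y)`. -/
def Pairing.liftApp {M N Q : Mackey G} (p : Pairing M N Q) (H : Subgroup G) :
    BoxObj M N H →ₗ[ℚ] Q.obj H :=
  boxLift (fun K hK => (p.φ K).compr₂ (Q.ind hK))
    (fun hL hK x y => by simp [p.ind_right, Q.ind_ind])
    (fun hL hK x y => by simp [p.ind_left, Q.ind_ind])
    (fun {h} hh K K' hK hK' e x y => by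
      simp only [LinearMap.compr₂_apply]
      rw [p.conj, Q.conj_ind h e (conjSub_of_mem hh).symm hK, Q.conj_self hh])

lemma Pairing.liftApp_pr {M N Q : Mackey G} (p : Pairing M N Q) {K H : Subgroup G} (hK : K ≤ H)
    (x : M.obj K) (y : N.obj K) : p.liftApp H (pr M N hK x y) = Q.ind hK (p.φ K x y) :=
  boxLift_pr _ _ _ _ _ _ _

/-- The morphism out of the box product given by a pairing. -/
def Pairing.lift {M N Q : Mackey G} (p : Pairing M N Q) : box M N ⟶ Q where
  app := p.liftApp
  app_res {S H} hS := box_ext (p.liftApp S ∘ₗ boxRes hS) (Q.res hS ∘ₗ p.liftApp H)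
    fun {K} hK x y => by
      rw [LinearMap.comp_apply, LinearMap.comp_apply, boxRes_pr, liftApp_pr, Q.res_ind, map_sum]
      refine Finset.sum_congr rfl fun l _ => ?_
      rw [map_smul, tw_apply, liftApp_pr, p.tr]
      rfl
  app_ind {S H} hS := box_ext (p.liftApp H ∘ₗ boxInd hS) (Q.ind hS ∘ₗ p.liftApp S)
    fun {K} hK x y => by
      rw [LinearMap.comp_apply, LinearMap.comp_apply, boxInd_pr, liftApp_pr, liftApp_pr, Q.ind_ind]
  app_conj g H K e := box_ext (p.liftApp K ∘ₗ boxConj g e) (Q.conj g e ∘ₗ p.liftApp H)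
    fun {J} hJ x y => by
      rw [LinearMap.comp_apply, LinearMap.comp_apply, boxConj_pr, liftApp_pr, liftApp_pr, p.conj,
        Q.conj_ind g rfl e hJ]

@[simp] lemma Pairing.lift_tmul {M N Q : Mackey G} (p : Pairing M N Q) {H : Subgroup G}
    (x : M.obj H) (y : N.obj H) : p.lift.app H (tmul x y) = p.φ H x y :=
  (p.liftApp_pr le_rfl x y).trans (Q.ind_self _)

lemma box_hom_ext {M N Q : Mackey G} {f g : box M N ⟶ Q}
    (h : ∀ H (x : M.obj H) (y : N.obj H), f.app H (tmul x y) = g.app H (tmul x y)) : f = g := by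
  ext H z
  refine obj_ext (f.app H) (g.app H) (fun hK x y => ?_) z
  rw [f.app_ind, g.app_ind, h]

lemma box_hom_ext₃ {M N P Q : Mackey G} {f g : box (box M N) P ⟶ Q}
    (h : ∀ H (x : M.obj H) (y : N.obj H) (z : P.obj H),
      f.app H (tmul (tmul x y) z) = g.app H (tmul (tmul x y) z)) : f = g := by
  refine box_hom_ext fun H w z => ?_
  refine obj_ext (f.app H ∘ₗ ((boxPairing (box M N) P).φ H).flip z)
    (g.app H ∘ₗ ((boxPairing (box M N) P).φ H).flip z) (fun {K} hK x y => ?_) w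
  change f.app H (tmul _ z) = g.app H (tmul _ z)
  rw [ind_tmul, f.app_ind, g.app_ind, h]

lemma box_hom_ext₄ {M N P Q R : Mackey G} {f g : box (box (box M N) P) Q ⟶ R}
    (h : ∀ H (x : M.obj H) (y : N.obj H) (z : P.obj H) (w : Q.obj H),
      f.app H (tmul (tmul (tmul x y) z) w) = g.app H (tmul (tmul (tmul x y) z) w)) : f = g := by
  refine box_hom_ext₃ fun H v z w => ?_
  refine obj_ext (f.app H ∘ₗ ((boxPairing _ Q).φ H).flip w ∘ₗ ((boxPairing (box M N) P).φ H).flip z)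
    (g.app H ∘ₗ ((boxPairing _ Q).φ H).flip w ∘ₗ ((boxPairing (box M N) P).φ H).flip z)
    (fun {K} hK x y => ?_) v
  change f.app H (tmul (tmul _ z) w) = g.app H (tmul (tmul _ z) w)
  rw [ind_tmul, ind_tmul, f.app_ind, g.app_ind, h]

lemma box_hom_ext₃' {M N P Q : Mackey G} {f g : box M (box N P) ⟶ Q}
    (h : ∀ H (x : M.obj H) (y : N.obj H) (z : P.obj H),
      f.app H (tmul x (tmul y z)) = g.app H (tmul x (tmul y z))) : f = g := by
  refine box_hom_ext fun H x w => ?_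
  refine obj_ext (f.app H ∘ₗ (boxPairing M (box N P)).φ H x)
    (g.app H ∘ₗ (boxPairing M (box N P)).φ H x) (fun {K} hK y z => ?_) w
  change f.app H (tmul x _) = g.app H (tmul x _)
  rw [tmul_ind, f.app_ind, g.app_ind, h]

/-- The box product of two morphisms. -/
def boxMap {M N M' N' : Mackey G} (f : M ⟶ M') (g : N ⟶ N') : box M N ⟶ box M' N' :=
  Pairing.lift
    { φ := fun H => ((boxPairing M' N').φ H).compl₁₂ (f.app H) (g.app H)
      res := fun h x y => by
        simp only [LinearMap.compl₁₂_apply]; rw [f.app_res, g.app_res, Pairing.res]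
      conj := fun a H K e x y => by
        simp only [LinearMap.compl₁₂_apply]; rw [f.app_conj, g.app_conj, Pairing.conj]
      ind_right := fun h x y => by
        simp only [LinearMap.compl₁₂_apply]; rw [f.app_res, g.app_ind, Pairing.ind_right]
      ind_left := fun h x y => by
        simp only [LinearMap.compl₁₂_apply]; rw [f.app_ind, g.app_res, Pairing.ind_left] }

@[simp] lemma boxMap_tmul {M N M' N' : Mackey G} (f : M ⟶ M') (g : N ⟶ N') {H : Subgroup G}
    (x : M.obj H) (y : N.obj H) :
    (boxMap f g).app H (tmul x y) = tmul (f.app H x) (g.app H y) := Pairing.lift_tmul _ _ _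

/-- The symmetry `x ⊗ y ↦ y ⊗ x`. -/
def boxSwap (M N : Mackey G) : box M N ⟶ box N M :=
  Pairing.lift
    { φ := fun H => ((boxPairing N M).φ H).flip
      res := fun h x y => (boxPairing N M).res h y x
      conj := fun a _ _ e x y => (boxPairing N M).conj a e y x
      ind_right := fun h x y => (boxPairing N M).ind_left h y x
      ind_left := fun h x y => (boxPairing N M).ind_right h y x }

@[simp] lemma boxSwap_tmul (M N : Mackey G) {H : Subgroup G} (x : M.obj H) (y : N.obj H) :
    (boxSwap M N).app H (tmul x y) = tmul y x := Pairing.lift_tmul _ _ _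

lemma boxSwap_boxSwap (M N : Mackey G) : boxSwap M N ≫ boxSwap N M = 𝟙 _ :=
  box_hom_ext fun H x y => by
    rw [comp_app, boxSwap_tmul, boxSwap_tmul, id_app]

/-- `x ⊗ y ⊗ z ↦ x ⊗ (y ⊗ R z)`. -/
def assocFun (M N P : Mackey G) {L K : Subgroup G} (hL : L ≤ K) :
    M.obj L →ₗ[ℚ] N.obj L →ₗ[ℚ] P.obj K →ₗ[ℚ] (box M (box N P)).obj K :=
  LinearMap.mk₂ ℚ (fun x y => (box M (box N P)).ind hL ∘ₗ
      (boxPairing M (box N P)).φ L x ∘ₗ (boxPairing N P).φ L y ∘ₗ P.res hL)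
      (fun x x' y => by ext z; simp) (fun c x y => by ext z; simp)
      (fun x y y' => by ext z; simp) (fun c x y => by ext z; simp)

lemma assocFun_apply (M N P : Mackey G) {L K : Subgroup G} (hL : L ≤ K) (x : M.obj L)
    (y : N.obj L) (z : P.obj K) : assocFun M N P hL x y z =
      (box M (box N P)).ind hL (tmul x (tmul y (P.res hL z))) := rfl

/-- For `z` at level `K`, `x ⊗ y` at level `L ≤ K` is sent to `x ⊗ (y ⊗ R z)`. -/
def assocAux (M N P : Mackey G) (K : Subgroup G) :
    (box M N).obj K →ₗ[ℚ] P.obj K →ₗ[ℚ] (box M (box N P)).obj K :=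
  boxLift (fun L hL => assocFun M N P hL)
    (fun {L K'} hL hK x y => by
      ext z
      simp only [assocFun_apply]
      rw [ind_tmul, tmul_ind, PreMackey.ind_ind, P.res_res])
    (fun {L K'} hL hK x y => by
      ext z
      simp only [assocFun_apply]
      rw [ind_tmul, PreMackey.ind_ind, res_tmul, P.res_res])
    (fun {h} hh L L' hL hL' e x y => by
      ext z
      simp only [assocFun_apply]
      have e' := (conjSub_of_mem hh).symm
      rw [← P.conj_self hh e' z, P.conj_res h e e' hL hL', P.conj_self hh e' z, ← conj_tmul,
        ← conj_tmul, (box M (box N P)).conj_ind h e e' hL hL', PreMackey.conj_self _ hh])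

lemma assocAux_ind (M N P : Mackey G) {L K : Subgroup G} (hL : L ≤ K) (x : M.obj L) (y : N.obj L)
    (z : P.obj K) : assocAux M N P K ((box M N).ind hL (tmul x y)) z =
      (box M (box N P)).ind hL (tmul x (tmul y (P.res hL z))) := by
  rw [← pr_eq]
  exact LinearMap.congr_fun (boxLift_pr _ _ _ _ _ _ _) z

lemma dc_tmul {M N : Mackey G} {S K : Subgroup G} (l : G) (x : M.obj K) (y : N.obj K) :
    (box M N).dc S l (tmul x y) = tw S l x y := by
  unfold PreMackey.dc
  rw [tr_tmul, ← pr_eq]; rfl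

lemma assocAux_dc (M N P : Mackey G) {S K : Subgroup G} (l : G) (x : M.obj K) (y : N.obj K)
    (z : P.obj S) : assocAux M N P S ((box M N).dc S l (tmul x y)) z =
      (box M (box N P)).ind inf_le_left (tmul (M.tr l inf_le_right x)
        (tmul (N.tr l inf_le_right y) (P.res (inf_le_left : S ⊓ conjSub l K ≤ S) z))) := by
  unfold PreMackey.dc
  rw [tr_tmul, assocAux_ind]

/-- The pairing that defines the associator. -/
def assocPairing (M N P : Mackey G) : Pairing (box M N) P (box M (box N P)) where
  φ := assocAux M N P
  res {S K} h w z := by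
    refine obj_ext ((assocAux M N P S).flip (P.res h z) ∘ₗ (box M N).res h)
      ((box M (box N P)).res h ∘ₗ (assocAux M N P K).flip z) (fun {L} hL x y => ?_) w
    simp only [LinearMap.comp_apply, LinearMap.flip_apply]
    rw [assocAux_ind, Mackey.res_ind, Mackey.res_ind, map_sum, LinearMap.sum_apply]
    refine Finset.sum_congr rfl fun l _ => ?_
    rw [map_smul, LinearMap.smul_apply, assocAux_dc]
    unfold PreMackey.dc
    have e : conjSub (l : G) L ≤ K := conjSub_le_of_mem hL l.2
    have e' : S ⊓ conjSub (l : G) L ≤ conjSub (l : G) K := by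
      rw [conjSub_of_mem l.2]; exact inf_le_right.trans e
    rw [tr_tmul, tr_tmul, P.res_res, P.tr_res _ _ hL e', P.tr_mem l.2 (inf_le_right.trans e)]
  conj g H K e w z := by
    refine obj_ext ((assocAux M N P K).flip (P.conj g e z) ∘ₗ (box M N).conj g e)
      ((box M (box N P)).conj g e ∘ₗ (assocAux M N P H).flip z) (fun {L} hL x y => ?_) w
    simp only [LinearMap.comp_apply, LinearMap.flip_apply]
    have h' := (conjSub_mono g hL).trans e.ge
    rw [assocAux_ind, ← PreMackey.conj_ind _ g rfl e hL h', ← PreMackey.conj_ind _ g rfl e hL h',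
      conj_tmul, conj_tmul, conj_tmul, assocAux_ind, P.conj_res g rfl e hL h']
  ind_right {S K} h w z := by
    refine obj_ext ((assocAux M N P K).flip (P.ind h z))
      ((box M (box N P)).ind h ∘ₗ (assocAux M N P S).flip z ∘ₗ (box M N).res h)
      (fun {L} hL x y => ?_) w
    simp only [LinearMap.comp_apply, LinearMap.flip_apply]
    rw [assocAux_ind, Mackey.res_ind, Mackey.res_ind, map_sum, LinearMap.sum_apply, map_sum,
      ← sum_inv_subgroup (fun m : G => (ord (L ⊓ conjSub m S) / (ord L * ord S)) • P.dc L m z)]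
    have h1 : ∀ v : K → P.obj L, (box M (box N P)).ind hL (tmul x (tmul y (∑ l, v l))) =
        ∑ l, (box M (box N P)).ind hL (tmul x (tmul y (v l))) := fun v => by
      simp only [tmul, map_sum]
    have h2 : ∀ (c : ℚ) (v : P.obj L), (box M (box N P)).ind hL (tmul x (tmul y (c • v))) =
        c • (box M (box N P)).ind hL (tmul x (tmul y v)) := fun c v => by
      simp only [tmul, map_smul]
    rw [h1]
    refine Finset.sum_congr rfl fun l _ => ?_
    have e : S ⊓ conjSub (l : G) L = conjSub (l : G) (L ⊓ conjSub (l : G)⁻¹ S) := inf_conjSub _ _ _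
    have h3 : L ⊓ conjSub (l : G)⁻¹ S ≤ K := inf_le_left.trans hL
    have h4 : S ⊓ conjSub (l : G) L ≤ conjSub ((l : G) * (l : G)⁻¹) S := by
      rw [mul_inv_cancel, conjSub_one]; exact inf_le_left
    have h5 : S ⊓ conjSub (l : G) L ≤ conjSub 1 S := by
      rw [conjSub_one]; exact inf_le_left
    rw [h2, map_smul, LinearMap.smul_apply, map_smul, assocAux_dc,
      show ord (S ⊓ conjSub (l : G) L) = ord (L ⊓ conjSub (l : G)⁻¹ S) by rw [e, ord_conjSub],
      mul_comm (ord L)]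
    congr 1
    unfold PreMackey.dc
    rw [tmul_ind, tmul_ind, PreMackey.ind_ind, PreMackey.ind_ind,
      ← PreMackey.conj_self _ l.2 (conjSub_of_mem l.2).symm (PreMackey.ind _ _ (tmul _ _)),
      ← PreMackey.conj_ind _ (l : G) e (conjSub_of_mem l.2).symm h3 (inf_le_left.trans h),
      conj_tmul, conj_tmul, M.conj_eq_tr, N.conj_eq_tr, P.conj_eq_tr, M.tr_res _ _ _ inf_le_right,
      N.tr_res _ _ _ inf_le_right, P.tr_tr _ _ _ _ h4, P.res_eq_tr,
      P.tr_congr (mul_inv_cancel (l : G)) h4 h5]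
  ind_left {S K} h w z := by
    refine obj_ext ((assocAux M N P K).flip z ∘ₗ (box M N).ind h)
      ((box M (box N P)).ind h ∘ₗ (assocAux M N P S).flip (P.res h z))
      (fun {L} hL x y => ?_) w
    simp only [LinearMap.comp_apply, LinearMap.flip_apply]
    rw [PreMackey.ind_ind, assocAux_ind, assocAux_ind, PreMackey.ind_ind, P.res_res]

/-- The associator `(x ⊗ y) ⊗ z ↦ x ⊗ (y ⊗ z)`. -/
def assocHom (M N P : Mackey G) : box (box M N) P ⟶ box M (box N P) := (assocPairing M N P).lift

@[simp] lemma assocHom_tmul (M N P : Mackey G) {H : Subgroup G} (x : M.obj H) (y : N.obj H)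
    (z : P.obj H) : (assocHom M N P).app H (tmul (tmul x y) z) = tmul x (tmul y z) := by
  rw [assocHom, Pairing.lift_tmul]
  have := assocAux_ind M N P (le_refl H) x y z
  rw [PreMackey.ind_self, PreMackey.ind_self, P.res_self] at this
  exact this

/-- The inverse of the associator. -/
def assocInv (M N P : Mackey G) : box M (box N P) ⟶ box (box M N) P :=
  boxSwap M (box N P) ≫ boxMap (boxSwap N P) (𝟙 M) ≫ assocHom P N M ≫
    boxSwap P (box N M) ≫ boxMap (boxSwap N M) (𝟙 P)

@[simp] lemma assocInv_tmul (M N P : Mackey G) {H : Subgroup G} (x : M.obj H) (y : N.obj H)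
    (z : P.obj H) : (assocInv M N P).app H (tmul x (tmul y z)) = tmul (tmul x y) z := by
  simp [assocInv]

/-- The associativity isomorphism. -/
def assocIso (M N P : Mackey G) : box (box M N) P ≅ box M (box N P) where
  hom := assocHom M N P
  inv := assocInv M N P
  hom_inv_id := box_hom_ext₃ fun H x y z => by
    rw [comp_app, assocHom_tmul, assocInv_tmul, id_app]
  inv_hom_id := box_hom_ext₃' fun H x y z => by
    rw [comp_app, assocInv_tmul, assocHom_tmul, id_app]

/-- The symmetry isomorphism. -/
def swapIso (M N : Mackey G) : box M N ≅ box N M where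
  hom := boxSwap M N
  inv := boxSwap N M
  hom_inv_id := boxSwap_boxSwap M N
  inv_hom_id := boxSwap_boxSwap N M

end Mackey

/-! ### The rational Burnside ring -/

section Burnside

/-- Finite `Γ`-sets; up to isomorphism the underlying set is `{0, …, n - 1}`. -/
structure FinGSet (Γ : Type) [Group Γ] where
  n : ℕ
  [act : MulAction Γ (Fin n)]

attribute [instance] FinGSet.act

variable {Γ Γ' : Type} [Group Γ] [Group Γ']

/-- `X` is isomorphic to the disjoint union of `Y` and `Z`. -/
def FinGSet.IsDisjUnion (X Y Z : FinGSet Γ) : Prop :=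
  ∃ e : Fin X.n ≃ Fin Y.n ⊕ Fin Z.n, ∀ (g : Γ) (x : Fin X.n), e (g • x) = g • e x

/-- The relations `[X] = [Y] + [Z]` for `X ≅ Y ⊔ Z`. -/
def burnsideRel (Γ : Type) [Group Γ] : Submodule ℚ (FinGSet Γ →₀ ℚ) :=
  Submodule.span ℚ {v | ∃ X Y Z : FinGSet Γ, X.IsDisjUnion Y Z ∧
    v = Finsupp.single X 1 - Finsupp.single Y 1 - Finsupp.single Z 1}

/-- The rational Grothendieck group `A_ℚ(Γ)` of finite `Γ`-sets under disjoint union. -/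
def Burnside (Γ : Type) [Group Γ] : Type := (FinGSet Γ →₀ ℚ) ⧸ burnsideRel Γ

instance : AddCommGroup (Burnside Γ) :=
  inferInstanceAs (AddCommGroup ((FinGSet Γ →₀ ℚ) ⧸ burnsideRel Γ))
instance : Module ℚ (Burnside Γ) :=
  inferInstanceAs (Module ℚ ((FinGSet Γ →₀ ℚ) ⧸ burnsideRel Γ))

/-- A finite `Γ`-set, transported to `{0, …, n - 1}`. -/
def FinGSet.of (Γ : Type) [Group Γ] (X : Type) [MulAction Γ X] [Finite X] : FinGSet Γ where
  n := Nat.card X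
  act := Equiv.mulAction Γ (Finite.equivFin X).symm

/-- The transport of structure. -/
def FinGSet.ofEquiv (Γ : Type) [Group Γ] (X : Type) [MulAction Γ X] [Finite X] :
    Fin (FinGSet.of Γ X).n ≃ X := (Finite.equivFin X).symm

lemma FinGSet.ofEquiv_smul (X : Type) [MulAction Γ X] [Finite X] (g : Γ)
    (x : Fin (FinGSet.of Γ X).n) :
    FinGSet.ofEquiv Γ X (g • x) = g • FinGSet.ofEquiv Γ X x :=
  (Finite.equivFin X).symm.apply_symm_apply _

lemma FinGSet.ofEquiv_symm_smul (X : Type) [MulAction Γ X] [Finite X] (g : Γ) (x : X) :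
    (FinGSet.ofEquiv Γ X).symm (g • x) = g • (FinGSet.ofEquiv Γ X).symm x := by
  rw [Equiv.symm_apply_eq, ofEquiv_smul, Equiv.apply_symm_apply]

/-- The class `[X]` in the Burnside ring. -/
def FinGSet.cl (X : FinGSet Γ) : Burnside Γ := (burnsideRel Γ).mkQ (Finsupp.single X 1)

/-- The class `[X]` of a finite `Γ`-set. -/
def cls (Γ : Type) [Group Γ] (X : Type) [MulAction Γ X] [Finite X] : Burnside Γ :=
  (FinGSet.of Γ X).cl

namespace Burnside

variable {V : Type} [AddCommGroup V] [Module ℚ V]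

/-- Linear maps out of the Burnside ring: additive invariants of finite `Γ`-sets. -/
def lift (f : FinGSet Γ → V) (hf : ∀ X Y Z : FinGSet Γ, X.IsDisjUnion Y Z → f X = f Y + f Z) :
    Burnside Γ →ₗ[ℚ] V :=
  (burnsideRel Γ).liftQ (Finsupp.linearCombination ℚ f) (by
    rw [burnsideRel, Submodule.span_le]
    rintro _ ⟨X, Y, Z, h, rfl⟩
    simp [hf X Y Z h])

lemma lift_cls (f : FinGSet Γ → V) (hf) (X : Type) [MulAction Γ X] [Finite X] :
    lift f hf (cls Γ X) = f (FinGSet.of Γ X) := by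
  refine (Submodule.liftQ_apply _ _ _).trans ?_
  simp

lemma cls_union {X Y Z : Type} [MulAction Γ X] [Finite X] [MulAction Γ Y] [Finite Y]
    [MulAction Γ Z] [Finite Z] (e : X ≃ Y ⊕ Z) (he : ∀ (g : Γ) x, e (g • x) = g • e x) :
    cls Γ X = cls Γ Y + cls Γ Z := by
  have h : (FinGSet.of Γ X).IsDisjUnion (FinGSet.of Γ Y) (FinGSet.of Γ Z) := by
    refine ⟨(FinGSet.ofEquiv Γ X).trans (e.trans
      (Equiv.sumCongr (FinGSet.ofEquiv Γ Y).symm (FinGSet.ofEquiv Γ Z).symm)), fun g x => ?_⟩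
    simp only [Equiv.trans_apply, FinGSet.ofEquiv_smul, he]
    rcases e (FinGSet.ofEquiv Γ X x) with y | z
    · simp [FinGSet.ofEquiv_symm_smul]
    · simp [FinGSet.ofEquiv_symm_smul]
  rw [← sub_eq_zero, ← sub_sub]
  exact (Submodule.Quotient.mk_eq_zero _).2 (Submodule.subset_span ⟨_, _, _, h, rfl⟩)

lemma cls_empty (X : Type) [MulAction Γ X] [IsEmpty X] : cls Γ X = 0 := by
  have := cls_union (Γ := Γ) (Equiv.equivOfIsEmpty X (X ⊕ X)) (fun _ x => isEmptyElim x)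
  exact left_eq_add.1 this

lemma cls_congr {X Y : Type} [MulAction Γ X] [Finite X] [MulAction Γ Y] [Finite Y] (e : X ≃ Y)
    (he : ∀ (g : Γ) x, e (g • x) = g • e x) : cls Γ X = cls Γ Y := by
  let _ : MulAction Γ Empty :=
    { smul := fun _ x => x, one_smul := fun x => x.elim, mul_smul := fun _ _ x => x.elim }
  rw [cls_union (e.trans (Equiv.sumEmpty Y Empty).symm) (fun g x => by simp [he]),
    cls_empty Empty, add_zero]

lemma cl_eq_cls (X : FinGSet Γ) : X.cl = cls Γ (Fin X.n) := by
  let _ : MulAction Γ Empty :=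
    { smul := fun _ x => x, one_smul := fun x => x.elim, mul_smul := fun _ _ x => x.elim }
  have h : X.IsDisjUnion (FinGSet.of Γ (Fin X.n)) (FinGSet.of Γ Empty) := by
    have : IsEmpty (Fin (FinGSet.of Γ Empty).n) := (FinGSet.ofEquiv Γ Empty).isEmpty
    exact ⟨(FinGSet.ofEquiv Γ (Fin X.n)).symm.trans (Equiv.sumEmpty _ _).symm, fun g x => by
      simp [FinGSet.ofEquiv_symm_smul]⟩
  have h2 : X.cl - cls Γ (Fin X.n) - cls Γ Empty =
      (0 : Burnside Γ) :=
    (Submodule.Quotient.mk_eq_zero _).2 (Submodule.subset_span ⟨_, _, _, h, rfl⟩)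
  rw [cls_empty Empty, sub_zero] at h2
  exact sub_eq_zero.1 h2

lemma ext {f g : Burnside Γ →ₗ[ℚ] V}
    (h : ∀ (X : Type) [MulAction Γ X] [Finite X], f (cls Γ X) = g (cls Γ X)) (a : Burnside Γ) :
    f a = g a := by
  have : f = g := by
    refine Submodule.linearMap_qext _ (Finsupp.lhom_ext' fun X => LinearMap.ext_ring ?_)
    have := h (Fin X.n)
    rw [← cl_eq_cls] at this
    exact this
  rw [this]

/-- The linear map `[X] ↦ ∑ w(Stab x)`, the sum over all `x ∈ X`. -/
def liftStab (w : Subgroup Γ → V) : Burnside Γ →ₗ[ℚ] V :=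
  lift (fun X => ∑ x : Fin X.n, w (MulAction.stabilizer Γ x)) (by
    rintro X Y Z ⟨e, he⟩
    rw [← e.symm.sum_comp, Fintype.sum_sum_type]
    congr 1 <;>
    · refine Finset.sum_congr rfl fun y _ => ?_
      congr 1
      ext g
      simp only [MulAction.mem_stabilizer_iff]
      rw [← e.apply_eq_iff_eq, he]
      simp)

lemma liftStab_cls (w : Subgroup Γ → V) (X : Type) [MulAction Γ X] [Finite X] :
    liftStab w (cls Γ X) = ∑ x : X, w (MulAction.stabilizer Γ x) := by
  rw [liftStab, lift_cls, ← Equiv.sum_comp (FinGSet.ofEquiv Γ X)]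
  refine Finset.sum_congr rfl fun x _ => ?_
  congr 1
  ext g
  simp only [MulAction.mem_stabilizer_iff]
  rw [← FinGSet.ofEquiv_smul, Equiv.apply_eq_iff_eq]

/-- `X` with `Γ'` acting through `φ : Γ' → Γ`. -/
def Twist (_ : Γ' →* Γ) (X : Type) : Type := X

instance (φ : Γ' →* Γ) (X : Type) [MulAction Γ X] : MulAction Γ' (Twist φ X) :=
  MulAction.compHom X φ
instance (φ : Γ' →* Γ) (X : Type) [h : Finite X] : Finite (Twist φ X) := h

/-- Restriction of the action along a homomorphism. -/
def twist (φ : Γ' →* Γ) : Burnside Γ →ₗ[ℚ] Burnside Γ' :=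
  lift (fun X => cls Γ' (Twist φ (Fin X.n))) (by
    rintro X Y Z ⟨e, he⟩
    refine cls_union (X := Twist φ (Fin X.n)) (Y := Twist φ (Fin Y.n)) (Z := Twist φ (Fin Z.n))
      e (fun g x => ?_)
    refine (he (φ g) x).trans ?_
    rcases h : e x with y | z <;> rfl)

lemma twist_cls (φ : Γ' →* Γ) (X : Type) [MulAction Γ X] [Finite X] :
    twist φ (cls Γ X) = cls Γ' (Twist φ X) := by
  rw [twist, lift_cls]
  exact cls_congr (X := Twist φ (Fin (FinGSet.of Γ X).n)) (Y := Twist φ X) (FinGSet.ofEquiv Γ X)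
    (fun g x => FinGSet.ofEquiv_smul X (φ g) x)

/-- `Γ × X` with `Γ'` acting by `k (γ, x) = (γ k⁻¹, k x)`. -/
def IndPre (_ : Γ' →* Γ) (X : Type) : Type := Γ × X

instance (φ : Γ' →* Γ) (X : Type) [MulAction Γ' X] : MulAction Γ' (IndPre φ X) where
  smul k p := (p.1 * (φ k)⁻¹, k • p.2)
  one_smul p := by
    change (p.1 * (φ 1)⁻¹, (1 : Γ') • p.2) = (p.1, p.2)
    simp
  mul_smul k k' p := by
    change (p.1 * (φ (k * k'))⁻¹, (k * k') • p.2) = (p.1 * (φ k')⁻¹ * (φ k)⁻¹, k • k' • p.2)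
    simp [mul_smul, mul_assoc]

instance (φ : Γ' →* Γ) (X : Type) [Finite Γ] [Finite X] : Finite (IndPre φ X) :=
  inferInstanceAs (Finite (Γ × X))

/-- The induced `Γ`-set `Γ ×_{Γ'} X`. -/
def IndSet (φ : Γ' →* Γ) (X : Type) [MulAction Γ' X] : Type :=
  MulAction.orbitRel.Quotient Γ' (IndPre φ X)

instance (φ : Γ' →* Γ) (X : Type) [MulAction Γ' X] [Finite Γ] [Finite X] : Finite (IndSet φ X) :=
  inferInstanceAs (Finite (_root_.Quotient _))

/-- The class of `(γ, x)`. -/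
def IndSet.mk (φ : Γ' →* Γ) {X : Type} [MulAction Γ' X] (γ : Γ) (x : X) : IndSet φ X :=
  Quotient.mk'' ((γ, x) : Γ × X)

lemma IndSet.mk_eq (φ : Γ' →* Γ) {X : Type} [MulAction Γ' X] (γ δ : Γ) (x y : X) :
    IndSet.mk φ γ x = IndSet.mk φ δ y ↔ ∃ k : Γ', γ = δ * (φ k)⁻¹ ∧ x = k • y := by
  refine (Quotient.eq'' (s₁ := MulAction.orbitRel Γ' (IndPre φ X))).trans ?_
  constructor
  · rintro ⟨k, hk⟩
    exact ⟨k, (congrArg Prod.fst hk).symm, (congrArg Prod.snd hk).symm⟩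
  · rintro ⟨k, rfl, rfl⟩
    exact ⟨k, rfl⟩

lemma IndSet.ind (φ : Γ' →* Γ) {X : Type} [MulAction Γ' X] {p : IndSet φ X → Prop}
    (h : ∀ γ x, p (IndSet.mk φ γ x)) (z : IndSet φ X) : p z :=
  Quotient.inductionOn' z fun q => h q.1 q.2

/-- Maps out of the induced set. -/
def IndSet.lift (φ : Γ' →* Γ) {X Y : Type} [MulAction Γ' X] (f : Γ → X → Y)
    (hf : ∀ γ x k, f (γ * (φ k)⁻¹) (k • x) = f γ x) : IndSet φ X → Y :=
  fun z => Quotient.liftOn' z (fun q => f q.1 q.2) (by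
    rintro ⟨_, _⟩ ⟨γ, x⟩ ⟨k, hk⟩
    cases hk
    exact hf γ x k)

@[simp] lemma IndSet.lift_mk (φ : Γ' →* Γ) {X Y : Type} [MulAction Γ' X] (f : Γ → X → Y)
    (hf : ∀ γ x k, f (γ * (φ k)⁻¹) (k • x) = f γ x) (γ : Γ) (x : X) :
    IndSet.lift φ f hf (IndSet.mk φ γ x) = f γ x := rfl

instance (φ : Γ' →* Γ) (X : Type) [MulAction Γ' X] : MulAction Γ (IndSet φ X) where
  smul g := IndSet.lift φ (fun γ x => IndSet.mk φ (g * γ) x) (fun γ x k =>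
    (IndSet.mk_eq φ _ _ _ _).2 ⟨k, by rw [mul_assoc], rfl⟩)
  one_smul := IndSet.ind φ fun γ x => by
    change IndSet.mk φ (1 * γ) x = _
    rw [one_mul]
  mul_smul g h := IndSet.ind φ fun γ x => by
    change IndSet.mk φ (g * h * γ) x = IndSet.mk φ (g * (h * γ)) x
    rw [mul_assoc]

lemma IndSet.smul_mk (φ : Γ' →* Γ) {X : Type} [MulAction Γ' X] (g γ : Γ) (x : X) :
    g • IndSet.mk φ γ x = IndSet.mk φ (g * γ) x := rfl

/-- Functoriality of the induced set. -/
def IndSet.map (φ : Γ' →* Γ) {X Y : Type} [MulAction Γ' X] [MulAction Γ' Y] (f : X → Y)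
    (hf : ∀ (k : Γ') x, f (k • x) = k • f x) : IndSet φ X → IndSet φ Y :=
  IndSet.lift φ (fun γ x => IndSet.mk φ γ (f x)) (fun _ x k =>
    (IndSet.mk_eq φ _ _ _ _).2 ⟨k, rfl, hf k x⟩)

lemma cls_indSet_union [Finite Γ] (φ : Γ' →* Γ) {X Y Z : Type} [MulAction Γ' X] [Finite X]
    [MulAction Γ' Y] [Finite Y] [MulAction Γ' Z] [Finite Z] (e : X ≃ Y ⊕ Z)
    (he : ∀ (g : Γ') x, e (g • x) = g • e x) :
    cls Γ (IndSet φ X) = cls Γ (IndSet φ Y) + cls Γ (IndSet φ Z) := by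
  have hs : ∀ (g : Γ') y, e.symm (g • y) = g • e.symm y := fun g y => by
    rw [Equiv.symm_apply_eq, he, Equiv.apply_symm_apply]
  refine cls_union
    { toFun := IndSet.lift φ (fun γ x => Sum.map (IndSet.mk φ γ) (IndSet.mk φ γ) (e x))
        (fun _ x k => ?_)
      invFun := Sum.elim (IndSet.map φ (fun y => e.symm (Sum.inl y)) (fun k y => hs k (Sum.inl y)))
        (IndSet.map φ (fun z => e.symm (Sum.inr z)) (fun k z => hs k (Sum.inr z)))
      left_inv := IndSet.ind φ fun γ x => ?_
      right_inv := ?_ } (fun g => IndSet.ind φ fun γ x => ?_)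
  · rw [he]
    rcases e x with y | z
    · exact congrArg Sum.inl ((IndSet.mk_eq φ _ _ _ _).2 ⟨k, rfl, rfl⟩)
    · exact congrArg Sum.inr ((IndSet.mk_eq φ _ _ _ _).2 ⟨k, rfl, rfl⟩)
  · rw [IndSet.lift_mk]
    rcases h : e x with y | z <;>
    · rw [← Equiv.eq_symm_apply] at h
      subst h
      rfl
  · rintro (z | z) <;>
    · revert z
      refine IndSet.ind φ fun γ x => ?_
      simp [IndSet.map]
  · change Sum.map (IndSet.mk φ (g * γ)) (IndSet.mk φ (g * γ)) (e x) =
      g • Sum.map (IndSet.mk φ γ) (IndSet.mk φ γ) (e x)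
    rcases e x with y | z <;> rfl

lemma cls_indSet_congr [Finite Γ] (φ : Γ' →* Γ) {X Y : Type} [MulAction Γ' X] [Finite X]
    [MulAction Γ' Y] [Finite Y] (e : X ≃ Y) (he : ∀ (g : Γ') x, e (g • x) = g • e x) :
    cls Γ (IndSet φ X) = cls Γ (IndSet φ Y) := by
  let _ : MulAction Γ' Empty :=
    { smul := fun _ x => x, one_smul := fun x => x.elim, mul_smul := fun _ _ x => x.elim }
  have : IsEmpty (IndSet φ Empty) := ⟨IndSet.ind φ fun _ x => x.elim⟩
  rw [cls_indSet_union φ (e.trans (Equiv.sumEmpty Y Empty).symm) (fun g x => by simp [he]),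
    cls_empty (IndSet φ Empty), add_zero]

/-- Induction of sets with group actions. -/
def induce [Finite Γ] (φ : Γ' →* Γ) : Burnside Γ' →ₗ[ℚ] Burnside Γ :=
  lift (fun X => cls Γ (IndSet φ (Fin X.n))) (by
    rintro X Y Z ⟨e, he⟩
    exact cls_indSet_union φ e he)

lemma induce_cls [Finite Γ] (φ : Γ' →* Γ) (X : Type) [MulAction Γ' X] [Finite X] :
    induce φ (cls Γ' X) = cls Γ (IndSet φ X) := by
  rw [induce, lift_cls]
  exact cls_indSet_congr φ (FinGSet.ofEquiv Γ' X) (FinGSet.ofEquiv_smul X)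

lemma stabilizer_mk (φ : Γ' →* Γ) {X : Type} [MulAction Γ' X] (γ : Γ) (x : X) :
    MulAction.stabilizer Γ (IndSet.mk φ γ x) =
      conjSub γ ((MulAction.stabilizer Γ' x).map φ) := by
  ext g
  rw [MulAction.mem_stabilizer_iff, IndSet.smul_mk, IndSet.mk_eq, mem_conjSub, Subgroup.mem_map]
  constructor
  · rintro ⟨k, h1, h2⟩
    refine ⟨k⁻¹, ?_, ?_⟩
    · rw [inv_mem_iff, MulAction.mem_stabilizer_iff]; exact h2.symm
    · rw [map_inv, mul_assoc, h1]; group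
  · rintro ⟨k, h1, h2⟩
    refine ⟨k⁻¹, ?_, ?_⟩
    · rw [map_inv, inv_inv, h2]; group
    · rw [eq_comm, ← MulAction.mem_stabilizer_iff, inv_mem_iff]; exact h1

lemma liftStab_induce [Finite Γ] [Finite Γ'] (φ : Γ' →* Γ) (hφ : Function.Injective φ)
    (w : Subgroup Γ → V) (a : Burnside Γ') :
    liftStab w (induce φ a) = (Nat.card Γ' : ℚ)⁻¹ •
      ∑ γ : Γ, liftStab (fun S => w (conjSub γ (S.map φ))) a := by
  have := ext (f := liftStab w ∘ₗ induce φ) (g := (Nat.card Γ' : ℚ)⁻¹ •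
      ∑ γ : Γ, liftStab (fun S => w (conjSub γ (S.map φ)))) (fun X _ _ => ?_) a
  · refine this.trans ?_
    simp [LinearMap.sum_apply]
  · rw [LinearMap.comp_apply, induce_cls, liftStab_cls]
    have h1 := orbit_sum (Γ := Γ') (X := IndPre φ X) (Q := IndSet φ X)
      (fun p => w (MulAction.stabilizer Γ (IndSet.mk φ p.1 p.2)))
      (fun k p => by
        congr 2
        exact (IndSet.mk_eq φ _ _ _ _).2 ⟨k, rfl, rfl⟩)
      (fun p => IndSet.mk φ p.1 p.2) (fun q => q.out) (fun q => Quotient.out_eq' q)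
      (fun p q => by
        rw [eq_comm, IndSet.mk_eq]
        constructor
        · rintro ⟨k, h1, h2⟩; exact ⟨k, Prod.ext h1.symm h2.symm⟩
        · rintro ⟨k, rfl⟩; exact ⟨k, rfl, rfl⟩)
    have h2 : ∀ q : IndSet φ X, IndSet.mk φ (q.out : IndPre φ X).1 (q.out : IndPre φ X).2 = q :=
      fun q => Quotient.out_eq' q
    simp only [h2] at h1
    rw [h1, LinearMap.smul_apply, LinearMap.sum_apply]
    have h3 : ∀ p : IndPre φ X, MulAction.stabilizer Γ' p = ⊥ := fun p => by
      rw [eq_bot_iff]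
      intro k hk
      have hk' : k • p = p := hk
      have : p.1 * (φ k)⁻¹ = p.1 := congrArg (fun q : IndPre φ X => q.1) hk'
      rw [mul_eq_left, inv_eq_one, ← map_one φ] at this
      exact hφ this
    simp only [h3, Subgroup.card_bot, Nat.cast_one, one_div, liftStab_cls, stabilizer_mk]
    rw [← Finset.smul_sum]
    congr 1
    let E : IndPre φ X ≃ Γ × X := Equiv.refl (Γ × X)
    rw [← E.symm.sum_comp]
    exact Fintype.sum_prod_type (fun p : Γ × X =>
      w (conjSub p.1 ((MulAction.stabilizer Γ' p.2).map φ)))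

lemma liftStab_twist (φ : Γ' →* Γ) (w : Subgroup Γ' → V) (a : Burnside Γ) :
    liftStab w (twist φ a) = liftStab (fun S => w (S.comap φ)) a := by
  refine ext (f := liftStab w ∘ₗ twist φ) (fun X _ _ => ?_) a
  rw [LinearMap.comp_apply, twist_cls, liftStab_cls, liftStab_cls]
  rfl

end Burnside
end Burnside

/-! ### Marks and the Burnside Mackey functor -/

namespace Burnside

variable {G : Type} [Group G] {V : Type} [AddCommGroup V] [Module ℚ V]

/-- The stabilizer in `H ≤ G` of a point of an `H`-set, as a subgroup of `G`. -/
def stab (H : Subgroup G) {X : Type} [MulAction H X] (x : X) : Subgroup G :=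
  (MulAction.stabilizer H x).map H.subtype

lemma mem_stab {H : Subgroup G} {X : Type} [MulAction H X] {x : X} {g : G} :
    g ∈ stab H x ↔ ∃ h : g ∈ H, (⟨g, h⟩ : H) • x = x := by
  simp [stab]

lemma stab_le {H : Subgroup G} {X : Type} [MulAction H X] (x : X) : stab H x ≤ H :=
  Subgroup.map_subtype_le _

lemma stab_smul {H : Subgroup G} {X : Type} [MulAction H X] (h : H) (x : X) :
    stab H (h • x) = conjSub (h : G) (stab H x) := by
  ext g
  rw [mem_conjSub, mem_stab, mem_stab]
  have e : ∀ hg : g ∈ H, ((h : G)⁻¹ * g * h ∈ H) := fun hg =>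
    H.mul_mem (H.mul_mem (H.inv_mem h.2) hg) h.2
  constructor
  · rintro ⟨hg, h1⟩
    refine ⟨e hg, ?_⟩
    have : (⟨(h : G)⁻¹ * g * h, e hg⟩ : H) = h⁻¹ * ⟨g, hg⟩ * h := rfl
    rw [this, mul_smul, mul_smul, h1, inv_smul_smul]
  · rintro ⟨hg, h1⟩
    have hg' : g ∈ H := by
      have := H.mul_mem (H.mul_mem h.2 hg) (H.inv_mem h.2)
      convert this using 1; group
    refine ⟨hg', ?_⟩
    have : (⟨(h : G)⁻¹ * g * h, hg⟩ : H) = h⁻¹ * ⟨g, hg'⟩ * h := rfl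
    rw [this, mul_smul, mul_smul, inv_smul_eq_iff] at h1
    exact h1

/-- The linear map `[X] ↦ ∑ w(Stab x)` on `A_ℚ(H)`, for a function `w` of subgroups of `G`. -/
def sumStab (H : Subgroup G) (w : Subgroup G → V) : Burnside H →ₗ[ℚ] V :=
  liftStab (fun S => w (S.map H.subtype))

lemma sumStab_cls (H : Subgroup G) (w : Subgroup G → V) (X : Type) [MulAction H X] [Finite X] :
    sumStab H w (cls H X) = ∑ x : X, w (stab H x) := liftStab_cls _ X

lemma sumStab_congr {H : Subgroup G} {w w' : Subgroup G → V} (h : ∀ S ≤ H, w S = w' S)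
    (a : Burnside H) : sumStab H w a = sumStab H w' a := by
  have : (fun S : Subgroup H => w (S.map H.subtype)) = fun S => w' (S.map H.subtype) :=
    funext fun S => h _ (Subgroup.map_subtype_le S)
  unfold sumStab
  rw [this]

lemma map_sumStab {W : Type} [AddCommGroup W] [Module ℚ W] {H : Subgroup G} (f : V →ₗ[ℚ] W)
    (w : Subgroup G → V) (a : Burnside H) :
    f (sumStab H w a) = sumStab H (fun S => f (w S)) a :=
  ext (f := f ∘ₗ sumStab H w) (fun X _ _ => by
    rw [LinearMap.comp_apply, sumStab_cls, sumStab_cls, map_sum]) a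

lemma sumStab_sum {ι : Type} [Fintype ι] {H : Subgroup G} (w : ι → Subgroup G → V)
    (a : Burnside H) : sumStab H (fun S => ∑ i, w i S) a = ∑ i, sumStab H (w i) a := by
  have := ext (f := sumStab H (fun S => ∑ i, w i S)) (g := ∑ i, sumStab H (w i)) (fun X _ _ => by
    rw [LinearMap.sum_apply]
    simp only [sumStab_cls]
    rw [Finset.sum_comm]) a
  rw [this, LinearMap.sum_apply]

lemma sumStab_smul {H : Subgroup G} (c : ℚ) (w : Subgroup G → V) (a : Burnside H) :
    sumStab H (fun S => c • w S) a = c • sumStab H w a :=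
  ext (f := sumStab H (fun S => c • w S)) (g := c • sumStab H w) (fun X _ _ => by
    rw [LinearMap.smul_apply, sumStab_cls, sumStab_cls, Finset.smul_sum]) a

lemma sumStab_conj {H : Subgroup G} {h : G} (hh : h ∈ H) (w : Subgroup G → V) (a : Burnside H) :
    sumStab H (fun S => w (conjSub h S)) a = sumStab H w a := by
  refine ext (fun X _ _ => ?_) a
  rw [sumStab_cls, sumStab_cls]
  refine Eq.trans ?_ (Equiv.sum_comp (MulAction.toPerm (⟨h, hh⟩ : H)) (fun x => w (stab H x)))
  refine Finset.sum_congr rfl fun x _ => ?_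
  rw [MulAction.toPerm_apply, stab_smul]

lemma sumStab_twist (g : G) {S K : Subgroup G} (φ : S →* K) (hφ : ∀ s, (φ s : G) = g⁻¹ * s * g)
    (w : Subgroup G → V) (a : Burnside K) :
    sumStab S w (twist φ a) = sumStab K (fun T => w (S ⊓ conjSub g T)) a := by
  unfold sumStab
  rw [liftStab_twist]
  congr 2
  funext T
  congr 1
  ext s
  simp only [Subgroup.mem_map, Subgroup.mem_comap, Subgroup.coe_subtype, Subgroup.mem_inf,
    mem_conjSub, Subtype.exists, exists_and_right, exists_eq_right]
  constructor
  · rintro ⟨h1, h2⟩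
    exact ⟨h1, by rw [← hφ ⟨s, h1⟩]; exact (φ _).2, by
      convert h2 using 1; exact Subtype.ext (hφ ⟨s, h1⟩).symm⟩
  · rintro ⟨h1, h2, h3⟩
    exact ⟨h1, by convert h3 using 1; exact Subtype.ext (hφ ⟨s, h1⟩)⟩

lemma sumStab_induce [Finite G] {K H : Subgroup G} (h : K ≤ H) (w : Subgroup G → V) (a : Burnside K) :
    sumStab H w (induce (Subgroup.inclusion h) a) =
      (ord K)⁻¹ • ∑ x : H, sumStab K (fun S => w (conjSub (x : G) S)) a := by
  unfold sumStab
  rw [liftStab_induce _ (Subgroup.inclusion_injective h)]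
  unfold ord
  congr 1
  refine Finset.sum_congr rfl fun x _ => ?_
  congr 2
  funext S
  congr 1
  ext g
  simp only [Subgroup.mem_map, mem_conjSub, Subgroup.coe_subtype, Subtype.exists,
    exists_and_right, exists_eq_right]
  constructor
  · rintro ⟨hg, k, hk, h1, h2⟩
    have h3 : k = (x : G)⁻¹ * g * x := congrArg Subtype.val h2
    refine ⟨by rw [← h3]; exact hk, ?_⟩
    convert h1 using 1
    exact Subtype.ext (congrArg Subtype.val h2).symm
  · rintro ⟨hk, h1⟩
    have hg : g ∈ H := by
      have := H.mul_mem (H.mul_mem x.2 (h hk)) (H.inv_mem x.2)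
      convert this using 1; group
    exact ⟨hg, _, hk, h1, rfl⟩

open scoped Classical in
/-- The mark `[X] ↦ |X^P|` on `A_ℚ(H)`, for `P ≤ H`. -/
def mark {H : Subgroup G} (P : Subgroup G) : Burnside H →ₗ[ℚ] ℚ :=
  sumStab H (fun S => if P ≤ S then 1 else 0)

/-- Marks count fixed points. -/
lemma mark_cls {H P : Subgroup G} (hP : P ≤ H) (X : Type) [MulAction H X] [Finite X] :
    mark P (cls H X) = Nat.card {x : X // ∀ p : H, (p : G) ∈ P → p • x = x} := by
  classical
  rw [mark, sumStab_cls, Finset.sum_boole, Nat.card_eq_fintype_card, Fintype.card_subtype]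
  congr 2
  ext x
  simp only [Finset.mem_filter, Finset.mem_univ, true_and]
  constructor
  · intro h p hp
    exact (mem_stab.1 (h hp)).2
  · intro h p hp
    exact mem_stab.2 ⟨hP hp, h ⟨p, hP hp⟩ hp⟩

lemma mark_twist (g : G) {S K : Subgroup G} (φ : S →* K) (hφ : ∀ s, (φ s : G) = g⁻¹ * s * g)
    {P : Subgroup G} (hP : P ≤ S) (a : Burnside K) :
    mark P (twist φ a) = mark (conjSub g⁻¹ P) a := by
  rw [mark, sumStab_twist g φ hφ, mark]
  refine sumStab_congr (fun T _ => ?_) a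
  classical
  refine if_congr ?_ rfl rfl
  rw [le_inf_iff, le_conjSub_iff, and_iff_right hP]

lemma mark_zero {H P : Subgroup G} (hP : ¬ P ≤ H) (a : Burnside H) : mark P a = 0 := by
  have h : mark P a = sumStab H (fun _ => (0 : ℚ) • (0 : ℚ)) a :=
    sumStab_congr (fun S hS => by rw [if_neg (fun h => hP (h.trans hS)), zero_smul]) a
  rw [h, sumStab_smul, zero_smul]

lemma mark_induce [Finite G] {K H : Subgroup G} (h : K ≤ H) (P : Subgroup G) (a : Burnside K) :
    mark P (induce (Subgroup.inclusion h) a) =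
      (ord K)⁻¹ * ∑ x : H, mark (conjSub (x : G)⁻¹ P) a := by
  rw [mark, sumStab_induce, smul_eq_mul]
  congr 1
  refine Finset.sum_congr rfl fun x _ => sumStab_congr (fun T _ => ?_) a
  classical
  exact if_congr le_conjSub_iff rfl rfl

lemma mark_conj {H : Subgroup G} {h : G} (hh : h ∈ H) (P : Subgroup G) (a : Burnside H) :
    mark (conjSub h P) a = mark P a := by
  rw [mark, ← sumStab_conj hh, mark]
  refine sumStab_congr (fun T _ => ?_) a
  classical
  refine if_congr ?_ rfl rfl
  rw [le_conjSub_iff, ← conjSub_mul, inv_mul_cancel, conjSub_one]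

/-- `1 ∈ A_ℚ(H)`, the class of a point. -/
def one (H : Subgroup G) : Burnside H := cls H PUnit

lemma stab_punit {H : Subgroup G} (x : PUnit) : stab H x = H := by
  ext g
  rw [mem_stab]
  exact ⟨fun h => h.1, fun h => ⟨h, rfl⟩⟩

lemma sumStab_one {H : Subgroup G} (w : Subgroup G → V) : sumStab H w (one H) = w H := by
  have h := Fintype.sum_subsingleton (fun x : PUnit => w (stab H x)) PUnit.unit
  rw [stab_punit] at h
  rw [one, sumStab_cls, ← h]
  congr!

open scoped Classical in
lemma mark_one {H : Subgroup G} (P : Subgroup G) :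
    mark P (one H) = if P ≤ H then 1 else 0 := by
  rw [mark, sumStab_one]

variable [Finite G]

open scoped Classical in
/-- `[H/L] ∈ A_ℚ(H)` for `L ≤ H`. -/
def coset (H L : Subgroup G) : Burnside H :=
  if h : L ≤ H then induce (Subgroup.inclusion h) (one L) else 0

lemma cls_orbit {H : Subgroup G} {X : Type} [MulAction H X] [Finite X] (x : X) :
    cls H (MulAction.orbit H x) = coset H (stab H x) := by
  rw [coset, dif_pos (stab_le x), one, induce_cls, eq_comm]
  have key : ∀ k : stab H x, Subgroup.inclusion (stab_le x) k • x = x := fun k =>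
    (mem_stab.1 k.2).2
  let f : IndSet (Subgroup.inclusion (stab_le x)) PUnit → MulAction.orbit H x :=
    IndSet.lift _ (fun γ _ => ⟨γ • x, γ, rfl⟩) (fun γ _ k => by
      refine Subtype.ext ?_
      change (γ * (Subgroup.inclusion (stab_le x) k)⁻¹) • x = γ • x
      rw [mul_smul, inv_smul_eq_iff.2 (key k).symm])
  refine cls_congr (Equiv.ofBijective f ⟨?_, ?_⟩) (fun g => IndSet.ind _ fun γ u => ?_)
  · refine fun z z' => ?_
    revert z z'
    refine IndSet.ind _ fun γ u => IndSet.ind _ fun δ v h => ?_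
    have h1 : γ • x = δ • x := congrArg Subtype.val h
    have h2 : ((γ⁻¹ * δ : H) : G) ∈ stab H x :=
      mem_stab.2 ⟨(γ⁻¹ * δ : H).2, by
        change (γ⁻¹ * δ) • x = x
        rw [mul_smul, ← h1, inv_smul_smul]⟩
    refine (IndSet.mk_eq _ _ _ _ _).2 ⟨⟨_, h2⟩, ?_, rfl⟩
    have h3 : Subgroup.inclusion (stab_le x) ⟨_, h2⟩ = γ⁻¹ * δ := rfl
    rw [h3]; group
  · rintro ⟨_, γ, rfl⟩
    exact ⟨IndSet.mk _ γ PUnit.unit, rfl⟩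
  · exact Subtype.ext (mul_smul g γ x)

lemma exists_stab {L H : Subgroup G} (h : L ≤ H) :
    ∃ (X : Type) (_ : MulAction H X) (_ : Finite X) (x : X), stab H x = L := by
  refine ⟨IndSet (Subgroup.inclusion h) PUnit, inferInstance, inferInstance,
    IndSet.mk _ 1 PUnit.unit, ?_⟩
  unfold stab
  rw [stabilizer_mk, conjSub_one]
  ext g
  simp only [Subgroup.mem_map, Subgroup.coe_subtype]
  constructor
  · rintro ⟨_, ⟨k, _, rfl⟩, rfl⟩
    exact k.2
  · intro hg
    exact ⟨_, ⟨⟨g, hg⟩, rfl, rfl⟩, rfl⟩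

lemma coset_conj {H : Subgroup G} {h : G} (hh : h ∈ H) (L : Subgroup G) :
    coset H (conjSub h L) = coset H L := by
  by_cases hL : L ≤ H
  · obtain ⟨X, _, _, x, rfl⟩ := exists_stab hL
    rw [← stab_smul ⟨h, hh⟩ x, ← cls_orbit, ← cls_orbit]
    exact cls_congr (Equiv.setCongr (MulAction.orbit_smul _ _)) (fun g y => rfl)
  · have : ¬ conjSub h L ≤ H := fun h' => hL (by
      have := conjSub_le_of_mem h' (H.inv_mem hh)
      rwa [← conjSub_mul, inv_mul_cancel, conjSub_one] at this)
    rw [coset, coset, dif_neg this, dif_neg hL]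

/-- The classes `[H/L]` span `A_ℚ(H)`. -/
lemma mem_span_coset {H : Subgroup G} (a : Burnside H) :
    a ∈ Submodule.span ℚ {b | ∃ L ≤ H, b = coset H L} := by
  set W := Submodule.span ℚ {b | ∃ L ≤ H, b = coset H L}
  have key : ∀ (n : ℕ) (X : Type) [MulAction H X] [Finite X], Nat.card X = n →
      cls H X ∈ W := by
    intro n
    induction n using Nat.strong_induction_on with
    | _ n ih =>
      intro X _ _ hX
      rcases isEmpty_or_nonempty X with hE | ⟨⟨x⟩⟩
      · rw [cls_empty]; exact W.zero_mem
      · classical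
        let O : SubMulAction H X :=
          { carrier := (MulAction.orbit H x)ᶜ
            smul_mem' := fun g y hy h' => hy (by
              have := MulAction.mem_orbit_of_mem_orbit g⁻¹ h'
              rwa [inv_smul_smul] at this) }
        have e := cls_union (Γ := H) (X := X) (Y := MulAction.orbit H x) (Z := O)
          (Equiv.Set.sumCompl (MulAction.orbit H x)).symm (fun g y => ?_)
        · rw [e, cls_orbit]
          refine W.add_mem (Submodule.subset_span ⟨_, stab_le x, rfl⟩) (ih _ ?_ O rfl)
          rw [← hX]
          exact Finite.card_subtype_lt (p := fun y => y ∈ (MulAction.orbit H x)ᶜ) (x := x)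
            (fun h => h (MulAction.mem_orbit_self x))
        · rw [Equiv.symm_apply_eq]
          rcases h : (Equiv.Set.sumCompl (MulAction.orbit H x)).symm y with z | z
          · rw [Equiv.symm_apply_eq] at h
            rw [h]; rfl
          · rw [Equiv.symm_apply_eq] at h
            rw [h]; rfl
  have : W.mkQ a = (0 : Burnside H →ₗ[ℚ] Burnside H ⧸ W) a :=
    ext (f := W.mkQ) (g := 0) (fun X _ _ => by
      rw [LinearMap.zero_apply, Submodule.mkQ_apply, Submodule.Quotient.mk_eq_zero]
      exact key _ X rfl) a
  rwa [LinearMap.zero_apply, Submodule.mkQ_apply, Submodule.Quotient.mk_eq_zero] at this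

end Burnside

namespace Burnside

variable {G : Type} [Group G] [Finite G]

lemma le_iff_eq_of_card {P L : Subgroup G} (h : Nat.card L ≤ Nat.card P) : P ≤ L ↔ L = P :=
  ⟨fun h' => (Subgroup.eq_of_le_of_card_ge h' h).symm, fun h' => h'.ge⟩

lemma card_conjSub (g : G) (P : Subgroup G) : Nat.card (conjSub g P) = Nat.card P :=
  Nat.card_congr (Subgroup.equivSMul (MulAut.conj g) P).toEquiv.symm

lemma mark_coset {H L : Subgroup G} (hL : L ≤ H) (P : Subgroup G) :
    mark P (coset H L) = (ord L)⁻¹ * ∑ x : H, mark (conjSub (x : G)⁻¹ P) (one L) := by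
  rw [coset, dif_pos hL, mark_induce]

/-- Surjectivity of the marks. -/
lemma mark_surj (H : Subgroup G) (f : Subgroup G → ℚ)
    (hf : ∀ h ∈ H, ∀ P, f (conjSub h P) = f P) :
    ∃ a : Burnside H, ∀ P ≤ H, mark P a = f P := by
  have _i : DecidableEq (Subgroup G) := Classical.decEq _
  have key : ∀ n (f : Subgroup G → ℚ), (∀ h ∈ H, ∀ P, f (conjSub h P) = f P) →
      (∀ P ≤ H, n < Nat.card P → f P = 0) → ∃ a : Burnside H, ∀ P ≤ H, mark P a = f P := by
    intro n
    induction n with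
    | zero => exact fun f _ h => ⟨0, fun P hP => by rw [map_zero, h P hP Nat.card_pos]⟩
    | succ n ih =>
      intro f hf hn
      let b : Burnside H := ∑ L : {L : Subgroup G // L ≤ H ∧ Nat.card L = n + 1},
        (f L * ord L.1 / ord H) • coset H L.1
      have hb : ∀ P : Subgroup G, n + 1 ≤ Nat.card P → P ≤ H → mark P b = f P := by
        intro P hP hPH
        have h1 : mark P b = ∑ L : {L : Subgroup G // L ≤ H ∧ Nat.card L = n + 1},
            (ord H)⁻¹ * ∑ x : H, if L.1 = conjSub (x : G)⁻¹ P then f P else 0 := by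
          rw [map_sum]
          refine Finset.sum_congr rfl fun L _ => ?_
          have h0 := ord_ne_zero L.1
          rw [map_smul, mark_coset L.2.1, smul_eq_mul, ← mul_assoc,
            show f L * ord L.1 / ord H * (ord L.1)⁻¹ = (ord H)⁻¹ * f L by field_simp, mul_assoc,
            Finset.mul_sum]
          congr 1
          refine Finset.sum_congr rfl fun x _ => ?_
          have h2 : conjSub (x : G)⁻¹ P ≤ L.1 ↔ L.1 = conjSub (x : G)⁻¹ P :=
            le_iff_eq_of_card (by rw [card_conjSub, L.2.2]; exact hP)
          rw [mark_one]
          by_cases h3 : L.1 = conjSub (x : G)⁻¹ P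
          · rw [if_pos (h2.2 h3), if_pos h3, mul_one, h3, hf _ (H.inv_mem x.2)]
          · rw [if_neg (fun h => h3 (h2.1 h)), if_neg h3, mul_zero]
        rw [h1, ← Finset.mul_sum, Finset.sum_comm]
        rcases hP.lt_or_eq with h4 | h4
        · rw [hn P hPH h4]; simp
        · have h5 : ∀ x : H, (∑ L : {L : Subgroup G // L ≤ H ∧ Nat.card L = n + 1},
              if L.1 = conjSub (x : G)⁻¹ P then f P else 0) = f P := by
            intro x
            let L₀ : {L : Subgroup G // L ≤ H ∧ Nat.card L = n + 1} :=
              ⟨conjSub (x : G)⁻¹ P, conjSub_le_of_mem hPH (H.inv_mem x.2),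
                by rw [card_conjSub, ← h4]⟩
            rw [Finset.sum_eq_single L₀]
            · rw [if_pos rfl]
            · intro L _ hL
              rw [if_neg (fun h => hL (Subtype.ext h))]
            · intro h; exact absurd (Finset.mem_univ _) h
          rw [Finset.sum_congr rfl fun x _ => h5 x, Finset.sum_const, Finset.card_univ,
            ← Nat.card_eq_fintype_card, ← Nat.cast_smul_eq_nsmul ℚ, smul_eq_mul, ← mul_assoc]
          change (ord H)⁻¹ * ord H * _ = _
          rw [inv_mul_cancel₀ (ord_ne_zero H), one_mul]
      obtain ⟨a, ha⟩ := ih (fun P => f P - mark P b)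
        (fun h hh P => by rw [hf h hh, mark_conj hh]) (fun P hP hc => by
          rw [hb P hc hP, sub_self])
      exact ⟨a + b, fun P hP => by rw [map_add, ha P hP]; ring⟩
  exact key (Nat.card G) f hf fun P _ hP =>
    absurd hP (not_lt.2 (Nat.card_le_card_of_injective _ P.subtype_injective))

/-- The conjugation invariant functions on the set of subgroups of `H`. -/
def invFun (H : Subgroup G) : Submodule ℚ (Subgroup G → ℚ) where
  carrier := {f | (∀ h ∈ H, ∀ P, f (conjSub h P) = f P) ∧ ∀ P, ¬ P ≤ H → f P = 0}
  add_mem' := fun ha hb => ⟨fun h hh P => by simp [ha.1 h hh, hb.1 h hh],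
    fun P hP => by simp [ha.2 P hP, hb.2 P hP]⟩
  zero_mem' := ⟨fun _ _ _ => rfl, fun _ _ => rfl⟩
  smul_mem' := fun c f hf => ⟨fun h hh P => by simp [hf.1 h hh], fun P hP => by simp [hf.2 P hP]⟩

/-- All marks at once. -/
def marks (H : Subgroup G) : Burnside H →ₗ[ℚ] invFun H where
  toFun a := ⟨fun P => mark P a, fun _ hh P => mark_conj hh P a, fun _ hP => mark_zero hP a⟩
  map_add' a b := by ext P; simp
  map_smul' c a := by ext P; simp

lemma marks_surjective (H : Subgroup G) : Function.Surjective (marks H) := fun f => by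
  obtain ⟨a, ha⟩ := mark_surj H f.1 f.2.1
  refine ⟨a, Subtype.ext (funext fun P => ?_)⟩
  by_cases hP : P ≤ H
  · exact ha P hP
  · rw [f.2.2 P hP]; exact mark_zero hP a

/-- `f ↦ ∑ f(L) [H/L]`. -/
def combine (H : Subgroup G) : invFun H →ₗ[ℚ] Burnside H where
  toFun f := ∑ L : Subgroup G, f.1 L • coset H L
  map_add' f g := by simp [add_smul, Finset.sum_add_distrib]
  map_smul' c f := by simp [mul_smul, Finset.smul_sum]

lemma combine_surjective (H : Subgroup G) : Function.Surjective (combine H) := by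
  classical
  intro a
  change a ∈ LinearMap.range (combine H)
  refine (Submodule.span_le.2 ?_) (mem_span_coset a)
  rintro _ ⟨L, hL, rfl⟩
  let c : Subgroup G → Prop := fun K => ∃ h ∈ H, K = conjSub h L
  have hc : ∀ h ∈ H, ∀ P, c (conjSub h P) ↔ c P := fun h hh P => by
    constructor
    · rintro ⟨k, hk, e⟩
      refine ⟨h⁻¹ * k, H.mul_mem (H.inv_mem hh) hk, ?_⟩
      rw [conjSub_mul, ← e, ← conjSub_mul, inv_mul_cancel, conjSub_one]
    · rintro ⟨k, hk, rfl⟩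
      exact ⟨h * k, H.mul_mem hh hk, (conjSub_mul _ _ _).symm⟩
  let f : invFun H := ⟨fun K => if c K then 1 else 0, fun h hh P => if_congr (hc h hh P) rfl rfl,
    fun P hP => if_neg (by
      rintro ⟨h, hh, rfl⟩
      exact hP (conjSub_le_of_mem hL hh))⟩
  have h1 : combine H f = ((Finset.univ.filter c).card : ℚ) • coset H L := by
    change ∑ K : Subgroup G, (if c K then (1 : ℚ) else 0) • coset H K = _
    rw [Nat.cast_smul_eq_nsmul, ← Finset.sum_const, Finset.sum_filter]
    refine Finset.sum_congr rfl fun K _ => ?_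
    split_ifs with h
    · obtain ⟨k, hk, rfl⟩ := h
      rw [coset_conj hk, one_smul]
    · rw [zero_smul]
  have h2 : ((Finset.univ.filter c).card : ℚ) ≠ 0 := by
    rw [Nat.cast_ne_zero, ← Nat.pos_iff_ne_zero, Finset.card_pos]
    exact ⟨L, Finset.mem_filter.2 ⟨Finset.mem_univ _, 1, H.one_mem, (conjSub_one L).symm⟩⟩
  refine ⟨((Finset.univ.filter c).card : ℚ)⁻¹ • f, ?_⟩
  rw [map_smul, h1, smul_smul, inv_mul_cancel₀ h2, one_smul]

/-- Injectivity of the marks. -/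
lemma mark_inj {H : Subgroup G} {a b : Burnside H} (h : ∀ P ≤ H, mark P a = mark P b) :
    a = b := by
  have h1 : Function.Injective (marks H ∘ₗ combine H) :=
    LinearMap.injective_iff_surjective.2
      ((marks_surjective H).comp (combine_surjective H))
  obtain ⟨f, rfl⟩ := combine_surjective H a
  obtain ⟨g, rfl⟩ := combine_surjective H b
  congr 1
  refine h1 (Subtype.ext (funext fun P => ?_))
  by_cases hP : P ≤ H
  · exact h P hP
  · exact (mark_zero hP _).trans (mark_zero hP _).symm

/-- `s ↦ g⁻¹ s g`. -/
def conjHom (g : G) {H K : Subgroup G} (e : K = conjSub g H) : K →* H where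
  toFun k := ⟨g⁻¹ * k * g, mem_conjSub.1 (e ▸ k.2)⟩
  map_one' := by ext; simp
  map_mul' a b := by ext; simp [mul_assoc]

lemma mark_conjHom (g : G) {H K : Subgroup G} (e : K = conjSub g H) {P : Subgroup G} (hP : P ≤ K)
    (a : Burnside H) : mark P (twist (conjHom g e) a) = mark (conjSub g⁻¹ P) a :=
  mark_twist g _ (fun _ => rfl) hP a

lemma mark_res {H K : Subgroup G} (h : K ≤ H) {P : Subgroup G} (hP : P ≤ K) (a : Burnside H) :
    mark P (twist (Subgroup.inclusion h) a) = mark P a := by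
  rw [mark_twist 1 _ (fun s => by simp) hP, inv_one, conjSub_one]

end Burnside

namespace Mackey

open Burnside

variable {G : Type} [Group G] [Finite G]

/-- The Burnside ring Mackey functor `A_ℚ(G/H) = A_ℚ(H)`, with restriction, induction and
conjugation of sets with group actions. -/
def preBurnside (G : Type) [Group G] [Finite G] : PreMackey G where
  obj H := Burnside H
  res h := twist (Subgroup.inclusion h)
  ind h := induce (Subgroup.inclusion h)
  conj g _ _ e := twist (conjHom g e)
  res_self x := mark_inj fun P hP => by rw [mark_res _ hP]
  ind_self {H} x := mark_inj fun P hP => by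
    rw [mark_induce, Finset.sum_congr rfl fun (y : H) _ => mark_conj (H.inv_mem y.2) P x,
      Finset.sum_const, Finset.card_univ, ← Nat.card_eq_fintype_card, ← Nat.cast_smul_eq_nsmul ℚ,
      smul_eq_mul, ← mul_assoc]
    change (ord H)⁻¹ * ord H * _ = _
    rw [inv_mul_cancel₀ (ord_ne_zero H), one_mul]
  conj_self {H h} hh e x := mark_inj fun P hP => by
    rw [mark_conjHom _ _ hP, mark_conj (H.inv_mem hh)]
  ind_ind {L K H} h₁ h₂ x := mark_inj fun P hP => by
    rw [mark_induce, mark_induce]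
    have : ∀ y : H, mark (conjSub (y : G)⁻¹ P) (induce (Subgroup.inclusion h₁) x) =
        ∑ k : K, (ord L)⁻¹ • mark (conjSub (y * k : G)⁻¹ P) x := fun y => by
      rw [mark_induce, Finset.mul_sum]
      simp only [mul_inv_rev, conjSub_mul, smul_eq_mul]
    rw [Finset.sum_congr rfl fun y _ => this y,
      sum_mul_right h₂ (fun y => (ord L)⁻¹ • mark (conjSub y⁻¹ P) x), smul_eq_mul, ← mul_assoc,
      inv_mul_cancel₀ (ord_ne_zero K), one_mul, Finset.mul_sum]
    rfl
  res_res h₁ h₂ x := mark_inj fun P hP => by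
    rw [mark_res _ hP, mark_res _ (hP.trans h₁), mark_res _ hP]
  conj_conj g h H K L e₁ e₂ e₃ x := mark_inj fun P hP => by
    have : conjSub g⁻¹ P ≤ K := by
      rw [← le_conjSub_iff, ← e₂]; exact hP
    rw [mark_conjHom _ _ hP, mark_conjHom _ _ this, mark_conjHom _ _ hP, mul_inv_rev, conjSub_mul]
  conj_res g K H K' H' eK eH h h' x := mark_inj fun P hP => by
    have : conjSub g⁻¹ P ≤ K := by
      rw [← le_conjSub_iff, ← eK]; exact hP
    rw [mark_res _ hP, mark_conjHom _ _ (hP.trans h'), mark_conjHom _ _ hP, mark_res _ this]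
  conj_ind g K H K' H' eK eH h h' x := mark_inj fun P hP => by
    subst eK eH
    rw [mark_induce, mark_conjHom _ _ hP, mark_induce, ord_conjSub]
    congr 1
    let e : H ≃ conjSub g H := (Subgroup.equivSMul (MulAut.conj g) H).toEquiv
    have he : ∀ m : H, ((e m : conjSub g H) : G) = g * m * g⁻¹ := fun m => rfl
    rw [← e.sum_comp]
    refine Finset.sum_congr rfl fun m _ => ?_
    have e1 : conjSub g⁻¹ (conjSub ((e m : conjSub g H) : G)⁻¹ P) =
        conjSub (m : G)⁻¹ (conjSub g⁻¹ P) := by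
      rw [← conjSub_mul, ← conjSub_mul, he]; congr 1; group
    by_cases h1 : conjSub ((e m : conjSub g H) : G)⁻¹ P ≤ conjSub g K
    · rw [mark_conjHom _ _ h1, e1]
    · rw [mark_zero h1, mark_zero]
      rwa [← e1, ← le_conjSub_iff]

/-- The Burnside ring Mackey functor. -/
def burnside (G : Type) [Group G] [Finite G] : Mackey G where
  toPreMackey := preBurnside G
  mackey := by
    rw [PreMackey.mackeyAxiom_iff]
    intro K L H hK hL (y : Burnside L)
    refine mark_inj (H := K) fun P hP => ?_
    have h1 : ∀ x : H, mark P ((preBurnside G).dc K (x : G) y : Burnside K) =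
        (ord (K ⊓ conjSub (x : G) L))⁻¹ • ∑ k : K, mark (conjSub (k * x : G)⁻¹ P) y := by
      intro x
      have : mark P ((preBurnside G).dc K (x : G) y : Burnside K) =
          (ord (K ⊓ conjSub (x : G) L))⁻¹ * ∑ k : K, mark (conjSub (k : G)⁻¹ P)
            ((preBurnside G).tr (x : G) inf_le_right y : Burnside ↥(K ⊓ conjSub (x : G) L)) :=
        mark_induce _ _ _
      rw [this, smul_eq_mul]
      congr 1
      refine Finset.sum_congr rfl fun k _ => ?_
      have e1 : conjSub (k * x : G)⁻¹ P = conjSub (x : G)⁻¹ (conjSub (k : G)⁻¹ P) := by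
        rw [mul_inv_rev, conjSub_mul]
      rw [e1]
      by_cases h2 : conjSub (k : G)⁻¹ P ≤ K ⊓ conjSub (x : G) L
      · exact (mark_res inf_le_right h2 _).trans (mark_conjHom _ _ (h2.trans inf_le_right) _)
      · exact (mark_zero h2 _).trans (mark_zero (fun h3 =>
          h2 (le_inf (conjSub_le_of_mem hP (K.inv_mem k.2)) (le_conjSub_iff.2 h3))) _).symm
    have h4 : mark P (twist (Subgroup.inclusion hK) (induce (Subgroup.inclusion hL) y)) =
        mark P (∑ x : H, (ord (K ⊓ conjSub (x : G) L) / (ord K * ord L)) •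
          ((preBurnside G).dc K (x : G) y : Burnside K)) := by
      rw [mark_res hK hP, mark_induce]
      refine Eq.trans ?_ (map_sum (mark P : Burnside K →ₗ[ℚ] ℚ) _ _).symm
      have h5 : ∀ x : H, mark P ((ord (K ⊓ conjSub (x : G) L) / (ord K * ord L)) •
          ((preBurnside G).dc K (x : G) y : Burnside K)) =
          ∑ k : K, ((ord K)⁻¹ * (ord L)⁻¹) • mark (conjSub (k * x : G)⁻¹ P) y := by
        intro x
        refine (map_smul (mark P : Burnside K →ₗ[ℚ] ℚ) _ _).trans ?_
        rw [← Finset.smul_sum, h1, smul_smul]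
        congr 1
        have := ord_ne_zero (K ⊓ conjSub (x : G) L)
        field_simp
      rw [Finset.sum_congr rfl fun x _ => h5 x, Finset.sum_comm,
        sum_mul_left hK (fun x => ((ord K)⁻¹ * (ord L)⁻¹) • mark (conjSub x⁻¹ P) y),
        ← Finset.smul_sum, smul_smul, ← mul_assoc, mul_inv_cancel₀ (ord_ne_zero K), one_mul]
      rfl
    exact h4

open scoped Classical in
/-- There is exactly one element of `A_ℚ(G)` whose mark at `K` is `1` if `K` is conjugate to `H`
and `0` otherwise. -/
lemma existsUnique_idem (H : Subgroup G) : ∃! e : Burnside (⊤ : Subgroup G),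
    ∀ K : Subgroup G, mark K e = if ∃ g : G, K = conjSub g H then 1 else 0 := by
  obtain ⟨e, he⟩ := mark_surj (⊤ : Subgroup G)
    (fun K => if ∃ g : G, K = conjSub g H then 1 else 0) (fun h _ P => by
      refine if_congr ⟨?_, ?_⟩ rfl rfl
      · rintro ⟨g, hg⟩
        exact ⟨h⁻¹ * g, by rw [conjSub_mul, ← hg, ← conjSub_mul, inv_mul_cancel, conjSub_one]⟩
      · rintro ⟨g, rfl⟩
        exact ⟨h * g, (conjSub_mul _ _ _).symm⟩)
  exact ⟨e, fun K => he K le_top, fun e' h' => mark_inj fun P _ => by rw [h', he P le_top]⟩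

/-- The idempotent `e_H ∈ A_ℚ(G)`: the element whose marks are given by the characteristic
function of the conjugacy class of `H`. -/
def idem (H : Subgroup G) : (burnside G).obj ⊤ := (existsUnique_idem H).choose

open scoped Classical in
lemma mark_idem (H K : Subgroup G) :
    mark K (idem H : Burnside (⊤ : Subgroup G)) = if ∃ g : G, K = conjSub g H then 1 else 0 :=
  (existsUnique_idem H).choose_spec.1 K

end Mackey

/-! ### The action of Burnside rings on Mackey functors -/

namespace Mackey

open Burnside

variable {G : Type} [Group G] [Finite G]

open scoped Classical in
/-- `m ↦ I_T^H R^H_T m`, extended by zero to those `T` that are not contained in `H`. -/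
def indRes (M : Mackey G) (H T : Subgroup G) : M.obj H →ₗ[ℚ] M.obj H :=
  if h : T ≤ H then M.ind h ∘ₗ M.res h else 0

lemma indRes_of_le (M : Mackey G) {H T : Subgroup G} (h : T ≤ H) (m : M.obj H) :
    M.indRes H T m = M.ind h (M.res h m) := by
  rw [indRes, dif_pos h]; rfl

/-- The action of `A_ℚ(H)` on `M(G/H)`, where `[H/L]` acts by `I_L^H R^H_L`. Since
`I_T^H R^H_T` depends only on the conjugacy class of `T ≤ H`, this means that a finite
`H`-set `X` acts by `∑ x ∈ X, (|T| / |H|) I_T^H R^H_T` with `T` the stabilizer of `x`. -/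
def act (M : Mackey G) (H : Subgroup G) : Burnside H →ₗ[ℚ] M.obj H →ₗ[ℚ] M.obj H :=
  sumStab H (fun T => (ord T / ord H) • M.indRes H T)

variable (M : Mackey G)

lemma act_eq {H : Subgroup G} (a : Burnside H) (m : M.obj H) :
    M.act H a m = sumStab H (fun T => (ord T / ord H) • M.indRes H T m) a :=
  map_sumStab (LinearMap.applyₗ m) (fun T => (ord T / ord H) • M.indRes H T) a

lemma act_one {H : Subgroup G} (m : M.obj H) : M.act H (one H) m = m := by
  rw [act_eq, sumStab_one, indRes_of_le _ le_rfl, M.res_self, M.ind_self,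
    div_self (ord_ne_zero H), one_smul]

lemma indRes_conj {H T : Subgroup G} {h : G} (hh : h ∈ H) (hT : T ≤ H) (m : M.obj H) :
    M.indRes H (conjSub h T) m = M.indRes H T m := by
  have e := (conjSub_of_mem hh).symm
  have h' : conjSub h T ≤ H := conjSub_le_of_mem hT hh
  rw [indRes_of_le _ hT, indRes_of_le _ h', ← M.conj_self hh e (M.ind hT _),
    ← M.conj_ind h rfl e hT h', ← M.conj_res h rfl e hT h', M.conj_self hh]

/-- The class `[H/L]` acts by `I_L^H R^H_L`. -/
lemma act_coset {H L : Subgroup G} (hL : L ≤ H) (m : M.obj H) :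
    M.act H (coset H L) m = M.ind hL (M.res hL m) := by
  rw [coset, dif_pos hL, act_eq, sumStab_induce]
  have : ∀ x : H, sumStab L (fun S => (ord (conjSub (x : G) S) / ord H) •
      M.indRes H (conjSub (x : G) S) m) (one L) = (ord L / ord H) • M.ind hL (M.res hL m) := by
    intro x
    rw [sumStab_one, ord_conjSub, M.indRes_conj x.2 hL, indRes_of_le _ hL]
  rw [Finset.sum_congr rfl fun x _ => this x, Finset.sum_const, Finset.card_univ,
    ← Nat.card_eq_fintype_card, ← Nat.cast_smul_eq_nsmul ℚ, smul_smul, smul_smul]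
  change ((ord L)⁻¹ * ord H * (ord L / ord H)) • M.ind hL (M.res hL m) = _
  have h1 := ord_ne_zero H
  have h2 := ord_ne_zero L
  rw [show (ord L)⁻¹ * ord H * (ord L / ord H) = 1 by field_simp, one_smul]

lemma sum_sumStab_conj {V : Type} [AddCommGroup V] [Module ℚ V] {H : Subgroup G}
    (w : Subgroup G → V) (a : Burnside H) :
    sumStab H (fun T => ∑ x : H, w (conjSub (x : G) T)) a = ord H • sumStab H w a := by
  rw [sumStab_sum, Finset.sum_congr rfl fun (x : H) _ => sumStab_conj x.2 w a, Finset.sum_const,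
    Finset.card_univ, ← Nat.card_eq_fintype_card, ← Nat.cast_smul_eq_nsmul ℚ]
  rfl

lemma sum_sumStab_conj_inv {V : Type} [AddCommGroup V] [Module ℚ V] {H : Subgroup G}
    (w : Subgroup G → V) (a : Burnside H) :
    sumStab H (fun T => ∑ x : H, w (conjSub (x : G)⁻¹ T)) a = ord H • sumStab H w a := by
  rw [← sum_sumStab_conj]
  refine sumStab_congr (fun T _ => ?_) a
  exact sum_inv_subgroup (fun x => w (conjSub x T))

lemma res_act {K H : Subgroup G} (hK : K ≤ H) (a : Burnside H) (m : M.obj H) :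
    M.res hK (M.act H a m) = M.act K (twist (Subgroup.inclusion hK) a) (M.res hK m) := by
  rw [act_eq, act_eq, map_sumStab, sumStab_twist 1 _ (fun s => by simp)]
  have h0 := ord_ne_zero H
  have h0' := ord_ne_zero K
  have key : ∀ T ≤ H, M.res hK ((ord T / ord H) • M.indRes H T m) =
      ∑ x : H, (ord (K ⊓ conjSub (x : G) T) / (ord H * ord K)) •
        M.indRes K (K ⊓ conjSub (x : G) T) (M.res hK m) := by
    intro T hT
    rw [indRes_of_le _ hT, map_smul, M.res_ind, Finset.smul_sum]
    refine Finset.sum_congr rfl fun x _ => ?_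
    have h2 := ord_ne_zero T
    rw [smul_smul, indRes_of_le _ inf_le_left, PreMackey.dc,
      M.tr_res _ _ hT (inf_le_right.trans (conjSub_mono _ hT)), M.res_res,
      M.tr_mem x.2 (inf_le_left.trans hK)]
    congr 1
    field_simp
  rw [sumStab_congr key, sum_sumStab_conj (fun T => (ord (K ⊓ T) / (ord H * ord K)) •
        M.indRes K (K ⊓ T) (M.res hK m)), ← sumStab_smul]
  refine sumStab_congr (fun T _ => ?_) a
  rw [smul_smul, conjSub_one]
  congr 1
  field_simp

lemma conj_act (g : G) {K H : Subgroup G} (e : K = conjSub g H) (a : Burnside H) (m : M.obj H) :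
    M.conj g e (M.act H a m) = M.act K (twist (conjHom g e) a) (M.conj g e m) := by
  rw [act_eq, act_eq, map_sumStab, sumStab_twist g _ (fun s => rfl)]
  refine sumStab_congr (fun T hT => ?_) a
  have h1 : K ⊓ conjSub g T = conjSub g T := inf_eq_right.2 (e ▸ conjSub_mono g hT)
  have h2 : conjSub g T ≤ K := e ▸ conjSub_mono g hT
  have h3 : ord K = ord H := by rw [e, ord_conjSub]
  rw [h1, ord_conjSub, map_smul, indRes_of_le _ hT, indRes_of_le _ h2, M.conj_res g rfl e hT,
    M.conj_ind g rfl e hT, h3]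

lemma act_ind {K H : Subgroup G} (hK : K ≤ H) (a : Burnside H) (y : M.obj K) :
    M.act H a (M.ind hK y) = M.ind hK (M.act K (twist (Subgroup.inclusion hK) a) y) := by
  rw [act_eq, act_eq, map_sumStab, sumStab_twist 1 _ (fun s => by simp)]
  have h0 := ord_ne_zero H
  have h0' := ord_ne_zero K
  have key : ∀ T ≤ H, (ord T / ord H) • M.indRes H T (M.ind hK y) =
      ∑ x : H, (ord (K ⊓ conjSub (x : G)⁻¹ T) / (ord H * ord K)) •
        M.ind hK (M.indRes K (K ⊓ conjSub (x : G)⁻¹ T) y) := by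
    intro T hT
    rw [indRes_of_le _ hT, M.res_ind, map_sum, Finset.smul_sum]
    refine Finset.sum_congr rfl fun x _ => ?_
    have h2 := ord_ne_zero T
    have e0 : T ⊓ conjSub (x : G) K = conjSub (x : G) (K ⊓ conjSub (x : G)⁻¹ T) := by
      rw [conjSub_inf, ← conjSub_mul, mul_inv_cancel, conjSub_one, inf_comm]
    have e := (conjSub_of_mem x.2).symm
    have h3 : K ⊓ conjSub (x : G)⁻¹ T ≤ H := inf_le_left.trans hK
    have h4 : T ⊓ conjSub (x : G) K ≤ H := inf_le_left.trans hT
    have e1 : ord (T ⊓ conjSub (x : G) K) = ord (K ⊓ conjSub (x : G)⁻¹ T) := by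
      rw [e0, ord_conjSub]
    rw [map_smul, smul_smul, indRes_of_le _ inf_le_left, M.ind_ind,
      ← M.conj_self x.2 e (M.ind (inf_le_left.trans hK) _),
      ← M.conj_ind (x : G) e0 e h3 h4, M.conj_eq_tr,
      M.tr_res _ _ inf_le_left inf_le_right, PreMackey.dc, M.ind_ind, e1]
    congr 1
    field_simp
  rw [sumStab_congr key, sum_sumStab_conj_inv (fun T => (ord (K ⊓ T) / (ord H * ord K)) •
        M.ind hK (M.indRes K (K ⊓ T) y)), ← sumStab_smul]
  refine sumStab_congr (fun T _ => ?_) a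
  rw [smul_smul, conjSub_one, map_smul]
  congr 1
  field_simp

lemma ind_act {K H : Subgroup G} (hK : K ≤ H) (b : Burnside K) (m : M.obj H) :
    M.act H (induce (Subgroup.inclusion hK) b) m = M.ind hK (M.act K b (M.res hK m)) := by
  rw [act_eq, act_eq, map_sumStab, sumStab_induce]
  have h0 := ord_ne_zero H
  have h0' := ord_ne_zero K
  have key : ∀ x : H, sumStab K (fun S => (ord (conjSub (x : G) S) / ord H) •
      M.indRes H (conjSub (x : G) S) m) b = sumStab K (fun S => (ord S / ord H) •
        M.indRes H S m) b := fun x => sumStab_congr (fun S hS => by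
    rw [ord_conjSub, M.indRes_conj x.2 (hS.trans hK)]) b
  rw [Finset.sum_congr rfl fun x _ => key x, Finset.sum_const, Finset.card_univ,
    ← Nat.card_eq_fintype_card, ← Nat.cast_smul_eq_nsmul ℚ, smul_smul, ← sumStab_smul]
  refine sumStab_congr (fun S hS => ?_) b
  rw [smul_smul, map_smul, indRes_of_le _ hS, indRes_of_le _ (hS.trans hK), M.ind_ind, M.res_res]
  congr 1
  change (ord K)⁻¹ * ord H * _ = _
  field_simp

/-- The action as a pairing. -/
def actPairing : Pairing (burnside G) M M where
  φ := M.act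
  res h a m := (M.res_act h a m).symm
  conj g _ _ e a m := (M.conj_act g e a m).symm
  ind_right h a y := M.act_ind h a y
  ind_left h b m := M.ind_act h b m

lemma act_app {M N : Mackey G} (f : M ⟶ N) {H : Subgroup G} (a : Burnside H) (m : M.obj H) :
    f.app H (M.act H a m) = N.act H a (f.app H m) := by
  rw [act_eq, act_eq, map_sumStab]
  refine sumStab_congr (fun T hT => ?_) a
  rw [map_smul, indRes_of_le _ hT, indRes_of_le _ hT, f.app_ind, f.app_res]

lemma Pairing.act_left {M N Q : Mackey G} (p : Pairing M N Q) {H : Subgroup G} (a : Burnside H)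
    (x : M.obj H) (y : N.obj H) : p.φ H (M.act H a x) y = Q.act H a (p.φ H x y) := by
  have := map_sumStab ((p.φ H).flip y) (fun T => (ord T / ord H) • M.indRes H T x) a
  rw [act_eq, act_eq]
  refine this.trans (sumStab_congr (fun T hT => ?_) a)
  rw [map_smul, indRes_of_le _ hT, indRes_of_le _ hT, LinearMap.flip_apply, p.ind_left, p.res]

lemma Pairing.act_right {M N Q : Mackey G} (p : Pairing M N Q) {H : Subgroup G} (a : Burnside H)
    (x : M.obj H) (y : N.obj H) : p.φ H x (N.act H a y) = Q.act H a (p.φ H x y) := by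
  have := map_sumStab (p.φ H x) (fun T => (ord T / ord H) • N.indRes H T y) a
  rw [act_eq, act_eq]
  refine this.trans (sumStab_congr (fun T hT => ?_) a)
  rw [map_smul, indRes_of_le _ hT, indRes_of_le _ hT, p.ind_right, p.res]

lemma act_tmul_left {M N : Mackey G} {H : Subgroup G} (a : Burnside H) (x : M.obj H)
    (y : N.obj H) : tmul (M.act H a x) y = (box M N).act H a (tmul x y) :=
  (boxPairing M N).act_left a x y

lemma act_tmul_right {M N : Mackey G} {H : Subgroup G} (a : Burnside H) (x : M.obj H)
    (y : N.obj H) : tmul x (N.act H a y) = (box M N).act H a (tmul x y) :=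
  (boxPairing M N).act_right a x y

/-- The product of `A_ℚ(H)`. -/
def bmul {H : Subgroup G} (a b : Burnside H) : Burnside H := (burnside G).act H a b

lemma act_bmul {H : Subgroup G} (a b : Burnside H) (m : M.obj H) :
    M.act H (bmul a b) m = M.act H a (M.act H b m) :=
  M.actPairing.act_left a b m

/-- Marks are multiplicative. -/
lemma mark_bmul {H : Subgroup G} (P : Subgroup G) (a b : Burnside H) :
    mark P (bmul a b) = mark P a * mark P b := by
  have _i : DecidableEq (Subgroup G) := Classical.decEq _
  refine (congrArg (mark P) ((burnside G).act_eq a b)).trans ?_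
  refine (map_sumStab (mark P : Burnside H →ₗ[ℚ] ℚ) _ a).trans ?_
  have h0 := ord_ne_zero H
  classical
  have key : ∀ T ≤ H, mark P ((ord T / ord H) • ((burnside G).indRes H T b : Burnside H)) =
      ∑ x : H, (ord H)⁻¹ • mark P b • (if P ≤ conjSub (x : G) T then (1 : ℚ) else 0) := by
    intro T hT
    have h2 := ord_ne_zero T
    refine (map_smul (mark P : Burnside H →ₗ[ℚ] ℚ) _ _).trans ?_
    have h3 : mark P ((burnside G).indRes H T b : Burnside H) = _ :=
      (congrArg (mark P) ((burnside G).indRes_of_le hT b)).trans (mark_induce hT P _)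
    rw [h3, smul_eq_mul, ← mul_assoc, Finset.mul_sum]
    have h4 : ord T / ord H * (ord T)⁻¹ = (ord H)⁻¹ := by field_simp
    rw [h4]
    refine Finset.sum_congr (by congr!) fun x _ => ?_
    rw [smul_eq_mul, smul_eq_mul]
    congr 1
    by_cases h5 : P ≤ conjSub (x : G) T
    · rw [if_pos h5, mul_one]
      exact (mark_res hT (le_conjSub_iff.1 h5) b).trans (mark_conj (H.inv_mem x.2) P b)
    · rw [if_neg h5, mul_zero]
      exact mark_zero (fun h => h5 (le_conjSub_iff.2 h)) _
  refine (sumStab_congr key a).trans ?_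
  rw [sumStab_sum]
  have h6 : ∀ x : H, sumStab H (fun T => (ord H)⁻¹ • mark P b •
      (if P ≤ conjSub (x : G) T then (1 : ℚ) else 0)) a = (ord H)⁻¹ • mark P b • mark P a := by
    intro x
    rw [sumStab_smul, sumStab_smul, sumStab_conj x.2 (fun T => if P ≤ T then (1 : ℚ) else 0),
      mark]
  rw [Finset.sum_congr rfl fun x _ => h6 x, Finset.sum_const, Finset.card_univ,
    ← Nat.card_eq_fintype_card, ← Nat.cast_smul_eq_nsmul ℚ, smul_smul]
  change (ord H * (ord H)⁻¹) • _ = _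
  rw [mul_inv_cancel₀ h0, one_smul, smul_eq_mul, mul_comm]

lemma bmul_comm {H : Subgroup G} (a b : Burnside H) : bmul a b = bmul b a :=
  mark_inj fun P _ => by rw [mark_bmul, mark_bmul, mul_comm]

lemma bmul_one {H : Subgroup G} (a : Burnside H) : bmul a (one H) = a :=
  (bmul_comm _ _).trans ((burnside G).act_one a)

lemma act_comm {H : Subgroup G} (a b : Burnside H) (m : M.obj H) :
    M.act H a (M.act H b m) = M.act H b (M.act H a m) := by
  rw [← act_bmul, bmul_comm, act_bmul]

lemma res_one {K H : Subgroup G} (h : K ≤ H) : (burnside G).res h (one H) = one K :=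
  mark_inj fun P hP => by
    refine (mark_res h hP _).trans ?_
    rw [mark_one, mark_one, if_pos hP, if_pos (hP.trans h)]

lemma conj_one (g : G) {K H : Subgroup G} (e : K = conjSub g H) :
    (burnside G).conj g e (one H) = one K :=
  mark_inj fun P hP => by
    refine (mark_conjHom g e hP _).trans ?_
    rw [mark_one, mark_one, if_pos hP, if_pos (le_conjSub_iff.1 (e ▸ hP))]

/-- The left unit isomorphism `a ⊗ m ↦ a m` of the box product. -/
def unitIso : box (burnside G) M ≅ M where
  hom := M.actPairing.lift
  inv :=
    { app := fun H => (boxPairing (burnside G) M).φ H (one H)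
      app_res := fun h m => by
        refine Eq.symm ((res_tmul h _ _).trans ?_)
        rw [res_one]; rfl
      app_ind := fun h m => by
        refine (tmul_ind h _ _).trans ?_
        rw [res_one]; rfl
      app_conj := fun g _ _ e m => by
        refine Eq.symm ((conj_tmul g e _ _).trans ?_)
        rw [conj_one]; rfl }
  hom_inv_id := box_hom_ext fun H a m => by
    rw [comp_app, Pairing.lift_tmul]
    refine (act_tmul_right (M := burnside G) a (one H) m).trans ?_
    refine (act_tmul_left (M := burnside G) a (one H) m).symm.trans ?_
    exact congrArg (fun z : (burnside G).obj H => tmul z m) (bmul_one a)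
  inv_hom_id := by
    ext H m
    rw [comp_app]
    refine (M.actPairing.lift_tmul _ _).trans (M.act_one m)

@[simp] lemma unitIso_hom_tmul {H : Subgroup G} (a : Burnside H) (m : M.obj H) :
    M.unitIso.hom.app H (tmul a m) = M.act H a m := M.actPairing.lift_tmul _ _

@[simp] lemma unitIso_inv_app {H : Subgroup G} (m : M.obj H) :
    M.unitIso.inv.app H m = tmul (one H : (burnside G).obj H) m := rfl

end Mackey

/-! ### The symmetric monoidal category of Mackey functors -/

namespace Mackey

open Burnside

variable {G : Type} [Group G] [Finite G]

instance : MonoidalCategoryStruct (Mackey G) where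
  tensorObj := box
  whiskerLeft M _ _ f := boxMap (𝟙 M) f
  whiskerRight f N := boxMap f (𝟙 N)
  tensorHom := boxMap
  tensorUnit := burnside G
  associator := assocIso
  leftUnitor M := M.unitIso
  rightUnitor M := swapIso M (burnside G) ≪≫ M.unitIso

lemma rightUnitor_hom_tmul (M : Mackey G) {H : Subgroup G} (m : M.obj H) (a : Burnside H) :
    (ρ_ M).hom.app H (tmul m (a : (burnside G).obj H)) = M.act H a m :=
  (congrArg (M.unitIso.hom.app H) (boxSwap_tmul M (burnside G) m a)).trans (unitIso_hom_tmul M a m)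

/-- Mackey functors form a monoidal category with the box product, whose unit is the Burnside
Mackey functor. -/
instance : MonoidalCategory (Mackey G) := MonoidalCategory.ofTensorHom
  (id_tensorHom_id := fun M N => box_hom_ext fun H x y => boxMap_tmul _ _ x y)
  (id_tensorHom := fun _ _ _ _ => rfl)
  (tensorHom_id := fun _ _ => rfl)
  (tensorHom_comp_tensorHom := fun f₁ f₂ g₁ g₂ => box_hom_ext fun H x y => by
    change (boxMap g₁ g₂).app H ((boxMap f₁ f₂).app H (tmul x y)) =
      (boxMap (f₁ ≫ g₁) (f₂ ≫ g₂)).app H (tmul x y)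
    simp only [boxMap_tmul, comp_app])
  (associator_naturality := fun f₁ f₂ f₃ => box_hom_ext₃ fun H x y z => by
    change (assocHom _ _ _).app H ((boxMap (boxMap f₁ f₂) f₃).app H (tmul (tmul x y) z)) =
      (boxMap f₁ (boxMap f₂ f₃)).app H ((assocHom _ _ _).app H (tmul (tmul x y) z))
    simp only [boxMap_tmul, assocHom_tmul])
  (leftUnitor_naturality := fun {M N} f => box_hom_ext fun H a m => by
    change N.unitIso.hom.app H ((boxMap (𝟙 _) f).app H (tmul a m)) =
      f.app H (M.unitIso.hom.app H (tmul a m))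
    rw [boxMap_tmul]
    refine (unitIso_hom_tmul N a (f.app H m)).trans ((act_app f a m).symm.trans ?_)
    exact congrArg _ (unitIso_hom_tmul M a m).symm)
  (rightUnitor_naturality := fun {M N} f => box_hom_ext fun H m a => by
    change (ρ_ N).hom.app H ((boxMap f (𝟙 _)).app H (tmul m a)) =
      f.app H ((ρ_ M).hom.app H (tmul m a))
    rw [boxMap_tmul]
    refine (rightUnitor_hom_tmul N (f.app H m) a).trans ((act_app f a m).symm.trans ?_)
    exact congrArg _ (rightUnitor_hom_tmul M m a).symm)
  (pentagon := fun W X Y Z => box_hom_ext₄ fun H w x y z => by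
    change (boxMap (𝟙 W) (assocHom X Y Z)).app H ((assocHom W (box X Y) Z).app H
      ((boxMap (assocHom W X Y) (𝟙 Z)).app H (tmul (tmul (tmul w x) y) z))) =
      (assocHom W X (box Y Z)).app H ((assocHom (box W X) Y Z).app H
        (tmul (tmul (tmul w x) y) z))
    simp only [boxMap_tmul, assocHom_tmul, id_app])
  (triangle := fun M N => box_hom_ext₃ fun H m a n => by
    change (boxMap (𝟙 M) N.unitIso.hom).app H ((assocHom M (burnside G) N).app H
      (tmul (tmul m a) n)) = (boxMap (ρ_ M).hom (𝟙 N)).app H (tmul (tmul m a) n)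
    rw [assocHom_tmul, boxMap_tmul, boxMap_tmul]
    refine (congrArg (fun z => tmul m z) (unitIso_hom_tmul N a n)).trans ?_
    refine Eq.trans ?_ (congrArg (fun z => tmul z n) (rightUnitor_hom_tmul M m a)).symm
    exact (act_tmul_right a m n).trans (act_tmul_left a m n).symm)

/-- The symmetry of the box product is `x ⊗ y ↦ y ⊗ x`. -/
instance : SymmetricCategory (Mackey G) where
  braiding := swapIso
  braiding_naturality_right X _ _ f := box_hom_ext fun H x y => by
    change (boxSwap _ _).app H ((boxMap (𝟙 X) f).app H (tmul x y)) =
      (boxMap f (𝟙 X)).app H ((boxSwap _ _).app H (tmul x y))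
    simp only [boxMap_tmul, boxSwap_tmul]
  braiding_naturality_left f Z := box_hom_ext fun H x y => by
    change (boxSwap _ _).app H ((boxMap f (𝟙 Z)).app H (tmul x y)) =
      (boxMap (𝟙 Z) f).app H ((boxSwap _ _).app H (tmul x y))
    simp only [boxMap_tmul, boxSwap_tmul]
  hexagon_forward X Y Z := box_hom_ext₃ fun H x y z => by
    change (assocHom Y Z X).app H ((boxSwap X (box Y Z)).app H
      ((assocHom X Y Z).app H (tmul (tmul x y) z))) =
      (boxMap (𝟙 Y) (boxSwap X Z)).app H ((assocHom Y X Z).app H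
        ((boxMap (boxSwap X Y) (𝟙 Z)).app H (tmul (tmul x y) z)))
    simp only [boxMap_tmul, boxSwap_tmul, assocHom_tmul, id_app]
  hexagon_reverse X Y Z := box_hom_ext₃' fun H x y z => by
    change (assocInv Z X Y).app H ((boxSwap (box X Y) Z).app H
      ((assocInv X Y Z).app H (tmul x (tmul y z)))) =
      (boxMap (boxSwap X Z) (𝟙 Y)).app H ((assocInv X Z Y).app H
        ((boxMap (𝟙 X) (boxSwap Y Z)).app H (tmul x (tmul y z))))
    simp only [boxMap_tmul, boxSwap_tmul, assocInv_tmul, id_app]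
  symmetry := boxSwap_boxSwap

end Mackey

/-! ### The summands `e_H Mack(G)` -/

namespace Mackey

open Burnside

variable {G : Type} [Group G] [Finite G]

/-- The restriction of `e_H` to `A_ℚ(K)`. -/
def idemRes (H K : Subgroup G) : Burnside K := (burnside G).res (le_top : K ≤ ⊤) (idem H)

open scoped Classical in
lemma mark_idemRes (H : Subgroup G) {P K : Subgroup G} (hP : P ≤ K) :
    mark P (idemRes H K) = if ∃ g : G, P = conjSub g H then 1 else 0 :=
  (mark_res le_top hP _).trans (mark_idem H P)

lemma bmul_idemRes (H K : Subgroup G) : bmul (idemRes H K) (idemRes H K) = idemRes H K :=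
  mark_inj fun P hP => by
    rw [mark_bmul, mark_idemRes H hP]
    split_ifs <;> simp

lemma act_idemRes_twice (M : Mackey G) (H : Subgroup G) {K : Subgroup G} (m : M.obj K) :
    M.act K (idemRes H K) (M.act K (idemRes H K) m) = M.act K (idemRes H K) m := by
  rw [← act_bmul, bmul_idemRes]

lemma res_act_idemRes (M : Mackey G) (H : Subgroup G) {L K : Subgroup G} (h : L ≤ K)
    (m : M.obj K) : M.res h (M.act K (idemRes H K) m) = M.act L (idemRes H L) (M.res h m) := by
  rw [res_act]
  congr 2
  exact (burnside G).res_res h le_top (idem H)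

lemma ind_act_idemRes (M : Mackey G) (H : Subgroup G) {L K : Subgroup G} (h : L ≤ K)
    (m : M.obj L) : M.ind h (M.act L (idemRes H L) m) = M.act K (idemRes H K) (M.ind h m) := by
  rw [act_ind]
  congr 3
  exact ((burnside G).res_res h le_top (idem H)).symm

lemma conj_act_idemRes (M : Mackey G) (H : Subgroup G) (g : G) {L K : Subgroup G}
    (e : L = conjSub g K) (m : M.obj K) :
    M.conj g e (M.act K (idemRes H K) m) = M.act L (idemRes H L) (M.conj g e m) := by
  rw [conj_act]
  congr 2
  have e' : (⊤ : Subgroup G) = conjSub g ⊤ := (conjSub_of_mem (Subgroup.mem_top g)).symm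
  refine ((burnside G).conj_res g e e' le_top le_top (idem H)).symm.trans ?_
  rw [(burnside G).conj_self (Subgroup.mem_top g) e']
  rfl

/-- `(e_H M)(G/K) = R_K(e_H) M(G/K)`. -/
def cutObj (H : Subgroup G) (M : Mackey G) (K : Subgroup G) : Submodule ℚ (M.obj K) :=
  LinearMap.range (M.act K (idemRes H K))

lemma mem_cutObj {H : Subgroup G} {M : Mackey G} {K : Subgroup G} {m : M.obj K} :
    m ∈ cutObj H M K ↔ M.act K (idemRes H K) m = m :=
  ⟨by rintro ⟨x, rfl⟩; exact act_idemRes_twice M H x, fun h => ⟨m, h⟩⟩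

/-- The Mackey functor `e_H M ⊆ M`, without the Mackey axiom. -/
def preCut (H : Subgroup G) (M : Mackey G) : PreMackey G where
  obj K := cutObj H M K
  res h := (M.res h).restrict fun m hm => mem_cutObj.2 (by
    rw [← res_act_idemRes, mem_cutObj.1 hm])
  ind h := (M.ind h).restrict fun m hm => mem_cutObj.2 (by
    rw [← ind_act_idemRes, mem_cutObj.1 hm])
  conj g _ _ e := (M.conj g e).restrict fun m hm => mem_cutObj.2 (by
    rw [← conj_act_idemRes, mem_cutObj.1 hm])
  res_self x := Subtype.ext (M.res_self _)
  ind_self x := Subtype.ext (M.ind_self _)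
  conj_self h e x := Subtype.ext (M.conj_self h e _)
  ind_ind h₁ h₂ x := Subtype.ext (M.ind_ind h₁ h₂ _)
  res_res h₁ h₂ x := Subtype.ext (M.res_res h₁ h₂ _)
  conj_conj g h _ _ _ e₁ e₂ e₃ x := Subtype.ext (M.conj_conj g h e₁ e₂ e₃ _)
  conj_res g _ _ _ _ eK eH h h' x := Subtype.ext (M.conj_res g eK eH h h' _)
  conj_ind g _ _ _ _ eK eH h h' x := Subtype.ext (M.conj_ind g eK eH h h' _)

/-- The Mackey functor `e_H M ⊆ M`. -/
def cut (H : Subgroup G) (M : Mackey G) : Mackey G where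
  toPreMackey := preCut H M
  mackey {K L J} hK hL y := by
    let f : (preCut H M).obj K →ₗ[ℚ] M.obj K := (cutObj H M K).subtype
    refine Subtype.ext ((M.mackey hK hL y.1).trans ?_)
    exact (map_sum f (fun q : DoubleCoset.Quotient (K.subgroupOf J : Set J)
      (L.subgroupOf J : Set J) => (preCut H M).ind (inf_le_left : K ⊓ conjSub (q.out : G) L ≤ K)
        ((preCut H M).conj (q.out : G) (inf_conjSub (q.out : G) K L)
          ((preCut H M).res (inf_le_left : L ⊓ conjSub (q.out : G)⁻¹ K ≤ L) y))) _).symm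

/-- The inclusion of `e_H M` in `M`. -/
def cutIncl (H : Subgroup G) (M : Mackey G) : cut H M ⟶ M where
  app K := (cutObj H M K).subtype
  app_res _ _ := rfl
  app_ind _ _ := rfl
  app_conj _ _ _ _ _ := rfl

/-- The projection of `M` to `e_H M`. -/
def cutProj (H : Subgroup G) (M : Mackey G) : M ⟶ cut H M where
  app K := (M.act K (idemRes H K)).rangeRestrict
  app_res h m := Subtype.ext (res_act_idemRes M H h m).symm
  app_ind h m := Subtype.ext (ind_act_idemRes M H h m).symm
  app_conj g _ _ e m := Subtype.ext (conj_act_idemRes M H g e m).symm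

lemma cutIncl_cutProj (H : Subgroup G) (M : Mackey G) : cutIncl H M ≫ cutProj H M = 𝟙 _ := by
  ext K m
  exact Subtype.ext (mem_cutObj.1 m.2)

lemma cutProj_cutIncl_app (H : Subgroup G) (M : Mackey G) {K : Subgroup G} (m : M.obj K) :
    (cutProj H M ≫ cutIncl H M).app K m = M.act K (idemRes H K) m := rfl

/-- The property `M = e_H M`. -/
def isCut (H : Subgroup G) : ObjectProperty (Mackey G) := fun M => ∀ K, cutObj H M K = ⊤

lemma isCut_iff {H : Subgroup G} {M : Mackey G} :
    isCut H M ↔ ∀ K (m : M.obj K), M.act K (idemRes H K) m = m :=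
  forall_congr' fun K => by
    rw [Submodule.eq_top_iff']
    exact forall_congr' fun m => mem_cutObj

lemma isCut_cut (H : Subgroup G) (M : Mackey G) : isCut H (cut H M) := isCut_iff.2 fun K m => by
  refine Subtype.ext ?_
  change (cutIncl H M).app K _ = _
  rw [act_app]
  exact mem_cutObj.1 m.2

lemma isCut_box {H : Subgroup G} {M N : Mackey G} (hM : isCut H M) : isCut H (box M N) :=
  isCut_iff.2 fun K z => by
    refine obj_ext ((box M N).act K (idemRes H K)) LinearMap.id (fun {L} hL x y => ?_) z
    rw [← ind_act_idemRes, ← act_tmul_left, isCut_iff.1 hM]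
    rfl

/-- The category `e_H Mack(G)`: the full subcategory of the Mackey functors `M` with
`M = e_H M`. -/
abbrev EMack (H : Subgroup G) := (isCut H).FullSubcategory

/-- The functor `M ↦ e_H M`. -/
def cutFunctor (H : Subgroup G) : Mackey G ⥤ EMack H where
  obj M := ⟨cut H M, isCut_cut H M⟩
  map {M N} f := ObjectProperty.homMk
    { app := fun K => (f.app K).restrict fun m hm => mem_cutObj.2 (by
        rw [← act_app, mem_cutObj.1 hm])
      app_res := fun h m => Subtype.ext (f.app_res h _)
      app_ind := fun h m => Subtype.ext (f.app_ind h _)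
      app_conj := fun g _ _ e m => Subtype.ext (f.app_conj g e _) }

/-- The left unit isomorphism `e_H A_ℚ □ M ≅ M`, given by `a ⊗ m ↦ a m`. -/
def cutUnitIso {H : Subgroup G} {M : Mackey G} (hM : isCut H M) :
    box (cut H (burnside G)) M ≅ M where
  hom := boxMap (cutIncl H (burnside G)) (𝟙 M) ≫ M.unitIso.hom
  inv := M.unitIso.inv ≫ boxMap (cutProj H (burnside G)) (𝟙 M)
  hom_inv_id := by
    rw [Category.assoc, Iso.hom_inv_id_assoc]
    change (cutIncl H (burnside G) ⊗ₘ 𝟙 M) ≫ (cutProj H (burnside G) ⊗ₘ 𝟙 M) = _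
    rw [MonoidalCategory.tensorHom_comp_tensorHom, cutIncl_cutProj, Category.comp_id,
      MonoidalCategory.id_tensorHom_id]
    rfl
  inv_hom_id := by
    ext K m
    refine (congrArg (fun z => M.unitIso.hom.app K
      ((boxMap (cutIncl H (burnside G)) (𝟙 M)).app K z)) (boxMap_tmul _ _ _ m)).trans ?_
    refine (congrArg (M.unitIso.hom.app K) (boxMap_tmul _ _ _ _)).trans ?_
    refine (unitIso_hom_tmul M _ _).trans ?_
    refine (act_bmul M (idemRes H K) (one K) m).trans ?_
    rw [act_one]
    exact isCut_iff.1 hM K m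

lemma cutUnitIso_hom_tmul {H : Subgroup G} {M : Mackey G} (hM : isCut H M) {K : Subgroup G}
    (a : (cut H (burnside G)).obj K) (m : M.obj K) :
    (cutUnitIso hM).hom.app K (tmul a m) = M.act K ((cutIncl H (burnside G)).app K a) m :=
  (congrArg (M.unitIso.hom.app K) (boxMap_tmul _ _ a m)).trans (unitIso_hom_tmul M _ _)

instance (H : Subgroup G) : MonoidalCategoryStruct (EMack H) where
  tensorObj M N := ⟨M.obj ⊗ N.obj, isCut_box M.property⟩
  whiskerLeft M _ _ f := ObjectProperty.homMk (M.obj ◁ f.hom)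
  whiskerRight f N := ObjectProperty.homMk (f.hom ▷ N.obj)
  tensorHom f g := ObjectProperty.homMk (f.hom ⊗ₘ g.hom)
  tensorUnit := ⟨cut H (burnside G), isCut_cut H _⟩
  associator M N P := ObjectProperty.isoMk _ (α_ M.obj N.obj P.obj)
  leftUnitor M := ObjectProperty.isoMk _ (cutUnitIso M.property)
  rightUnitor M := ObjectProperty.isoMk _
    (swapIso M.obj (cut H (burnside G)) ≪≫ cutUnitIso M.property)

lemma cut_rightUnitor_hom_tmul {H : Subgroup G} (M : EMack H) {K : Subgroup G}
    (m : M.obj.obj K) (a : (cut H (burnside G)).obj K) :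
    (ρ_ M).hom.hom.app K (tmul m a) = M.obj.act K ((cutIncl H (burnside G)).app K a) m :=
  (congrArg ((cutUnitIso M.property).hom.app K) (boxSwap_tmul M.obj _ m a)).trans
    (cutUnitIso_hom_tmul M.property a m)

/-- `e_H Mack(G)` is a monoidal category with the box product, whose unit is `e_H A_ℚ`. -/
instance (H : Subgroup G) : MonoidalCategory (EMack H) := MonoidalCategory.ofTensorHom
  (id_tensorHom_id := fun M N => ObjectProperty.hom_ext _
    (MonoidalCategory.id_tensorHom_id M.obj N.obj))
  (id_tensorHom := fun M _ _ f => ObjectProperty.hom_ext _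
    (MonoidalCategory.id_tensorHom M.obj f.hom))
  (tensorHom_id := fun f N => ObjectProperty.hom_ext _
    (MonoidalCategory.tensorHom_id f.hom N.obj))
  (tensorHom_comp_tensorHom := fun f₁ f₂ g₁ g₂ => ObjectProperty.hom_ext _
    (MonoidalCategory.tensorHom_comp_tensorHom f₁.hom f₂.hom g₁.hom g₂.hom))
  (associator_naturality := fun f₁ f₂ f₃ => ObjectProperty.hom_ext _
    (MonoidalCategory.associator_naturality f₁.hom f₂.hom f₃.hom))
  (leftUnitor_naturality := fun {M N} f => ObjectProperty.hom_ext _ <| box_hom_ext fun K a m => by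
    change (cutUnitIso N.property).hom.app K ((boxMap (𝟙 _) f.hom).app K (tmul a m)) =
      f.hom.app K ((cutUnitIso M.property).hom.app K (tmul a m))
    rw [boxMap_tmul, cutUnitIso_hom_tmul, cutUnitIso_hom_tmul]
    exact (act_app f.hom _ m).symm)
  (rightUnitor_naturality := fun {M N} f => ObjectProperty.hom_ext _ <| box_hom_ext fun K m a => by
    change (ρ_ N).hom.hom.app K ((boxMap f.hom (𝟙 _)).app K (tmul m a)) =
      f.hom.app K ((ρ_ M).hom.hom.app K (tmul m a))
    rw [boxMap_tmul, cut_rightUnitor_hom_tmul, cut_rightUnitor_hom_tmul]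
    exact (act_app f.hom _ m).symm)
  (pentagon := fun W X Y Z => ObjectProperty.hom_ext _ <| by
    have := MonoidalCategory.pentagon W.obj X.obj Y.obj Z.obj
    rw [← MonoidalCategory.tensorHom_id, ← MonoidalCategory.id_tensorHom] at this
    exact this)
  (triangle := fun M N => ObjectProperty.hom_ext _ <| box_hom_ext₃ fun K m a n => by
    change (boxMap (𝟙 M.obj) (cutUnitIso N.property).hom).app K ((assocHom M.obj _ N.obj).app K
      (tmul (tmul m a) n)) = (boxMap (ρ_ M).hom.hom (𝟙 N.obj)).app K (tmul (tmul m a) n)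
    rw [assocHom_tmul, boxMap_tmul, boxMap_tmul, cutUnitIso_hom_tmul, cut_rightUnitor_hom_tmul]
    exact (act_tmul_right _ m n).trans (act_tmul_left _ m n).symm)

/-- The symmetry is `x ⊗ y ↦ y ⊗ x`. -/
instance (H : Subgroup G) : SymmetricCategory (EMack H) where
  braiding M N := ObjectProperty.isoMk _ (β_ M.obj N.obj)
  braiding_naturality_right X _ _ f := ObjectProperty.hom_ext _
    (BraidedCategory.braiding_naturality_right X.obj f.hom)
  braiding_naturality_left f Z := ObjectProperty.hom_ext _
    (BraidedCategory.braiding_naturality_left f.hom Z.obj)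
  hexagon_forward X Y Z := ObjectProperty.hom_ext _
    (BraidedCategory.hexagon_forward X.obj Y.obj Z.obj)
  hexagon_reverse X Y Z := ObjectProperty.hom_ext _
    (BraidedCategory.hexagon_reverse X.obj Y.obj Z.obj)
  symmetry X Y := ObjectProperty.hom_ext _ (SymmetricCategory.symmetry X.obj Y.obj)

/-- The set of conjugacy classes of subgroups of `G`. -/
def conjSetoid (G : Type) [Group G] : Setoid (Subgroup G) where
  r H K := ∃ g : G, K = conjSub g H
  iseqv := ⟨fun H => ⟨1, (conjSub_one H).symm⟩,
    fun {H K} ⟨g, h⟩ => ⟨g⁻¹, by rw [h, ← conjSub_mul, inv_mul_cancel, conjSub_one]⟩,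
    fun {H K L} ⟨g, h⟩ ⟨g', h'⟩ => ⟨g' * g, by rw [h', h, conjSub_mul]⟩⟩

/-- The idempotent splitting `M ↦ (e_H M)_H`, with one `H` in each conjugacy class of
subgroups. -/
def splitting (G : Type) [Group G] [Finite G] :
    Mackey G ⥤ ∀ c : Quotient (conjSetoid G), EMack c.out :=
  Functor.pi' fun c => cutFunctor c.out

end Mackey

/-! ### The functors `U_H` and `F_H` -/

namespace Mackey

open Burnside

variable {G : Type} [Group G] [Finite G]

/-- The Weyl group `W_G H = N_G H / H`. -/
abbrev Weyl (H : Subgroup G) : Type :=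
  Subgroup.normalizer (H : Set G) ⧸ H.subgroupOf (Subgroup.normalizer (H : Set G))

lemma conjSub_normalizer {H : Subgroup G} (n : Subgroup.normalizer (H : Set G)) :
    conjSub (n : G) H = H := by
  ext x
  rw [mem_conjSub]
  exact ((Subgroup.mem_normalizer_iff'' (H := H)).1 n.2 x).symm

/-- The action of `W_G H` on `M(G/H)` by conjugation maps. -/
def weylRep (H : Subgroup G) (M : Mackey G) : Representation ℚ (Weyl H) (M.obj H) :=
  QuotientGroup.lift _
    { toFun := fun n => M.conj (n : G) (conjSub_normalizer n).symm
      map_one' := LinearMap.ext fun x => M.conj_self H.one_mem _ x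
      map_mul' := fun _ _ => LinearMap.ext fun x => (M.conj_conj _ _ _ _ _ x).symm }
    (fun _ hn => LinearMap.ext fun x => M.conj_self (Subgroup.mem_subgroupOf.1 hn) _ x)

/-- The functor `U_H`, with `U_H M = M(G/H)` as a module over `ℚ[W_G H]`. -/
def U (H : Subgroup G) : EMack H ⥤ Rep.{0} ℚ (Weyl H) where
  obj M := Rep.of (weylRep H M.obj)
  map {M N} f := Rep.ofHom (LinearMap.intertwiningMap_of_isIntertwiningMap _ _ (f.hom.app H)
    (fun w x => by
      induction w using QuotientGroup.induction_on with
      | H n => exact f.hom.app_conj _ _ x))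

variable (H : Subgroup G) (V : Rep.{0} ℚ (Weyl H))

/-- The value of `F_H(V)` at `G/K`, that is `(ℚ[(G/K)^H] ⊗ V)^{W_G H}`: its elements are the
families `(y_σ)` in `V`, indexed by the points `σ` of `(G/K)^H = {gK | g⁻¹ H g ≤ K}`, with
`y_{wσ} = w y_σ` for all `w` in `W_G H`. Such a family is written as the function `g ↦ y_{gK}` on
`G` which vanishes at those `g` for which `gK` is not fixed by `H`. -/
def fObj (K : Subgroup G) : Submodule ℚ (G → V.V) where
  carrier := {f | (∀ g, ¬ conjSub g⁻¹ H ≤ K → f g = 0) ∧ (∀ g, ∀ k ∈ K, f (g * k) = f g) ∧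
    ∀ (n : Subgroup.normalizer (H : Set G)) g, f (n * g) = V.ρ (QuotientGroup.mk n) (f g)}
  add_mem' {f f'} hf hf' := ⟨fun g hg => by simp [hf.1 g hg, hf'.1 g hg],
    fun g k hk => by simp [hf.2.1 g k hk, hf'.2.1 g k hk],
    fun n g => by simp [hf.2.2 n g, hf'.2.2 n g]⟩
  zero_mem' := ⟨fun _ _ => rfl, fun _ _ _ => rfl, fun _ _ => by simp⟩
  smul_mem' c f hf := ⟨fun g hg => by simp [hf.1 g hg], fun g k hk => by simp [hf.2.1 g k hk],
    fun n g => by simp [hf.2.2 n g]⟩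

lemma conjSub_mul_inv_le {K : Subgroup G} {g k : G} (hk : k ∈ K) :
    conjSub (g * k)⁻¹ H ≤ K ↔ conjSub g⁻¹ H ≤ K := by
  rw [mul_inv_rev, conjSub_mul, ← le_conjSub_iff, conjSub_of_mem hk]

lemma conjSub_normalizer_mul (n : Subgroup.normalizer (H : Set G)) (g : G) :
    conjSub (n * g)⁻¹ H = conjSub g⁻¹ H := by
  have := conjSub_normalizer (n⁻¹)
  rw [Subgroup.coe_inv] at this
  rw [mul_inv_rev, conjSub_mul, this]

open scoped Classical in
/-- The restriction `(R y)_σ = y_{α σ}` for the projection `α : G/L → G/K`. -/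
def fRes {L K : Subgroup G} (h : L ≤ K) : fObj H V K →ₗ[ℚ] fObj H V L where
  toFun f := ⟨fun g => if conjSub g⁻¹ H ≤ L then f.1 g else 0, fun g hg => if_neg hg,
    fun g k hk => if_congr (conjSub_mul_inv_le H hk) (f.2.2.1 g k (h hk)) rfl,
    fun n g => by
      beta_reduce
      rw [conjSub_normalizer_mul, f.2.2.2 n g]
      split_ifs <;> simp⟩
  map_add' f f' := by
    ext g
    simp only [Submodule.coe_add, Pi.add_apply]
    split_ifs <;> simp
  map_smul' c f := by
    ext g
    simp only [Submodule.coe_smul, Pi.smul_apply, RingHom.id_apply]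
    split_ifs <;> simp

lemma fRes_of_le {L K : Subgroup G} (h : L ≤ K) (f : fObj H V K) {g : G}
    (hg : conjSub g⁻¹ H ≤ L) : (fRes H V h f).1 g = f.1 g := if_pos hg

/-- The induction `(I y)_τ = ∑_{α σ = τ} y_σ` for the projection `α : G/L → G/K`: if `k` runs
through `K`, then `gkL` runs `|L|` times through the preimages of `gK`. -/
def fInd {L K : Subgroup G} (h : L ≤ K) : fObj H V L →ₗ[ℚ] fObj H V K where
  toFun f := ⟨fun g => (ord L)⁻¹ • ∑ k : K, f.1 (g * k),
    fun g hg => by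
      beta_reduce
      rw [Finset.sum_eq_zero, smul_zero]
      intro k _
      exact f.2.1 _ fun h' => hg ((conjSub_mul_inv_le H k.2).1 (h'.trans h)),
    fun g k hk => by
      beta_reduce
      congr 1
      rw [← Equiv.sum_comp (Equiv.mulLeft (⟨k, hk⟩ : K)) (fun k' : K => f.1 (g * k'))]
      exact Finset.sum_congr rfl fun k' _ => by
        rw [Equiv.coe_mulLeft, Subgroup.coe_mul, mul_assoc],
    fun n g => by
      beta_reduce
      rw [map_smul, map_sum]
      congr 1
      exact Finset.sum_congr rfl fun k _ => by rw [mul_assoc, f.2.2.2]⟩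
  map_add' f f' := by
    ext g
    simp [Finset.sum_add_distrib]
  map_smul' c f := by
    ext g
    simp only [Submodule.coe_smul, Pi.smul_apply, RingHom.id_apply, ← Finset.smul_sum]
    rw [smul_comm]

/-- The conjugation, induced by `G/gKg⁻¹ → G/K`, `x gKg⁻¹ ↦ xgK`. -/
def fConj (g : G) {K K' : Subgroup G} (e : K' = conjSub g K) : fObj H V K →ₗ[ℚ] fObj H V K' where
  toFun f := ⟨fun x => f.1 (x * g),
    fun x hx => f.2.1 _ fun h => hx (by
      rw [e, le_conjSub_iff, ← conjSub_mul, ← mul_inv_rev]; exact h),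
    fun x k hk => by
      have h1 : g⁻¹ * k * g ∈ K := mem_conjSub.1 (e ▸ hk)
      have h2 : x * k * g = x * g * (g⁻¹ * k * g) := by group
      beta_reduce
      rw [h2, f.2.2.1 _ _ h1],
    fun n x => by
      beta_reduce
      rw [mul_assoc, f.2.2.2]⟩
  map_add' f f' := rfl
  map_smul' c f := rfl

/-- The Mackey functor `F_H(V)`, without the Mackey axiom. -/
def preF : PreMackey G where
  obj K := fObj H V K
  res := fRes H V
  ind := fInd H V
  conj g _ _ e := fConj H V g e
  res_self {K} f := by
    ext g
    by_cases hg : conjSub g⁻¹ H ≤ K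
    · exact fRes_of_le H V _ f hg
    · rw [f.2.1 g hg]; exact if_neg hg
  ind_self {K} f := by
    ext g
    change (ord K)⁻¹ • ∑ k : K, f.1 (g * k) = f.1 g
    rw [Finset.sum_congr rfl fun (k : K) _ => f.2.2.1 g k k.2, Finset.sum_const, Finset.card_univ,
      ← Nat.card_eq_fintype_card, ← Nat.cast_smul_eq_nsmul ℚ, smul_smul]
    change ((ord K)⁻¹ * ord K) • _ = _
    rw [inv_mul_cancel₀ (ord_ne_zero K), one_smul]
  conj_self hh e f := by
    ext g
    exact f.2.2.1 g _ hh
  ind_ind {L K J} h₁ h₂ f := by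
    ext g
    change (ord K)⁻¹ • ∑ j : J, (ord L)⁻¹ • ∑ k : K, f.1 (g * j * k) =
      (ord L)⁻¹ • ∑ j : J, f.1 (g * j)
    rw [← Finset.smul_sum]
    simp only [mul_assoc]
    rw [sum_mul_right h₂ (fun y => f.1 (g * y)), smul_comm (ord L)⁻¹, smul_smul,
      inv_mul_cancel₀ (ord_ne_zero K), one_smul]
  res_res {L K J} h₁ h₂ f := by
    ext g
    by_cases hg : conjSub g⁻¹ H ≤ L
    · rw [fRes_of_le H V _ _ hg, fRes_of_le H V _ _ (hg.trans h₁), fRes_of_le H V _ _ hg]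
    · exact (if_neg hg).trans (if_neg hg).symm
  conj_conj g h _ _ _ e₁ e₂ e₃ f := by
    ext x
    exact congrArg f.1 (mul_assoc x g h)
  conj_res g K J K' J' eK eJ h h' f := by
    ext x
    have e : conjSub x⁻¹ H ≤ K' ↔ conjSub (x * g)⁻¹ H ≤ K := by
      rw [eK, le_conjSub_iff, ← conjSub_mul, ← mul_inv_rev]
    by_cases hx : conjSub x⁻¹ H ≤ K'
    · exact (if_pos hx).trans (if_pos (e.1 hx)).symm
    · exact (if_neg hx).trans (if_neg (fun h => hx (e.2 h))).symm
  conj_ind g K J K' J' eK eJ h h' f := by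
    subst eK eJ
    ext x
    change (ord (conjSub g K))⁻¹ • ∑ k : conjSub g J, f.1 (x * k * g) =
      (ord K)⁻¹ • ∑ k : J, f.1 (x * g * k)
    rw [ord_conjSub]
    congr 1
    let e : J ≃ conjSub g J := (Subgroup.equivSMul (MulAut.conj g) J).toEquiv
    have he : ∀ m : J, ((e m : conjSub g J) : G) = g * m * g⁻¹ := fun m => rfl
    rw [← e.sum_comp]
    refine Finset.sum_congr rfl fun m _ => ?_
    rw [he]
    congr 1
    group

lemma preF_dc (K : Subgroup G) {L : Subgroup G} (x : G) (f : fObj H V L) {g : G}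
    (hg : conjSub g⁻¹ H ≤ K) :
    ((preF H V).dc K x (f : (preF H V).obj L) : fObj H V K).1 g =
      (ord (K ⊓ conjSub x L))⁻¹ • ∑ k : K, f.1 (g * (k * x)) := by
  change (ord (K ⊓ conjSub x L))⁻¹ • ∑ k : K,
    (fRes H V inf_le_right (fConj H V x rfl f) : fObj H V (K ⊓ conjSub x L)).1 (g * k) = _
  congr 1
  refine Finset.sum_congr rfl fun k _ => ?_
  rw [← mul_assoc]
  by_cases h1 : conjSub (g * k)⁻¹ H ≤ K ⊓ conjSub x L
  · exact fRes_of_le H V _ _ h1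
  · refine (if_neg h1).trans (f.2.1 _ fun h2 => h1 (le_inf ?_ ?_)).symm
    · exact (conjSub_mul_inv_le H k.2).2 hg
    · rw [le_conjSub_iff, ← conjSub_mul, ← mul_inv_rev]; exact h2

/-- The Mackey functor `F_H(V)`. -/
def fMackey : Mackey G where
  toPreMackey := preF H V
  mackey := by
    rw [PreMackey.mackeyAxiom_iff]
    intro K L J hK hL (f : fObj H V L)
    refine Subtype.ext (funext fun g => ?_)
    by_cases hg : conjSub g⁻¹ H ≤ K
    · let ev : (preF H V).obj K →ₗ[ℚ] V.V := LinearMap.proj g ∘ₗ (fObj H V K).subtype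
      have h1 : ev ((preF H V).res hK ((preF H V).ind hL f)) =
          (ord L)⁻¹ • ∑ x : J, f.1 (g * x) := fRes_of_le H V hK (fInd H V hL f) hg
      have h2 : ∀ x : J, ev ((ord (K ⊓ conjSub (x : G) L) / (ord K * ord L)) •
          (preF H V).dc K (x : G) (f : (preF H V).obj L)) =
          ∑ k : K, ((ord K)⁻¹ * (ord L)⁻¹) • f.1 (g * (k * x)) := by
        intro x
        have h3 : ev ((preF H V).dc K (x : G) (f : (preF H V).obj L)) = _ :=
          preF_dc H V K (x : G) f hg
        have h4 := ord_ne_zero (K ⊓ conjSub (x : G) L)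
        rw [map_smul, h3, smul_smul, ← Finset.smul_sum]
        congr 1
        field_simp
      refine h1.trans (Eq.trans ?_ (map_sum ev _ _).symm)
      rw [Finset.sum_congr rfl fun x _ => h2 x, Finset.sum_comm,
        sum_mul_left hK (fun y => ((ord K)⁻¹ * (ord L)⁻¹) • f.1 (g * y)), ← Finset.smul_sum,
        smul_smul, ← mul_assoc, mul_inv_cancel₀ (ord_ne_zero K), one_mul]
    · have h0 : ∀ y : fObj H V K, y.1 g = 0 := fun y => y.2.1 g hg
      exact (h0 _).trans (h0 _).symm

lemma act_fMackey {K : Subgroup G} (a : Burnside K) (f : fObj H V K) (g : G) :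
    ((fMackey H V).act K a (f : (fMackey H V).obj K) : fObj H V K).1 g =
      mark (conjSub g⁻¹ H) a • f.1 g := by
  have _i : DecidableEq (Subgroup G) := Classical.decEq _
  let ev : (fMackey H V).obj K →ₗ[ℚ] V.V := LinearMap.proj g ∘ₗ (fObj H V K).subtype
  refine (congrArg ev (act_eq (fMackey H V) a f)).trans ?_
  rw [map_sumStab]
  set P := conjSub g⁻¹ H with hP
  have key : ∀ T ≤ K, ev ((ord T / ord K) • (fMackey H V).indRes K T f) =
      ∑ k : K, (ord K)⁻¹ • LinearMap.toSpanSingleton ℚ V.V (f.1 g)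
        (@ite _ (P ≤ conjSub (k : G) T) (Classical.propDecidable _) (1 : ℚ) 0) := by
    intro T hT
    have h0 := ord_ne_zero T
    have h1 : ev ((fMackey H V).indRes K T f) =
        (ord T)⁻¹ • ∑ k : K, (fRes H V hT f).1 (g * k) :=
      congrArg ev (indRes_of_le _ hT f)
    rw [map_smul, h1, smul_smul, Finset.smul_sum]
    have h2 : ord T / ord K * (ord T)⁻¹ = (ord K)⁻¹ := by field_simp
    rw [h2]
    refine Finset.sum_congr rfl fun k _ => ?_
    congr 1
    have h3 : conjSub (g * k)⁻¹ H ≤ T ↔ P ≤ conjSub (k : G) T := by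
      rw [le_conjSub_iff, hP, ← conjSub_mul, ← mul_inv_rev]
    rw [LinearMap.toSpanSingleton_apply]
    by_cases h4 : P ≤ conjSub (k : G) T
    · rw [fRes_of_le H V hT f (h3.2 h4), if_pos h4, one_smul, f.2.2.1 g k k.2]
    · rw [if_neg h4, zero_smul]
      exact if_neg (fun h => h4 (h3.1 h))
  refine (sumStab_congr key a).trans ?_
  rw [sum_sumStab_conj (fun T => (ord K)⁻¹ • LinearMap.toSpanSingleton ℚ V.V (f.1 g)
    (@ite _ (P ≤ T) (Classical.propDecidable _) (1 : ℚ) 0)), sumStab_smul, smul_smul,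
    mul_inv_cancel₀ (ord_ne_zero K), one_smul, ← map_sumStab, LinearMap.toSpanSingleton_apply]
  rfl

lemma isCut_fMackey : isCut H (fMackey H V) := isCut_iff.2 fun K (f : fObj H V K) => by
  refine Subtype.ext (funext fun g => ?_)
  refine (act_fMackey H V (idemRes H K) f g).trans ?_
  by_cases hg : conjSub g⁻¹ H ≤ K
  · rw [mark_idemRes H hg, if_pos ⟨g⁻¹, rfl⟩, one_smul]
  · rw [f.2.1 g hg, smul_zero]

/-- The functor `F_H`. -/
def F (H : Subgroup G) : Rep.{0} ℚ (Weyl H) ⥤ EMack H where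
  obj V := ⟨fMackey H V, isCut_fMackey H V⟩
  map {V W} φ := ObjectProperty.homMk
    { app := fun K => (φ.hom.toLinearMap.compLeft G).restrict fun f hf =>
        ⟨fun g hg => by rw [LinearMap.compLeft_apply, Function.comp_apply, hf.1 g hg, map_zero],
        fun g k hk => congrArg φ.hom.toLinearMap (hf.2.1 g k hk),
        fun n g => (congrArg φ.hom.toLinearMap (hf.2.2 n g)).trans (Rep.hom_comm_apply φ _ _)⟩
      app_res := fun {L K} h (f : fObj H V K) => by
        refine Subtype.ext (funext fun g => ?_)
        by_cases hg : conjSub g⁻¹ H ≤ L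
        · exact (congrArg φ.hom.toLinearMap (fRes_of_le H V h f hg)).trans (if_pos hg).symm
        · exact (congrArg φ.hom.toLinearMap (if_neg hg)).trans
            ((map_zero φ.hom.toLinearMap).trans (if_neg hg).symm)
      app_ind := fun {L K} h (f : fObj H V L) => by
        refine Subtype.ext (funext fun g => ?_)
        change φ.hom.toLinearMap ((ord L)⁻¹ • ∑ k : K, f.1 (g * k)) =
          (ord L)⁻¹ • ∑ k : K, φ.hom.toLinearMap (f.1 (g * k))
        rw [map_smul, map_sum]
      app_conj := fun g _ _ e f => rfl }

end Mackey

end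

end RatMackey

open RatMackey RatMackey.Mackey

namespace RatMackey

noncomputable section

attribute [local instance 5] Fintype.ofFinite

namespace Mackey

open Burnside

variable {G : Type} [Group G] [Finite G]

/-! ### Mackey functors in `e_H Mack(G)` are determined by their value at `G/H` -/

/-! An element of A_ℚ(K) is determined by its marks (`mark_inj`), so everything about the
restrictions of the idempotents e_H is read off from characteristic functions of conjugacy classes.
Three facts about R_K(e_H) carry part (1).

(a) If K contains no conjugate of H, then R_K(e_H) = 0. Hence a Mackey functor with M = e_H M
vanishes at such K, in particular at every proper subgroup of H (`isCut.eq_zero_of_not_le`).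

(b) R_K(e_H) is the sum of (|L|/|K|) Ind_L^K R_L(e_H) over the subgroups L of K conjugate to H
(`idemRes_eq_sum`). Since R_K(e_H) acts as the identity on M(G/K), every x in M(G/K) is the
corresponding combination of the elements I_L^K R^K_L x (`isCut.eq_sum_ind_res`). A morphism in e_H
Mack(G) that is bijective at G/H is bijective at G/L for every conjugate L of H, and therefore at
all levels (`app_bijective_of_isCut`).

(c) At level H only the mark at H of R_H(e_H) is nonzero, so e_H A_ℚ(H) is one-dimensional
(`unitMap_bijective`).

The unit of U_H ⊣ F_H sends x in M(G/K) to the family of R_H C_g x, indexed by the gK fixed by H. It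
commutes with induction by the double coset formula: a double coset that does not come from a fixed
point passes through a proper subgroup of H, where M vanishes by (a). The counit takes the component
of a family at the trivial coset. It is bijective because (G/H)^H is a free transitive W_GH-set
(`counitHom_bijective`). A triangle identity then makes the unit bijective at level H, and by (b) it
is an isomorphism.

In (M □ N)(G/H) the summands indexed by proper subgroups of H vanish by (a), and conjugation by H on
the summand of H is trivial. What remains is M(G/H) ⊗ N(G/H) (`tensorMap_bijective`). Together with
(c) this makes U_H strong symmetric monoidal. F_H receives the structure that corresponds to it
under the adjunction, so the adjunction is monoidal by construction.

For part (2), the idempotents e_H, one for each conjugacy class, are orthogonal with sum 1, again by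
marks. Every M is therefore the sum of its pieces e_H M, and there are no nonzero morphisms between
pieces for different classes. This gives faithfulness and fullness, while the product of a family
M_H in e_H Mack(G) has the prescribed pieces (`cutIncl_piProj_bijective`). The functor is monoidal
since the Burnside action passes through either tensor factor: e(x ⊗ y) = ex ⊗ y = ex ⊗ ey. -/

lemma conjSub_inv_eq {g : G} {H L : Subgroup G} (e : L = conjSub g H) : H = conjSub g⁻¹ L := by
  rw [e, ← conjSub_mul, inv_mul_cancel, conjSub_one]

lemma idemRes_eq_zero {H K : Subgroup G} (h : ∀ g : G, ¬ conjSub g H ≤ K) : idemRes H K = 0 :=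
  mark_inj fun P hP => by
    rw [mark_idemRes H hP, map_zero, if_neg]
    rintro ⟨g, rfl⟩
    exact h g hP

/-- The element R_K(e_H) acts on M(G/K) both as the identity and as zero. -/
lemma isCut.eq_zero {H : Subgroup G} {M : Mackey G} (hM : isCut H M) {K : Subgroup G}
    (h : ∀ g : G, ¬ conjSub g H ≤ K) (x : M.obj K) : x = 0 := by
  rw [← isCut_iff.1 hM K x, idemRes_eq_zero h, map_zero, LinearMap.zero_apply]

lemma eq_of_conjSub_le {g : G} {H K : Subgroup G} (hK : K ≤ H) (h : conjSub g H ≤ K) : K = H :=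
  Subgroup.eq_of_le_of_card_ge hK (by rw [← card_conjSub g H]; exact Subgroup.card_le_of_le h)

/-- A proper subgroup of H is too small to contain a conjugate of H. This vanishing is the source of
both the compatibility of the adjunction unit with induction and the computation of the box product
at level H. -/
lemma isCut.eq_zero_of_not_le {H : Subgroup G} {M : Mackey G} (hM : isCut H M) {K : Subgroup G}
    (hK : K ≤ H) (h : ¬ H ≤ K) (x : M.obj K) : x = 0 :=
  hM.eq_zero (fun _ hg => h (eq_of_conjSub_le hK hg).ge) x

/-- The subgroups of `K` which are conjugate to `H` in `G`. -/
abbrev ConjIn (H K : Subgroup G) : Type := {L : Subgroup G // L ≤ K ∧ ∃ g : G, L = conjSub g H}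

open scoped Classical in
-- Two conjugates of H have the same order, so the only conjugate of H inside L is L itself.
lemma mark_idemRes_conj {H L : Subgroup G} (hL : ∃ g : G, L = conjSub g H) (P : Subgroup G) :
    mark P (idemRes H L) = if L = P then 1 else 0 := by
  by_cases hP : P ≤ L
  · rw [mark_idemRes H hP]
    refine if_congr ⟨?_, fun h => h ▸ hL⟩ rfl rfl
    rintro ⟨g, rfl⟩
    obtain ⟨g', rfl⟩ := hL
    exact (le_iff_eq_of_card (by rw [card_conjSub, card_conjSub])).1 hP
  · rw [mark_zero hP, if_neg fun h => hP h.ge]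

/-- The restriction of `e_H` to `K` is induced from the subgroups of `K` conjugate to `H`. -/
lemma idemRes_eq_sum (H K : Subgroup G) :
    idemRes H K = ∑ L : ConjIn H K,
      (ord L.1 / ord K) • induce (Subgroup.inclusion L.2.1) (idemRes H L.1) := by
  have _i : DecidableEq (Subgroup G) := Classical.decEq _
  refine mark_inj fun P hP => ?_
  -- The weight |L|/|K| cancels the factor 1/|L| in the mark of an induced element. What is left is
  -- 1/|K| times the number of x in K with L = x⁻¹Px.
  have h1 : ∀ L : ConjIn H K, mark P ((ord L.1 / ord K) •
      induce (Subgroup.inclusion L.2.1) (idemRes H L.1)) =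
        ∑ x : K, if L.1 = conjSub (x : G)⁻¹ P then (ord K)⁻¹ else 0 := fun L => by
    have h0 := ord_ne_zero L.1
    rw [map_smul, mark_induce, smul_eq_mul, ← mul_assoc,
      show ord L.1 / ord K * (ord L.1)⁻¹ = (ord K)⁻¹ by field_simp, Finset.mul_sum]
    refine Finset.sum_congr rfl fun x _ => ?_
    rw [mark_idemRes_conj L.2.2]
    split_ifs <;> simp
  rw [map_sum, Finset.sum_congr rfl fun L _ => h1 L, Finset.sum_comm, mark_idemRes H hP]
  split_ifs with h
  · have h2 : ∀ x : K, (∑ L : ConjIn H K, if L.1 = conjSub (x : G)⁻¹ P then (ord K)⁻¹ else 0) =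
        (ord K)⁻¹ := fun x => by
      obtain ⟨g, hg⟩ := h
      -- When P is conjugate to H, each x in K is counted for exactly one L, namely x⁻¹Px. The |K|
      -- terms 1/|K| add up to 1.
      let L₀ : ConjIn H K := ⟨conjSub (x : G)⁻¹ P, conjSub_le_of_mem hP (K.inv_mem x.2),
        (x : G)⁻¹ * g, by rw [conjSub_mul, hg]⟩
      rw [Finset.sum_eq_single L₀ (fun L _ hL => if_neg fun h => hL (Subtype.ext h))
        (fun h => absurd (Finset.mem_univ _) h), if_pos rfl]
    rw [Finset.sum_congr rfl fun x _ => h2 x, Finset.sum_const, Finset.card_univ,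
      ← Nat.card_eq_fintype_card, nsmul_eq_mul]
    exact (mul_inv_cancel₀ (ord_ne_zero K)).symm
  · refine (Finset.sum_eq_zero fun x _ => Finset.sum_eq_zero fun L _ => if_neg fun hL => h ?_).symm
    obtain ⟨g, hg⟩ := L.2.2
    exact ⟨x * g, by rw [conjSub_mul, ← hg, hL, ← conjSub_mul, mul_inv_cancel, conjSub_one]⟩

/-- Let both sides of `idemRes_eq_sum` act on x. An element induced from L acts as I ∘ a ∘ R by
Frobenius reciprocity (`ind_act`), and a = R_L(e_H) is the identity on M(G/L). -/
lemma isCut.eq_sum_ind_res {H : Subgroup G} {M : Mackey G} (hM : isCut H M) {K : Subgroup G}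
    (x : M.obj K) :
    x = ∑ L : ConjIn H K, (ord L.1 / ord K) • M.ind L.2.1 (M.res L.2.1 x) := by
  conv_lhs => rw [← isCut_iff.1 hM K x, idemRes_eq_sum, map_sum, LinearMap.sum_apply]
  refine Finset.sum_congr rfl fun L _ => ?_
  rw [map_smul, LinearMap.smul_apply, ind_act, isCut_iff.1 hM]

/-! ### Isomorphisms in e_H Mack(G) are detected at level H -/

lemma conj_injective (M : Mackey G) (g : G) {K L : Subgroup G} (e : L = conjSub g K) :
    Function.Injective (M.conj g e) := fun x y h => by
  have e' := conjSub_inv_eq e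
  have e'' : K = conjSub (g⁻¹ * g) K := by rw [inv_mul_cancel, conjSub_one]
  have h1 : (1 : G) ∈ K := K.one_mem
  rw [← inv_mul_cancel g] at h1
  rw [← M.conj_self h1 e'' x, ← M.conj_self h1 e'' y, ← M.conj_conj _ _ e e', h,
    M.conj_conj _ _ e e']

lemma conj_surjective (M : Mackey G) (g : G) {K L : Subgroup G} (e : L = conjSub g K) :
    Function.Surjective (M.conj g e) := fun y => by
  have e'' : L = conjSub (g * g⁻¹) L := by rw [mul_inv_cancel, conjSub_one]
  have h1 : (1 : G) ∈ L := L.one_mem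
  rw [← mul_inv_cancel g] at h1
  exact ⟨M.conj g⁻¹ (conjSub_inv_eq e) y, by rw [M.conj_conj _ _ _ _ e'', M.conj_self h1]⟩

lemma app_bijective_of_conj {M N : Mackey G} (f : M ⟶ N) {H L : Subgroup G}
    (hf : Function.Bijective (f.app H)) {g : G} (e : L = conjSub g H) :
    Function.Bijective (f.app L) := by
  refine ⟨fun x y h => ?_, fun z => ?_⟩
  · obtain ⟨x, rfl⟩ := conj_surjective M g e x
    obtain ⟨y, rfl⟩ := conj_surjective M g e y
    rw [f.app_conj, f.app_conj] at h
    rw [hf.1 (conj_injective N g e h)]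
  · obtain ⟨z, rfl⟩ := conj_surjective N g e z
    obtain ⟨x, rfl⟩ := hf.2 z
    exact ⟨M.conj g e x, f.app_conj _ _ _⟩

/-- Elements at level K are recovered from their restrictions to the conjugates of H in K by
`isCut.eq_sum_ind_res`, and at these conjugates f is bijective because it commutes with conjugation.
-/
lemma app_bijective_of_isCut {H : Subgroup G} {M N : Mackey G} (hM : isCut H M) (hN : isCut H N)
    (f : M ⟶ N) (hf : Function.Bijective (f.app H)) (K : Subgroup G) :
    Function.Bijective (f.app K) := by
  have hL : ∀ L : ConjIn H K, Function.Bijective (f.app L.1) := fun L =>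
    app_bijective_of_conj f hf L.2.2.choose_spec
  refine ⟨(injective_iff_map_eq_zero _).2 fun x hx => ?_, fun z => ?_⟩
  · rw [hM.eq_sum_ind_res x]
    refine Finset.sum_eq_zero fun L _ => ?_
    have : M.res L.2.1 x = 0 := (hL L).1 (by rw [f.app_res, hx, map_zero, map_zero])
    rw [this, map_zero, smul_zero]
  -- The preimages `y L` of the restrictions of z may be chosen independently of one another: the
  -- weighted sum of their inductions maps to the expansion of z, with no compatibility needed.
  · choose y hy using fun L : ConjIn H K => (hL L).2 (N.res L.2.1 z)
    refine ⟨∑ L : ConjIn H K, (ord L.1 / ord K) • M.ind L.2.1 (y L), ?_⟩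
    rw [hN.eq_sum_ind_res z, map_sum]
    refine Finset.sum_congr rfl fun L _ => ?_
    rw [map_smul, f.app_ind, hy]

/-- A morphism of Mackey functors that is bijective at every level is an isomorphism. -/
def isoOfBijective {M N : Mackey G} (f : M ⟶ N) (hf : ∀ K, Function.Bijective (f.app K)) :
    M ≅ N where
  hom := f
  inv :=
    { app := fun K => (LinearEquiv.ofBijective (f.app K) (hf K)).symm
      app_res := fun {K H} h x => by
        simp only [LinearEquiv.coe_coe]
        rw [LinearEquiv.symm_apply_eq, LinearEquiv.ofBijective_apply, f.app_res]
        congr 1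
        exact ((LinearEquiv.ofBijective (f.app H) (hf H)).apply_symm_apply x).symm
      app_ind := fun {K H} h x => by
        simp only [LinearEquiv.coe_coe]
        rw [LinearEquiv.symm_apply_eq, LinearEquiv.ofBijective_apply, f.app_ind]
        congr 1
        exact ((LinearEquiv.ofBijective (f.app K) (hf K)).apply_symm_apply x).symm
      app_conj := fun g {H K} e x => by
        simp only [LinearEquiv.coe_coe]
        rw [LinearEquiv.symm_apply_eq, LinearEquiv.ofBijective_apply, f.app_conj]
        congr 1
        exact ((LinearEquiv.ofBijective (f.app H) (hf H)).apply_symm_apply x).symm }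
  hom_inv_id := hom_ext fun K x =>
    (LinearEquiv.ofBijective (f.app K) (hf K)).symm_apply_apply x
  inv_hom_id := hom_ext fun K x =>
    (LinearEquiv.ofBijective (f.app K) (hf K)).apply_symm_apply x

lemma isIso_of_bijective {H : Subgroup G} {M N : EMack H} (f : M ⟶ N)
    (hf : Function.Bijective (f.hom.app H)) : IsIso f :=
  (ObjectProperty.isoMk (isCut H) (isoOfBijective f.hom
    (app_bijective_of_isCut M.property N.property f.hom hf))).isIso_hom

/-! ### The adjunction -/

/-- Here H ∩ gLg⁻¹ = H, so the induction in `dc` is along an equality. -/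
lemma dc_eq_tr {M : Mackey G} {H L : Subgroup G} (g : G)
    (h : H ≤ conjSub g L) (x : M.obj L) : M.dc H g x = M.tr g h x := by
  rw [← M.ind_self (M.tr g h x)]
  exact M.ind_tr_congr (inf_eq_left.2 h) _ _ _ _ _ _ rfl

open scoped Classical in
/-- The element of `F_H(U_H M)(G/K)` given by `x ∈ M(G/K)`, with components `R_H C_g x`. -/
def unitFun (H : Subgroup G) (M : Mackey G) (K : Subgroup G) :
    M.obj K →ₗ[ℚ] fObj H (Rep.of (weylRep H M)) K where
  -- The condition H ≤ gKg⁻¹ says that gK is fixed by H. The value zero at the other g is the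
  -- convention of `fObj`.
  toFun x := ⟨fun g => if h : H ≤ conjSub g K then M.tr g h x else 0,
    fun g hg => dif_neg fun h => hg (le_conjSub_iff.1 h),
    fun g k hk => by
      beta_reduce
      have e : conjSub (g * k) K = conjSub g K := by rw [conjSub_mul, conjSub_of_mem hk]
      by_cases h : H ≤ conjSub g K
      · rw [dif_pos h, dif_pos (h.trans e.ge)]
        exact M.tr_mul_mem g hk h _ x
      · rw [dif_neg h, dif_neg fun h' => h (h'.trans e.le)],
    fun n g => by
      beta_reduce
      have e : H ≤ conjSub (n * g) K ↔ H ≤ conjSub g K := by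
        rw [le_conjSub_iff, conjSub_normalizer_mul, le_conjSub_iff]
      by_cases h : H ≤ conjSub g K
      · rw [dif_pos h, dif_pos (e.2 h), ← M.tr_tr (n : G) g (conjSub_normalizer n).ge h,
          ← M.conj_eq_tr _ (conjSub_normalizer n).symm]
        rfl
      · rw [dif_neg h, dif_neg fun h' => h (e.1 h'), map_zero]⟩
  map_add' x y := by
    ext g
    simp only [Submodule.coe_add, Pi.add_apply]
    split_ifs <;> simp
  map_smul' c x := by
    ext g
    simp only [Submodule.coe_smul, Pi.smul_apply, RingHom.id_apply]
    split_ifs <;> simp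

lemma unitFun_apply (H : Subgroup G) (M : Mackey G) {K : Subgroup G} (x : M.obj K) {g : G}
    (h : H ≤ conjSub g K) : (unitFun H M K x).1 g = M.tr g h x := dif_pos h

lemma fObj_ext {H : Subgroup G} {V : Rep.{0} ℚ (Weyl H)} {K : Subgroup G} {f f' : fObj H V K}
    (h : ∀ g, H ≤ conjSub g K → f.1 g = f'.1 g) : f = f' :=
  Subtype.ext <| funext fun g => by
    by_cases hg : H ≤ conjSub g K
    · exact h g hg
    · rw [f.2.1 g fun h' => hg (le_conjSub_iff.2 h'), f'.2.1 g fun h' => hg (le_conjSub_iff.2 h')]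

/-- The unit of the adjunction. -/
def unitHom {H : Subgroup G} {M : Mackey G} (hM : isCut H M) :
    M ⟶ fMackey H (Rep.of (weylRep H M)) where
  app := unitFun H M
  app_res {L K} h x := fObj_ext fun g hg => by
    have hg' : H ≤ conjSub g K := hg.trans (conjSub_mono g h)
    refine (unitFun_apply H M _ hg).trans (Eq.trans ?_
      (fRes_of_le H _ h (unitFun H M K x) (le_conjSub_iff.1 hg)).symm)
    rw [unitFun_apply H M x hg', M.tr_res g hg h hg']
  app_ind {L K} h x := fObj_ext fun g hg => by
    refine (unitFun_apply H M _ hg).trans ?_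
    -- The double coset formula writes R_H C_g I_L^K x as a sum over k in K, to be compared term by
    -- term with the sum over K in `fInd`.
    rw [M.tr_ind g hg h]
    change _ = (ord L)⁻¹ • ∑ k : K, (unitFun H M L x).1 (g * k)
    rw [Finset.smul_sum]
    refine Finset.sum_congr rfl fun k _ => ?_
    -- If gkL is fixed by H, the coefficient |H|/(|H||L|) equals the factor 1/|L| of `fInd`.
    -- Otherwise H ∩ gkL(gk)⁻¹ is a proper subgroup of H, where M vanishes. This is the only place
    -- where `hM` enters.
    by_cases hk : H ≤ conjSub (g * k) L
    · have h0 := ord_ne_zero H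
      rw [unitFun_apply H M x hk, dc_eq_tr _ hk, inf_eq_left.2 hk]
      congr 1
      field_simp
    · rw [(unitFun H M L x).2.1 _ fun h' => hk (le_conjSub_iff.2 h'), smul_zero]
      unfold PreMackey.dc
      rw [hM.eq_zero_of_not_le inf_le_left (fun h' => hk (h'.trans inf_le_right)) (M.tr _ _ x),
        map_zero, smul_zero]
  app_conj g {K K'} e x := fObj_ext fun y hy => by
    have e' : conjSub (y * g) K = conjSub y K' := by rw [conjSub_mul, e]
    refine (unitFun_apply H M _ hy).trans (Eq.trans ?_
      (unitFun_apply H M x (hy.trans e'.ge)).symm)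
    rw [M.conj_eq_tr, M.tr_tr _ _ _ _ (hy.trans e'.ge)]

/-- The counit of the adjunction, `y ↦ y_H`. -/
def counitHom (H : Subgroup G) (V : Rep.{0} ℚ (Weyl H)) : (U H).obj ((F H).obj V) ⟶ V :=
  Rep.ofHom (LinearMap.intertwiningMap_of_isIntertwiningMap (weylRep H (fMackey H V)) V.ρ
    (LinearMap.proj 1 ∘ₗ (fObj H V H).subtype) (fun w y => by
      induction w using QuotientGroup.induction_on with
      | H n =>
        -- The action of n on the family y followed by evaluation at 1 gives y at 1·n = n·1, which
        -- equals n y(1) by equivariance of y.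
        have h := (show fObj H V H from y).2.2.2 n 1
        rw [mul_one, ← one_mul (n : G)] at h
        exact h))

/-- The counit applied to R_H C_g y recovers the component of y at g. This is the content of the
second triangle identity. -/
lemma tr_fMackey_one {H : Subgroup G} {V : Rep.{0} ℚ (Weyl H)} {K : Subgroup G} (y : fObj H V K)
    {g : G} (h : H ≤ conjSub g K) :
    ((fMackey H V).tr g h (y : (fMackey H V).obj K) : fObj H V H).1 1 = y.1 g := by
  have h1 : conjSub (1 : G)⁻¹ H ≤ H := by rw [inv_one, conjSub_one]
  exact (fRes_of_le H V h (fConj H V g rfl y) h1).trans (congrArg y.1 (one_mul g))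

/-- The adjunction between `U_H` and `F_H`. -/
def adjUF (H : Subgroup G) : U H ⊣ F H :=
  Adjunction.mkOfUnitCounit
    { unit :=
        { app := fun M => ObjectProperty.homMk (unitHom M.property)
          naturality := fun M N f => ObjectProperty.hom_ext _ <| hom_ext fun K x =>
            fObj_ext fun g hg => by
              refine (unitFun_apply H N.obj (f.hom.app K x) hg).trans ?_
              rw [← app_tr]
              exact congrArg (f.hom.app H) (unitFun_apply H M.obj x hg).symm }
      counit :=
        { app := counitHom H
          naturality := fun V W f => rfl }
      left_triangle := by
        ext M x
        have h : H ≤ conjSub 1 H := (conjSub_one H).ge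
        -- The component of the unit at g = 1 is the restriction from H to H, that is, the identity.
        exact (unitFun_apply H M.obj x h).trans ((M.obj.res_eq_tr le_rfl x).symm.trans
          (M.obj.res_self x))
      right_triangle := by
        ext V : 2
        refine ObjectProperty.hom_ext _ <| hom_ext fun K y => fObj_ext fun g hg => ?_
        -- F_H of the counit takes the component at 1 of each component of the unit, and the
        -- component at g of the unit is R_H C_g y.
        refine Eq.trans ?_ (tr_fMackey_one y hg)
        exact congrArg (fun z : fObj H V H => z.1 1) (unitFun_apply H (fMackey H V) y hg) }

/-! ### The counit and the unit are isomorphisms -/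

lemma mem_normalizer_of_conjSub_le {H : Subgroup G} {g : G} (h : conjSub g⁻¹ H ≤ H) :
    g ∈ Subgroup.normalizer (H : Set G) := by
  have e : conjSub g⁻¹ H = H :=
    Subgroup.eq_of_le_of_card_ge h (by rw [card_conjSub])
  refine (Subgroup.mem_normalizer_iff'' (H := H)).2 fun x => ?_
  have e' := conjSub_inv_eq e.symm
  rw [inv_inv] at e'
  rw [← mem_conjSub, ← e']

/-- The points gH fixed by H are those with g in N_G H, so (G/H)^H is W_GH acting on itself. An
equivariant family on it is determined by its component at 1, which is arbitrary. -/
lemma counitHom_bijective (H : Subgroup G) (V : Rep.{0} ℚ (Weyl H)) :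
    Function.Bijective (counitHom H V).hom := by
  classical
  have hN : ∀ (y : fObj H V H) (n : Subgroup.normalizer (H : Set G)),
      y.1 n = V.ρ (QuotientGroup.mk n) (y.1 1) := fun y n => by rw [← y.2.2.2 n 1, mul_one]
  refine ⟨fun (y y' : fObj H V H) (h : y.1 1 = y'.1 1) => fObj_ext fun g hg => ?_, fun v => ?_⟩
  · let n : Subgroup.normalizer (H : Set G) :=
      ⟨g, mem_normalizer_of_conjSub_le (le_conjSub_iff.1 hg)⟩
    exact (hN y n).trans ((congrArg _ h).trans (hN y' n).symm)
  -- The preimage of v is the equivariant family n ↦ nv on the normalizer, extended by zero to all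
  -- of G.
  · let φ : G → V.V := fun g =>
      if h : g ∈ Subgroup.normalizer (H : Set G) then V.ρ (QuotientGroup.mk ⟨g, h⟩) v else 0
    have h1 : ∀ (n : Subgroup.normalizer (H : Set G)) g,
        φ (n * g) = V.ρ (QuotientGroup.mk n) (φ g) := fun n g => by
      by_cases hg : g ∈ Subgroup.normalizer (H : Set G)
      · refine (dif_pos (mul_mem n.2 hg)).trans ?_
        rw [show φ g = _ from dif_pos hg, ← Module.End.mul_apply, ← map_mul]
        rfl
      · rw [show φ g = 0 from dif_neg hg, map_zero]
        exact dif_neg fun h => hg ((Subgroup.mul_mem_cancel_left _ n.2).1 h)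
    have h2 : ∀ g, ∀ k ∈ H, φ (g * k) = φ g := fun g k hk => by
      have hk' : k ∈ Subgroup.normalizer (H : Set G) := Subgroup.le_normalizer hk
      by_cases hg : g ∈ Subgroup.normalizer (H : Set G)
      · refine (dif_pos (mul_mem hg hk')).trans (Eq.trans ?_ (dif_pos hg).symm)
        congr 2
        exact (QuotientGroup.eq.2 (by
          rw [Subgroup.mem_subgroupOf]
          simpa using hk)).symm
      · exact (dif_neg fun h => hg ((Subgroup.mul_mem_cancel_right _ hk').1 h)).trans
          (show φ g = 0 from dif_neg hg).symm
    refine ⟨(⟨φ, fun g hg => dif_neg fun h => hg ?_, h2, h1⟩ : fObj H V H), ?_⟩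
    · have := conjSub_normalizer (⟨g, h⟩⁻¹ : Subgroup.normalizer (H : Set G))
      exact this.le
    · refine (dif_pos (one_mem _)).trans ?_
      change V.ρ ((1 : Subgroup.normalizer (H : Set G)) : Weyl H) v = v
      rw [QuotientGroup.mk_one, map_one]
      rfl

lemma isIso_rep_of_bijective {Γ : Type} [Group Γ] {V W : Rep.{0} ℚ Γ} (f : V ⟶ W)
    (hf : Function.Bijective f.hom) : IsIso f :=
  (ConcreteCategory.isIso_iff_bijective f).2 hf

instance (H : Subgroup G) : IsIso (adjUF H).counit :=
  (NatTrans.isIso_iff_isIso_app _).2 fun V =>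
    isIso_rep_of_bijective _ (counitHom_bijective H V)

/-- By the triangle identity the unit at level H is a right inverse of the counit, which is
bijective. So the unit is bijective at level H, and `isIso_of_bijective` spreads this to all levels.
-/
instance (H : Subgroup G) : IsIso (adjUF H).unit :=
  (NatTrans.isIso_iff_isIso_app _).2 fun M => isIso_of_bijective _ <| by
    have h : (U H).map ((adjUF H).unit.app M) ≫ counitHom H ((U H).obj M) = 𝟙 _ :=
      (adjUF H).left_triangle_components M
    have h1 : (counitHom H ((U H).obj M)).hom ∘ (unitHom M.property).app H = id :=
      funext fun x => congrArg (fun f => f.hom x) h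
    refine (Function.Bijective.of_comp_iff' (counitHom_bijective H _) _).1 ?_
    refine (congrArg Function.Bijective h1).mpr Function.bijective_id

end Mackey

end

end RatMackey
namespace RatMackey

noncomputable section

attribute [local instance 5] Fintype.ofFinite

/-! ### Monoidal structures -/

/-- The right adjoint of a braided functor is lax braided. -/
lemma rightAdjoint_braided {C D : Type*} [Category C] [Category D] [MonoidalCategory C]
    [MonoidalCategory D] [BraidedCategory C] [BraidedCategory D] {L : C ⥤ D} {R : D ⥤ C}
    (adj : L ⊣ R) [L.Braided] [R.LaxMonoidal] [adj.IsMonoidal] (X Y : D) :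
    Functor.LaxMonoidal.μ R X Y ≫ R.map (β_ X Y).hom =
      (β_ (R.obj X) (R.obj Y)).hom ≫ Functor.LaxMonoidal.μ R Y X := by
  -- Monoidality of the adjunction expresses μ of R through the unit, the counit and the
  -- comultiplication δ of L. Moving the braiding across the unit turns the claim into the
  -- compatibility of L with braidings and the naturality of the braiding.
  rw [Adjunction.IsMonoidal.leftAdjoint_μ (adj := adj),
    Adjunction.IsMonoidal.leftAdjoint_μ (adj := adj), Category.assoc, ← R.map_comp,
    ← adj.unit_naturality_assoc, ← R.map_comp]
  simp [Functor.map_braiding]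

/-! ### Morphisms out of tensor products of representations -/

section Rep

variable {Γ : Type} [Group Γ] {X Y Z W : Rep.{0} ℚ Γ}

lemma rep_tensor_ext {f g : X ⊗ Y ⟶ Z}
    (h : ∀ (x : X.V) (y : Y.V), f.hom (x ⊗ₜ[ℚ] y) = g.hom (x ⊗ₜ[ℚ] y)) : f = g :=
  ConcreteCategory.hom_ext _ _ fun t => LinearMap.congr_fun
    (TensorProduct.ext' (g := f.hom.toLinearMap) (h := g.hom.toLinearMap) h) t

lemma rep_tensor_ext₃ {f g : (X ⊗ Y) ⊗ Z ⟶ W}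
    (h : ∀ (x : X.V) (y : Y.V) (z : Z.V),
      f.hom ((x ⊗ₜ[ℚ] y) ⊗ₜ[ℚ] z) = g.hom ((x ⊗ₜ[ℚ] y) ⊗ₜ[ℚ] z)) : f = g :=
  ConcreteCategory.hom_ext _ _ fun t => LinearMap.congr_fun
    (TensorProduct.ext_threefold (g := f.hom.toLinearMap) (h := g.hom.toLinearMap) h) t

end Rep

/-! ### The tensor product at level H -/

namespace Mackey

open Burnside

variable {G : Type} [Group G] [Finite G] {H : Subgroup G}

/-- The structure map `x ⊗ y ↦ [x ⊗ y]` of `U_H`. -/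
def tensorMap (M N : EMack H) : (U H).obj M ⊗ (U H).obj N ⟶ (U H).obj (M ⊗ N) :=
  Rep.ofHom (LinearMap.intertwiningMap_of_isIntertwiningMap
    ((weylRep H M.obj).tprod (weylRep H N.obj)) (weylRep H (box M.obj N.obj))
    (TensorProduct.lift ((boxPairing M.obj N.obj).φ H)) (fun w t => by
      induction w using QuotientGroup.induction_on with
      | H n =>
        induction t with
        | zero => simp only [map_zero]
        | add t t' h h' => simp only [map_add, h, h']
        | tmul x y =>
          exact (conj_tmul (M := M.obj) (N := N.obj) (n : G) (conjSub_normalizer n).symm x y).symm))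

open scoped Classical in
/-- The inverse of `x ⊗ y ↦ [x ⊗ y]` at the level `H`. -/
def tensorInv {M N : Mackey G} (hM : isCut H M) (hN : isCut H N) :
    BoxObj M N H →ₗ[ℚ] M.obj H ⊗[ℚ] N.obj H :=
  -- The summands of proper subgroups K go to zero. If H ≤ K, then K = H, and restriction along `h`
  -- serves as the transport along this equality.
  boxLift (fun K _ => if h : H ≤ K then
      (TensorProduct.mk ℚ (M.obj H) (N.obj H)).compl₁₂ (M.res h) (N.res h) else 0)
    (fun {L K} hL hK x y => by
      -- A relation between levels L ≤ K ≤ H is trivial if L = H. Otherwise it involves an element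
      -- of N(G/L), which is zero because L is a proper subgroup of H.
      by_cases h : H ≤ L
      · obtain rfl : H = L := le_antisymm h (hL.trans hK)
        obtain rfl : H = K := le_antisymm hL hK
        simp only [M.res_self, N.ind_self]
      · rw [hN.eq_zero_of_not_le (hL.trans hK) h y, map_zero, map_zero, map_zero])
    (fun {L K} hL hK x y => by
      by_cases h : H ≤ L
      · obtain rfl : H = L := le_antisymm h (hL.trans hK)
        obtain rfl : H = K := le_antisymm hL hK
        simp only [N.res_self, M.ind_self]
      · rw [hM.eq_zero_of_not_le (hL.trans hK) h x, map_zero, map_zero, map_zero,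
          LinearMap.zero_apply, LinearMap.zero_apply])
    (fun {h} hh K K' hK hK' e x y => by
      -- On the summand of H the conjugations by elements of H are identities. On all other summands
      -- the map is zero, and conjugation preserves these summands.
      by_cases hH : H ≤ K
      · obtain rfl : H = K := le_antisymm hH hK
        obtain rfl : K' = H := e.trans (conjSub_of_mem hh)
        rw [M.conj_self hh, N.conj_self hh]
      · have hH' : ¬ H ≤ K' := fun h' => hH (by
          rw [e, le_conjSub_iff, conjSub_of_mem (H.inv_mem hh)] at h'
          exact h')
        rw [dif_neg hH, dif_neg hH', LinearMap.zero_apply, LinearMap.zero_apply,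
          LinearMap.zero_apply, LinearMap.zero_apply])

lemma tensorInv_tmul {M N : Mackey G} (hM : isCut H M) (hN : isCut H N) (x : M.obj H)
    (y : N.obj H) : tensorInv hM hN (tmul x y) = x ⊗ₜ y := by
  refine (boxLift_pr _ _ _ _ le_rfl x y).trans ?_
  rw [dif_pos le_rfl, LinearMap.compl₁₂_apply, M.res_self, N.res_self]
  rfl

/-- The two composites with `tensorInv` need only be checked on generators. The generators of the
box product that come from a proper subgroup of H are zero, so only the classes [x ⊗ y] at level H
remain. -/
lemma tensorMap_bijective (M N : EMack H) : Function.Bijective (tensorMap M N).hom := by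
  let τ : M.obj.obj H ⊗[ℚ] N.obj.obj H →ₗ[ℚ] (box M.obj N.obj).obj H :=
    TensorProduct.lift ((boxPairing M.obj N.obj).φ H)
  have h1 : ∀ t, tensorInv M.property N.property (τ t) = t := fun t =>
    LinearMap.congr_fun (TensorProduct.ext' (g := tensorInv M.property N.property ∘ₗ τ)
      (h := LinearMap.id) fun x y => tensorInv_tmul M.property N.property x y) t
  have h2 : ∀ z, τ (tensorInv M.property N.property z) = z :=
    obj_ext (τ ∘ₗ tensorInv M.property N.property) LinearMap.id fun {K} hK x y => by
      by_cases h : H ≤ K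
      · obtain rfl : H = K := le_antisymm h hK
        rw [PreMackey.ind_self]
        exact congrArg τ (tensorInv_tmul M.property N.property x y)
      · rw [M.property.eq_zero_of_not_le hK h x]
        simp only [tmul, map_zero, LinearMap.zero_apply]
  exact Function.bijective_iff_has_inverse.2 ⟨tensorInv M.property N.property, h1, h2⟩

/-! ### The unit object and the strong monoidal structure of U_H -/

lemma conj_idemRes (H : Subgroup G) {K : Subgroup G} (g : G) (e : K = conjSub g K) :
    (burnside G).conj g e (idemRes H K) = idemRes H K := by
  have h : (burnside G).act K (idemRes H K) (one K : (burnside G).obj K) = idemRes H K := bmul_one _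
  have h' := conj_act_idemRes (burnside G) H g e (one K)
  rwa [conj_one, h] at h'

/-- The generator of `e_H A_ℚ(H)`. -/
def cutOne (H : Subgroup G) : (cut H (burnside G)).obj H :=
  ⟨idemRes H H, mem_cutObj.2 (bmul_idemRes H H)⟩

/-- The unit map of `U_H`. -/
def unitMap (H : Subgroup G) : 𝟙_ (Rep.{0} ℚ (Weyl H)) ⟶ (U H).obj (𝟙_ (EMack H)) :=
  Rep.ofHom (LinearMap.intertwiningMap_of_isIntertwiningMap
    (Representation.trivial ℚ (Weyl H) ℚ) (weylRep H (cut H (burnside G)))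
    (LinearMap.toSpanSingleton ℚ _ (cutOne H)) (fun w c => by
      induction w using QuotientGroup.induction_on with
      | H n =>
        have h : weylRep H (cut H (burnside G)) n (cutOne H) = cutOne H :=
          Subtype.ext (conj_idemRes H (n : G) (conjSub_normalizer n).symm)
        have h' := map_smul (weylRep H (cut H (burnside G)) n) c (cutOne H)
        rw [h] at h'
        exact h'.symm))

lemma mark_idemRes_self (H : Subgroup G) : mark H (idemRes H H) = 1 := by
  classical
  rw [mark_idemRes H le_rfl, if_pos ⟨1, (conjSub_one H).symm⟩]

/-- Only the mark at H of R_H(e_H) is nonzero, and it is 1. Comparing marks, an element a with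
R_H(e_H) a = a is its mark at H times R_H(e_H). Injectivity follows by taking the mark at H. -/
lemma unitMap_bijective (H : Subgroup G) : Function.Bijective (unitMap H).hom := by
  refine ⟨fun (c c' : ℚ) h => ?_, fun a => ?_⟩
  · have h1 : (c • idemRes H H : Burnside H) = c' • idemRes H H := congrArg Subtype.val h
    have h2 := congrArg (mark H) h1
    rwa [map_smul, map_smul, mark_idemRes_self, smul_eq_mul, smul_eq_mul, mul_one, mul_one] at h2
  · obtain ⟨(a : Burnside H), ha⟩ := a
    have ha' : bmul (idemRes H H) a = a := mem_cutObj.1 ha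
    refine ⟨mark H a, Subtype.ext ?_⟩
    change (mark H a • idemRes H H : Burnside H) = a
    -- The mark at P of R_H(e_H) is zero unless P = H, and there both sides have the mark of a at H.
    refine mark_inj fun P hP => ?_
    conv_rhs => rw [← ha', mark_bmul]
    rw [map_smul, smul_eq_mul, mul_comm]
    classical
    rw [mark_idemRes_conj ⟨1, (conjSub_one H).symm⟩]
    split_ifs with h
    · subst h; rfl
    · rw [zero_mul, zero_mul]

instance (M N : EMack H) : IsIso (tensorMap M N) :=
  isIso_rep_of_bijective _ (tensorMap_bijective M N)

instance (H : Subgroup G) : IsIso (unitMap H) := isIso_rep_of_bijective _ (unitMap_bijective H)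

/-- Identifies the action of the unit object at level H with scalar multiplication, as both
unitality axioms for U_H require. -/
lemma act_smul_idemRes {M : Mackey G} (hM : isCut H M) (c : ℚ) {K : Subgroup G} (m : M.obj K) :
    M.act K (c • idemRes H K) m = c • m := by
  rw [map_smul, LinearMap.smul_apply, isCut_iff.1 hM]

/-- The strong monoidal structure of `U_H`. -/
def coreMonoidalU (H : Subgroup G) : (U H).CoreMonoidal where
  εIso := asIso (unitMap H)
  μIso M N := asIso (tensorMap M N)
  μIso_hom_natural_left {M N} f P := rep_tensor_ext fun x y =>
    (boxMap_tmul f.hom (𝟙 P.obj) (x : M.obj.obj H) (y : P.obj.obj H)).symm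
  μIso_hom_natural_right {M N} P f := rep_tensor_ext fun x y =>
    (boxMap_tmul (𝟙 P.obj) f.hom (x : P.obj.obj H) (y : M.obj.obj H)).symm
  associativity M N P := rep_tensor_ext₃ fun x y z =>
    assocHom_tmul M.obj N.obj P.obj (x : M.obj.obj H) (y : N.obj.obj H) (z : P.obj.obj H)
  left_unitality M := rep_tensor_ext fun (c : ℚ) (m : M.obj.obj H) => by
    -- The unit map sends c to c R_H(e_H), and the left unitor of e_H Mack(G) lets this act on m,
    -- which gives c m.
    refine Eq.symm ((cutUnitIso_hom_tmul M.property (c • cutOne H) m).trans ?_)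
    exact act_smul_idemRes M.property c m
  right_unitality M := rep_tensor_ext fun (m : M.obj.obj H) (c : ℚ) => by
    refine Eq.symm ((cut_rightUnitor_hom_tmul M m (c • cutOne H)).trans ?_)
    exact act_smul_idemRes M.property c m

lemma inverseMonoidal_isMonoidal {C D : Type*} [Category C] [Category D] [MonoidalCategory C]
    [MonoidalCategory D] (e : C ≌ D) [e.functor.Monoidal] :
    letI := e.inverseMonoidal
    e.IsMonoidal :=
  -- The monoidal structure of the inverse has as its lax part the one that the right adjoint
  -- inherits from the functor, and for that structure the adjunction is monoidal.
  let _ := e.toAdjunction.rightAdjointLaxMonoidal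
  inferInstanceAs e.toAdjunction.IsMonoidal

/-- `U_H` is a braided monoidal functor. -/
instance braidedU (H : Subgroup G) : (U H).Braided where
  toMonoidal := (coreMonoidalU H).toMonoidal
  braided M N := rep_tensor_ext fun x y =>
    boxSwap_tmul M.obj N.obj (x : M.obj.obj H) (y : N.obj.obj H)

/-- The equivalence of categories given by `U_H` and `F_H`. -/
def equivUF (H : Subgroup G) : EMack H ≌ Rep.{0} ℚ (Weyl H) := (adjUF H).toEquivalence

/-- U_H has the explicit structure `tensorMap`. F_H gets the structure determined by the adjunction
rather than one given by formulas, and its compatibility with the symmetries comes from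
`rightAdjoint_braided`. -/
theorem exists_braided_adjunction (H : Subgroup G) :
    ∃ (adj : U H ⊣ F H) (_ : (U H).Braided) (_ : (F H).Braided),
      (U H).IsEquivalence ∧ adj.IsMonoidal ∧
        ∀ (M N : EMack H) (x : M.obj.obj H) (y : N.obj.obj H),
          (Functor.LaxMonoidal.μ (U H) M N).hom (x ⊗ₜ[ℚ] y) = tmul x y := by
  -- The functor of `equivUF H` is U_H by definition, so its monoidal structure is supplied here.
  -- The inverse is likewise F_H.
  let _ : (equivUF H).functor.Monoidal := (braidedU H).toMonoidal
  let mF : (F H).Monoidal := (equivUF H).inverseMonoidal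
  let adj : U H ⊣ F H := (equivUF H).toAdjunction
  have hm : adj.IsMonoidal := inverseMonoidal_isMonoidal (equivUF H)
  exact ⟨adj, braidedU H, { toMonoidal := mF, braided := rightAdjoint_braided adj },
    (equivUF H).isEquivalence_functor, hm, fun M N x y => rfl⟩

end Mackey

end

end RatMackey
namespace RatMackey

noncomputable section

attribute [local instance 5] Fintype.ofFinite

namespace Mackey

open Burnside

variable {G : Type} [Group G] [Finite G]

/-! ### The idempotent splitting is monoidal -/

section cutFunctor

variable {H : Subgroup G} (M N : Mackey G)

lemma cut_ext {M : Mackey G} {K : Subgroup G} {x y : (cut H M).obj K}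
    (h : (cutIncl H M).app K x = (cutIncl H M).app K y) : x = y := Subtype.ext h

/-- The inclusion e_H N → N is a monomorphism, so identities of morphisms into e_H N can be checked
in N. -/
lemma cut_hom_ext {M N : Mackey G} {f g : M ⟶ cut H N}
    (h : f ≫ cutIncl H N = g ≫ cutIncl H N) : f = g :=
  hom_ext fun _ x => cut_ext (congrArg (fun k : M ⟶ N => k.app _ x) h)

lemma act_cut {K : Subgroup G} (m : (cut H M).obj K) :
    M.act K (idemRes H K) ((cutIncl H M).app K m) = (cutIncl H M).app K m :=
  mem_cutObj.1 m.2

/-- The map `e_H M □ e_H N → e_H (M □ N)` induced by the inclusions. -/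
def cutTensor : box (cut H M) (cut H N) ⟶ cut H (box M N) :=
  boxMap (cutIncl H M) (cutIncl H N) ≫ cutProj H (box M N)

/-- The projection in `cutTensor` changes nothing on [x ⊗ y]: the idempotent passes to the factor x,
which it fixes. Through this lemma all coherence conditions for M ↦ e_H M reduce to those of `Mackey
G`. -/
lemma cutTensor_tmul {K : Subgroup G} (x : (cut H M).obj K) (y : (cut H N).obj K) :
    (cutIncl H (box M N)).app K ((cutTensor M N).app K (tmul x y)) =
      tmul ((cutIncl H M).app K x) ((cutIncl H N).app K y) := by
  refine (cutProj_cutIncl_app H (box M N) _).trans ?_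
  rw [boxMap_tmul, ← act_tmul_left, act_cut]

lemma cutTensor_cutIncl :
    cutTensor M N ≫ cutIncl H (box M N) = boxMap (cutIncl H M) (cutIncl H N) :=
  box_hom_ext fun _ x y => (cutTensor_tmul M N x y).trans (boxMap_tmul _ _ x y).symm

/-- On [x ⊗ y] the left side is [ex ⊗ ey] = e²[x ⊗ y] with e = R_K(e_H), since the action passes
through each factor. The right side is e[x ⊗ y], and e² = e. -/
lemma boxMap_cutProj_cutIncl :
    boxMap (cutProj H M) (cutProj H N) ≫ boxMap (cutIncl H M) (cutIncl H N) =
      cutProj H (box M N) ≫ cutIncl H (box M N) :=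
  box_hom_ext fun K x y => by
    rw [cutProj_cutIncl_app, comp_app, boxMap_tmul, boxMap_tmul, ← comp_app, ← comp_app,
      cutProj_cutIncl_app, cutProj_cutIncl_app, act_tmul_left, act_tmul_right,
      act_idemRes_twice]

/-- The isomorphism `e_H M □ e_H N ≅ e_H (M □ N)`. -/
def cutTensorIso : box (cut H M) (cut H N) ≅ cut H (box M N) where
  hom := cutTensor M N
  inv := cutIncl H (box M N) ≫ boxMap (cutProj H M) (cutProj H N)
  hom_inv_id := by
    -- The box product of the inclusions is a split monomorphism: the box product of the projections
    -- is a retraction of it.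
    rw [← Category.assoc, cutTensor_cutIncl]
    refine box_hom_ext fun K x y => ?_
    rw [comp_app, boxMap_tmul, boxMap_tmul, ← comp_app, ← comp_app, cutIncl_cutProj,
      cutIncl_cutProj]
    rfl
  inv_hom_id := cut_hom_ext <| by
    rw [Category.assoc, Category.assoc, cutTensor_cutIncl, boxMap_cutProj_cutIncl,
      ← Category.assoc, cutIncl_cutProj]

/-- The strong monoidal structure of `M ↦ e_H M`. -/
def coreMonoidalCut (H : Subgroup G) : (cutFunctor H).CoreMonoidal where
  -- The unit of `EMack H` is e_H A_ℚ, which is by definition the value of the functor at the unit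
  -- A_ℚ.
  εIso := Iso.refl _
  μIso M N := ObjectProperty.isoMk (isCut H) (cutTensorIso M N)
  μIso_hom_natural_left {M N} f P := ObjectProperty.hom_ext _ <| box_hom_ext
    fun K (x : (cut H M).obj K) (y : (cut H P).obj K) => cut_ext <| by
      let k : cut H M ⟶ cut H N := ((cutFunctor H).map f).hom
      change (cutIncl H (box N P)).app K ((cutTensor N P).app K
          ((boxMap k (𝟙 (cut H P))).app K (tmul x y))) =
        (boxMap f (𝟙 P)).app K ((cutIncl H (box M P)).app K ((cutTensor M P).app K (tmul x y)))
      rw [boxMap_tmul, cutTensor_tmul, cutTensor_tmul, boxMap_tmul]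
      rfl
  μIso_hom_natural_right {M N} P f := ObjectProperty.hom_ext _ <| box_hom_ext
    fun K (x : (cut H P).obj K) (y : (cut H M).obj K) => cut_ext <| by
      let k : cut H M ⟶ cut H N := ((cutFunctor H).map f).hom
      change (cutIncl H (box P N)).app K ((cutTensor P N).app K
          ((boxMap (𝟙 (cut H P)) k).app K (tmul x y))) =
        (boxMap (𝟙 P) f).app K ((cutIncl H (box P M)).app K ((cutTensor P M).app K (tmul x y)))
      rw [boxMap_tmul, cutTensor_tmul, cutTensor_tmul, boxMap_tmul]
      rfl
  associativity M N P := ObjectProperty.hom_ext _ <| box_hom_ext₃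
    fun K (x : (cut H M).obj K) (y : (cut H N).obj K) (z : (cut H P).obj K) => cut_ext <| by
      change (assocHom M N P).app K ((cutIncl H (box (box M N) P)).app K
          ((cutTensor (box M N) P).app K ((boxMap (cutTensor M N) (𝟙 _)).app K
            (tmul (tmul x y) z)))) =
        (cutIncl H (box M (box N P))).app K ((cutTensor M (box N P)).app K
          ((boxMap (𝟙 _) (cutTensor N P)).app K ((assocHom _ _ _).app K (tmul (tmul x y) z))))
      rw [boxMap_tmul, cutTensor_tmul, cutTensor_tmul, assocHom_tmul, assocHom_tmul, boxMap_tmul,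
        cutTensor_tmul, cutTensor_tmul]
      rfl
  left_unitality M := ObjectProperty.hom_ext _ <| box_hom_ext
    fun K (a : (cut H (burnside G)).obj K) (m : (cut H M).obj K) => cut_ext <| by
    change (cutIncl H M).app K ((cutUnitIso (isCut_cut H M)).hom.app K (tmul a m)) =
      M.unitIso.hom.app K ((cutIncl H (box (burnside G) M)).app K ((cutTensor (burnside G) M).app K
        ((boxMap (𝟙 _) (𝟙 _)).app K (tmul a m))))
    rw [boxMap_tmul, cutTensor_tmul, cutUnitIso_hom_tmul]
    exact (act_app (cutIncl H M) _ _).trans (unitIso_hom_tmul M _ _).symm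
  right_unitality M := ObjectProperty.hom_ext _ <| box_hom_ext
    fun K (m : (cut H M).obj K) (a : (cut H (burnside G)).obj K) => cut_ext <| by
    -- Both unitors are the action of e_H A_ℚ ⊆ A_ℚ, in e_H M and in M respectively, and the
    -- inclusion commutes with this action.
    let r : box (cut H M) (cut H (burnside G)) ⟶ cut H M := (ρ_ ((cutFunctor H).obj M)).hom.hom
    have hr : r.app K (tmul m a) = (cut H M).act K ((cutIncl H (burnside G)).app K a) m :=
      cut_rightUnitor_hom_tmul ((cutFunctor H).obj M) m a
    change (cutIncl H M).app K (r.app K (tmul m a)) =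
      (ρ_ M).hom.app K ((cutIncl H (box M (burnside G))).app K ((cutTensor M (burnside G)).app K
        ((boxMap (𝟙 _) (𝟙 _)).app K (tmul m a))))
    rw [boxMap_tmul, cutTensor_tmul, hr]
    exact (act_app (cutIncl H M) _ _).trans (rightUnitor_hom_tmul M _ _).symm

/-- The functor `M ↦ e_H M` is braided monoidal. -/
instance braidedCut (H : Subgroup G) : (cutFunctor H).Braided where
  toMonoidal := (coreMonoidalCut H).toMonoidal
  braided M N := ObjectProperty.hom_ext _ <| box_hom_ext
    fun K (x : (cut H M).obj K) (y : (cut H N).obj K) => cut_ext <| by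
    change (boxSwap M N).app K ((cutIncl H (box M N)).app K ((cutTensor M N).app K (tmul x y))) =
      (cutIncl H (box N M)).app K ((cutTensor N M).app K ((boxSwap _ _).app K (tmul x y)))
    rw [boxSwap_tmul, cutTensor_tmul, cutTensor_tmul, boxSwap_tmul]

end cutFunctor

/-- A functor into a product with componentwise structure is braided as soon as its components are.
-/
instance braidedSplitting (G : Type) [Group G] [Finite G] : (splitting G).Braided :=
  inferInstanceAs
    (Functor.pi' fun c : Quotient (conjSetoid G) => cutFunctor (G := G) c.out).Braided

/-! ### The idempotent splitting is an equivalence -/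

lemma exists_conjSub_out_iff {c : Quotient (conjSetoid G)} {P : Subgroup G} :
    (∃ g : G, P = conjSub g c.out) ↔ c = Quotient.mk _ P := by
  conv_rhs => rw [← Quotient.out_eq c, Quotient.eq]
  rfl

/-- Each P ≤ K belongs to exactly one conjugacy class of subgroups of G, so the marks of the sum are
all 1. -/
lemma sum_idemRes (K : Subgroup G) : ∑ c : Quotient (conjSetoid G), idemRes c.out K = one K := by
  refine mark_inj fun P hP => ?_
  rw [map_sum, mark_one, if_pos hP, Finset.sum_eq_single (Quotient.mk _ P)]
  · classical
    rw [mark_idemRes _ hP, if_pos (exists_conjSub_out_iff.2 rfl)]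
  · intro c _ hc
    classical
    rw [mark_idemRes _ hP, if_neg fun h => hc (exists_conjSub_out_iff.1 h)]
  · exact fun h => absurd (Finset.mem_univ _) h

lemma sum_act_idemRes (M : Mackey G) {K : Subgroup G} (m : M.obj K) :
    ∑ c : Quotient (conjSetoid G), M.act K (idemRes c.out K) m = m := by
  conv_rhs => rw [← M.act_one m, ← sum_idemRes, map_sum, LinearMap.sum_apply]

/-- Orthogonality of the idempotents: no P is conjugate to the representatives of two different
classes, so R_K(e_c) R_K(e_d) has no nonzero mark. On M the factor R_K(e_d) is the identity. -/
lemma isCut.act_eq_zero {c d : Quotient (conjSetoid G)} (hcd : c ≠ d) {M : Mackey G}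
    (hM : isCut d.out M) {K : Subgroup G} (m : M.obj K) : M.act K (idemRes c.out K) m = 0 := by
  have h : bmul (idemRes c.out K) (idemRes d.out K) = 0 := mark_inj fun P hP => by
    classical
    rw [mark_bmul, map_zero, mark_idemRes _ hP, mark_idemRes _ hP]
    by_cases h : ∃ g : G, P = conjSub g c.out
    · have h' : ¬ ∃ g : G, P = conjSub g d.out := fun h' =>
        hcd ((exists_conjSub_out_iff.1 h).trans (exists_conjSub_out_iff.1 h').symm)
      rw [if_neg h', mul_zero]
    · rw [if_neg h, zero_mul]
  rw [← isCut_iff.1 hM K m, ← act_bmul, h, map_zero, LinearMap.zero_apply]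

/-! ### The splitting is fully faithful -/

instance (G : Type) [Group G] [Finite G] : (splitting G).Faithful where
  map_injective {M N f g} h := hom_ext fun K m => by
    -- Since m is the sum of its parts in the e_c M, a morphism is determined by its restrictions to
    -- these pieces.
    rw [← sum_act_idemRes M m, map_sum, map_sum]
    refine Finset.sum_congr rfl fun c _ => ?_
    have h1 : ((cutFunctor c.out).map f).hom = ((cutFunctor c.out).map g).hom :=
      congrArg (fun k : (cutFunctor c.out).obj M ⟶ (cutFunctor c.out).obj N => k.hom)
        (congrFun h c)
    exact congrArg (fun k : cut c.out M ⟶ cut c.out N =>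
      (cutIncl c.out N).app K (k.app K ((cutProj c.out M).app K m))) h1

/-- The sum of finitely many morphisms. -/
def sumHom {ι : Type} [Fintype ι] {M N : Mackey G} (f : ι → (M ⟶ N)) : M ⟶ N where
  app K := ∑ i, (f i).app K
  app_res h x := by simp only [LinearMap.sum_apply, map_sum, Hom.app_res]
  app_ind h x := by simp only [LinearMap.sum_apply, map_sum, Hom.app_ind]
  app_conj g _ _ e x := by simp only [LinearMap.sum_apply, map_sum, Hom.app_conj]

lemma sumHom_app {ι : Type} [Fintype ι] {M N : Mackey G} (f : ι → (M ⟶ N)) {K : Subgroup G}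
    (x : M.obj K) : (sumHom f).app K x = ∑ i, (f i).app K x := LinearMap.sum_apply _ _ _

lemma cutProj_app_eq_zero {c d : Quotient (conjSetoid G)} (hcd : c ≠ d) (M : Mackey G)
    {K : Subgroup G} (x : (cut d.out M).obj K) :
    (cutProj c.out M).app K ((cutIncl d.out M).app K x) = 0 := cut_ext <| by
  change M.act K (idemRes c.out K) ((cutIncl d.out M).app K x) = _
  rw [← act_app, isCut.act_eq_zero hcd (isCut_cut _ _), map_zero, map_zero]

/-- The morphism `M ⟶ N` with given components `e_H M ⟶ e_H N`. -/
def assemble {M N : Mackey G} (k : ∀ c : Quotient (conjSetoid G), cut c.out M ⟶ cut c.out N) :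
    M ⟶ N :=
  sumHom fun c : Quotient (conjSetoid G) => cutProj c.out M ≫ k c ≫ cutIncl c.out N

/-- By orthogonality an element of the piece d is killed by all the other projections, so only the
term of d survives in the sum. -/
lemma assemble_cutIncl {M N : Mackey G}
    (k : ∀ c : Quotient (conjSetoid G), cut c.out M ⟶ cut c.out N) (d : Quotient (conjSetoid G))
    {K : Subgroup G} (x : (cut d.out M).obj K) :
    (assemble k).app K ((cutIncl d.out M).app K x) = (cutIncl d.out N).app K ((k d).app K x) := by
  have h : ∀ c : Quotient (conjSetoid G), c ≠ d →
      (cutIncl c.out N).app K ((k c).app K ((cutProj c.out M).app K ((cutIncl d.out M).app K x))) =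
        0 := fun c hc => by
    rw [cutProj_app_eq_zero hc, map_zero, map_zero]
  have h' : (cutProj d.out M).app K ((cutIncl d.out M).app K x) = x :=
    Subtype.ext (mem_cutObj.1 x.2)
  refine (sumHom_app _ _).trans ?_
  simp only [comp_app]
  rw [Finset.sum_eq_single d (fun c _ hc => h c hc) fun h => absurd (Finset.mem_univ _) h, h']

/-- A family of morphisms between the pieces is assembled into one morphism; `assemble_cutIncl` says
that its components are the given ones. -/
instance (G : Type) [Group G] [Finite G] : (splitting G).Full where
  map_surjective {M N} h := by
    let k : ∀ c : Quotient (conjSetoid G), cut c.out M ⟶ cut c.out N := fun c => (h c).hom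
    refine ⟨assemble k, ?_⟩
    funext d
    exact ObjectProperty.hom_ext _ <| hom_ext fun K x => cut_ext (assemble_cutIncl k d x)

/-- The product of a family of Mackey functors, without the Mackey axiom. -/
def prePi {ι : Type} (M : ι → Mackey G) : PreMackey G where
  obj K := ∀ i, (M i).obj K
  res h := LinearMap.pi fun i => (M i).res h ∘ₗ LinearMap.proj i
  ind h := LinearMap.pi fun i => (M i).ind h ∘ₗ LinearMap.proj i
  conj g _ _ e := LinearMap.pi fun i => (M i).conj g e ∘ₗ LinearMap.proj i
  res_self x := funext fun i => (M i).res_self (x i)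
  ind_self x := funext fun i => (M i).ind_self (x i)
  conj_self h e x := funext fun i => (M i).conj_self h e (x i)
  ind_ind h₁ h₂ x := funext fun i => (M i).ind_ind h₁ h₂ (x i)
  res_res h₁ h₂ x := funext fun i => (M i).res_res h₁ h₂ (x i)
  conj_conj g h _ _ _ e₁ e₂ e₃ x := funext fun i => (M i).conj_conj g h e₁ e₂ e₃ (x i)
  conj_res g _ _ _ _ eK eH h h' x := funext fun i => (M i).conj_res g eK eH h h' (x i)
  conj_ind g _ _ _ _ eK eH h h' x := funext fun i => (M i).conj_ind g eK eH h h' (x i)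

/-- The product of a family of Mackey functors. -/
def piMackey {ι : Type} (M : ι → Mackey G) : Mackey G where
  toPreMackey := prePi M
  mackey {K L J} hK hL y := funext fun i => by
    refine ((M i).mackey hK hL (y i)).trans ?_
    exact (map_sum (LinearMap.proj i : (∀ i, (M i).obj K) →ₗ[ℚ] (M i).obj K)
      (fun q : DoubleCoset.Quotient (K.subgroupOf J : Set J) (L.subgroupOf J : Set J) =>
        (prePi M).ind (inf_le_left : K ⊓ conjSub (q.out : G) L ≤ K)
          ((prePi M).conj (q.out : G) (inf_conjSub (q.out : G) K L)
            ((prePi M).res (inf_le_left : L ⊓ conjSub (q.out : G)⁻¹ K ≤ L) y))) _).symm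

/-- The projections of a product of Mackey functors. -/
def piProj {ι : Type} (M : ι → Mackey G) (i : ι) : piMackey M ⟶ M i where
  app _ := LinearMap.proj i
  app_res _ _ := rfl
  app_ind _ _ := rfl
  app_conj _ _ _ _ _ := rfl

/-! ### The splitting is essentially surjective -/

lemma piMackey_ext {ι : Type} {M : ι → Mackey G} {K : Subgroup G} {x y : (piMackey M).obj K}
    (h : ∀ i, (piProj M i).app K x = (piProj M i).app K y) : x = y := funext h

/-- On the product of the M_d the idempotent e_c acts as the identity in the factor M_c and as zero
in all others, so it cuts out precisely M_c. -/
lemma cutIncl_piProj_bijective (M : ∀ c : Quotient (conjSetoid G), EMack c.out)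
    (c : Quotient (conjSetoid G)) (K : Subgroup G) :
    Function.Bijective
      ((cutIncl c.out (piMackey fun d => (M d).obj) ≫ piProj _ c).app K) := by
  classical
  refine ⟨(injective_iff_map_eq_zero _).2 fun x hx => cut_ext (piMackey_ext fun d => ?_),
    fun y => ?_⟩
  · rw [map_zero, map_zero]
    by_cases hd : c = d
    · subst hd
      exact hx
    · rw [← act_cut, act_app, isCut.act_eq_zero hd (M d).property]
  -- The preimage of y is the family with y in place c and zero elsewhere, which R_K(e_c) fixes.
  · let z : (piMackey fun d => (M d).obj).obj K :=
      (Pi.single c y : ∀ d, (M d).obj.obj K)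
    refine ⟨⟨z, mem_cutObj.2 (piMackey_ext fun d => ?_)⟩,
      Pi.single_eq_same (M := fun d => (M d).obj.obj K) c y⟩
    rw [act_app]
    by_cases hd : c = d
    · subst hd
      exact isCut_iff.1 (M c).property K _
    · rw [isCut.act_eq_zero hd (M d).property]
      exact (Pi.single_eq_of_ne (M := fun d => (M d).obj.obj K) (Ne.symm hd) y).symm

/-- A family (M_c) is the image of its product, and the isomorphisms of the components are the
projections restricted to the pieces. -/
instance (G : Type) [Group G] [Finite G] : (splitting G).EssSurj where
  mem_essImage M := ⟨piMackey fun c => (M c).obj, ⟨Pi.isoMk fun c =>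
    ObjectProperty.isoMk _ (isoOfBijective _ (cutIncl_piProj_bijective M c))⟩⟩

end Mackey

end

end RatMackey

theorem mainTheorem6 (G : Type) [Group G] [Finite G] :
    (∀ H : Subgroup G, ∃ (adj : U H ⊣ F H) (_ : (U H).Braided) (_ : (F H).Braided),
      (U H).IsEquivalence ∧ adj.IsMonoidal ∧
        ∀ (M N : EMack H) (x : M.obj.obj H) (y : N.obj.obj H),
          (Functor.LaxMonoidal.μ (U H) M N).hom (x ⊗ₜ[ℚ] y) = tmul x y) ∧
    ((splitting G).IsEquivalence ∧ ∃ _ : (splitting G).Braided,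
      ∀ (M N : Mackey G) (c : Quotient (conjSetoid G)),
        (Functor.LaxMonoidal.μ (splitting G) M N c).hom ≫ cutIncl c.out (M ⊗ N) =
          cutIncl c.out M ⊗ₘ cutIncl c.out N) :=
  -- The empty structure collects the instances for full, faithful and essentially surjective. The
  -- monoidal structure of the splitting is componentwise `cutTensor`, so its description through
  -- the inclusions is `cutTensor_cutIncl`.
  ⟨exists_braided_adjunction, { }, braidedSplitting G, fun M N _ => cutTensor_cutIncl M N⟩
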